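/- Let $L>0$, $\gamma\in\mathbb R$, $N\ge 0$, $J=[-L/2,L/2]$ and $\mathfrak h_N=L^2(J^N)$. For $\lambda\in\mathbb C$ and a tuple $i=(i_1,\dots,i_n)$ of distinct elements of $\{1,\dots,N\}$ write $\phi_{i\to y}f(x)$ for the value of $f$ at the point obtained from $x$ by replacing $x_{i_m}$ by $y_m$ ($m=1,\dots,n$), and $\theta(P)=1$ if $P$ holds, $0$ otherwise. The following formulae define bounded operators $b^\pm_\lambda:\mathfrak h_N\to\mathfrak h_{N+1}$ and $a_\lambda,d_\lambda:\mathfrak h_N\to\mathfrak h_N$: $$(b^-_\lambda f)(x_1,\dots,x_{N+1})=e^{\mathrm i\lambda x_{N+1}}\sum_{n\ge0}\gamma^n\sum_{i}\theta(x_{N+1}>x_{i_1}>\dots>x_{i_n})\Big(\prod_{m=1}^n\int_{x_{i_m}}^{x_{i_{m-1}}}dy_m\,e^{\mathrm i\lambda(x_{i_m}-y_m)}\Big)(\phi_{i\to y}f)(x_1,\dots,x_N),\quad x_{i_0}:=x_{N+1},$$ $$(d_\lambda f)(x)=e^{\mathrm i\lambda L/2}\sum_{n\ge0}\gamma^n\sum_{i}\theta(x_{i_1}>\dots>x_{i_n})\Big(\prod_{m=1}^n\int_{x_{i_m}}^{x_{i_{m-1}}}dy_m\,e^{\mathrm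 i\lambda(x_{i_m}-y_m)}\Big)(\phi_{i\to y}f)(x),\quad x_{i_0}:=L/2,$$ $$(a_\lambda f)(x)=e^{-\mathrm i\lambda L/2}\sum_{n\ge0}\gamma^n\sum_{i}\theta(x_{i_1}>\dots>x_{i_n})\Big(\prod_{m=1}^n\int_{x_{i_{m+1}}}^{x_{i_m}}dy_m\,e^{\mathrm i\lambda(x_{i_m}-y_m)}\Big)(\phi_{i\to y}f)(x),\quad x_{i_{n+1}}:=-L/2,$$ and, for $x=(x_0,x')$ with $x_0\in J$ and $x'=(x'_1,\dots,x'_N)\in J^N$, $$(b^+_\lambda f)(x_0,x')=e^{\mathrm i\lambda x_0}\sum_{n\ge0}\gamma^n\sum_{i}\theta(x'_{i_1}>\dots>x'_{i_n}>x_0)\Big(\prod_{m=1}^n\int_{x'_{i_{m+1}}}^{x'_{i_m}}dy_m\,e^{\mathrm i\lambda(x'_{i_m}-y_m)}\Big)(\phi_{i\to y}f)(x'),\quad x'_{i_{n+1}}:=x_0 .$$ Let $S_N$ act on functions on $\mathbb R^N$ by permuting coordinates, $(wf)(x)=f(w^{-1}x)$; let $s_j$ be the transposition of $x_j,x_{j+1}$,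 and $s_{j,\gamma}=s_j+\gamma I_j$ with $(I_jf)(x)=\int_0^{x_j-x_{j+1}}f(x-y(e_j-e_{j+1}))\,dy$. For $w=s_{j_1}\cdots s_{j_l}\in S_N$ put $w_\gamma=s_{j_1,\gamma}\cdots s_{j_l,\gamma}$ (on continuous functions this does not depend on the decomposition). For $\boldsymbol\lambda\in\mathbb C^N$ the pre-wavefunction is $\psi_{\boldsymbol\lambda}=\sum_{w\in S_N}\chi_{w^{-1}\mathbb R^N_+}\,w^{-1}w_\gamma\,e^{\mathrm i\boldsymbol\lambda}$, where $e^{\mathrm i\boldsymbol\lambda}(x)=e^{\mathrm i\sum_j\lambda_jx_j}$ and $\mathbb R^N_+=\{x_1>\dots>x_N\}$. Let $\mathfrak z_N\subset\mathfrak h_N$ be the closed linear span of all $\psi_{\boldsymbol\lambda}$, $\boldsymbol\lambda\in\mathbb C^N$. For an entire function $F$ of two complex momenta with values in a normed space put $$(\tilde s_\gamma F)(\mu,\nu)=F(\nu,\mu)-\mathrm i\gamma\,\frac{F(\mu,\nu)-F(\nu,\mu)}{\mu-\nu},$$ where for $\mu=\nu$ the quotient is understood as its limit along $(\mu+\varepsilon,\nu-\varepsilon)$,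 $\varepsilon\to0$. Write $\tilde s_{N+1,\gamma}$ for $\tilde s_\gamma$ acting in the variables $(\lambda_{N+1},\lambda_{N+2})$ and $\tilde s_{1,\gamma}$ for $\tilde s_\gamma$ acting in $(\lambda_1,\lambda_2)$. **Theorem.** The operators $a_\lambda,b^\pm_\lambda,d_\lambda$ depend holomorphically (in operator norm) on $\lambda\in\mathbb C$; $b^\pm_\lambda$ map $\mathfrak z_N$ into $\mathfrak z_{N+1}$, and $a_\lambda,d_\lambda$ map $\mathfrak z_N$ into $\mathfrak z_N$. For all $\lambda_1,\lambda_2,\lambda_{N+1},\lambda_{N+2}\in\mathbb C$ we have $$s_{N+1}b^-_{\lambda_{N+2}}b^-_{\lambda_{N+1}}=\big(\tilde s_{N+1,\gamma}\,b^-_{\lambda_{N+2}}b^-_{\lambda_{N+1}}\big),\qquad s_1b^+_{\lambda_1}b^+_{\lambda_2}=\big(\tilde s_{1,\gamma}\,b^+_{\lambda_1}b^+_{\lambda_2}\big)\qquad\text{in }\mathrm{Hom}(\mathfrak z_N,\mathfrak z_{N+2}),$$ and, in $\mathrm{Hom}(\mathfrak z_N,\mathfrak z_{N+1})$, $$b^-_{\lambda_{N+2}}d_{\lambda_{N+1}}=\big(\tilde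 s_{N+1,\gamma}\,d_{\lambda_{N+2}}b^-_{\lambda_{N+1}}\big),\qquad b^+_{\lambda_1}a_{\lambda_2}=\big(\tilde s_{1,\gamma}\,a_{\lambda_1}b^+_{\lambda_2}\big),$$ $$d_{\lambda_{N+2}}b^-_{\lambda_{N+1}}=\big(\tilde s_{N+1,\gamma}\,b^-_{\lambda_{N+2}}d_{\lambda_{N+1}}\big),\qquad a_{\lambda_1}b^+_{\lambda_2}=\big(\tilde s_{1,\gamma}\,b^+_{\lambda_1}a_{\lambda_2}\big).$$ -/

import Mathlib

open MeasureTheory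
open scoped ENNReal NNReal

noncomputable section

namespace QNLS

/-! ### The Hilbert spaces `L²(J^N)` with `J = [-L/2, L/2]` -/

/-- Lebesgue measure on the cube `J^N`, `J = [-L/2, L/2]`, as a measure on `ℝ^N`. -/
def cubeMeasure (L : ℝ) (N : ℕ) : Measure (Fin N → ℝ) :=
  Measure.pi fun _ => (volume : Measure ℝ).restrict (Set.Icc (-(L / 2)) (L / 2))

instance (L : ℝ) (N : ℕ) : IsFiniteMeasure (cubeMeasure L N) := by
  unfold cubeMeasure; infer_instance

/-- The non-symmetric `N`-particle sector `𝔥_N = L²(J^N)`. -/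
abbrev Sector (L : ℝ) (N : ℕ) : Type := Lp ℂ 2 (cubeMeasure L N)

theorem ae_cube (L : ℝ) (N : ℕ) :
    ∀ᵐ x ∂(cubeMeasure L N), ∀ j, x j ∈ Set.Icc (-(L / 2)) (L / 2) := by
  rw [ae_all_iff]
  intro j
  have h : ∀ᵐ t ∂((volume : Measure ℝ).restrict (Set.Icc (-(L / 2)) (L / 2))),
      t ∈ Set.Icc (-(L / 2)) (L / 2) := ae_restrict_mem measurableSet_Icc
  exact (Measure.tendsto_eval_ae_ae (μ := fun _ : Fin N =>
    (volume : Measure ℝ).restrict (Set.Icc (-(L / 2)) (L / 2))) (i := j)).eventually h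

/-- The coordinate permutation `x ↦ x ∘ σ` preserves the measure of the cube. -/
theorem measurePreserving_perm (L : ℝ) (N : ℕ) (σ : Equiv.Perm (Fin N)) :
    MeasurePreserving (fun x : Fin N → ℝ => x ∘ σ) (cubeMeasure L N) (cubeMeasure L N) := by
  have h := measurePreserving_piCongrLeft (α := fun _ : Fin N => ℝ)
    (fun _ => (volume : Measure ℝ).restrict (Set.Icc (-(L / 2)) (L / 2))) σ.symm
  have e : ⇑(MeasurableEquiv.piCongrLeft (fun _ : Fin N => ℝ) σ.symm)
      = fun x : Fin N → ℝ => x ∘ σ := by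
    funext x i
    rw [MeasurableEquiv.coe_piCongrLeft]
    have := Equiv.piCongrLeft_apply_apply (fun _ : Fin N => ℝ) σ.symm x (σ i)
    simpa using this
  rw [e] at h
  exact h

/-- The action of the transposition of the coordinates `j` and `k` on `𝔥_N`:
`(s_{jk} f)(x) = f(s_{jk} x)`. -/
def swapOp (L : ℝ) {N : ℕ} (j k : Fin N) : Sector L N →L[ℂ] Sector L N :=
  (Lp.compMeasurePreservingₗᵢ ℂ (fun x : Fin N → ℝ => x ∘ Equiv.swap j k)
    (measurePreserving_perm L N (Equiv.swap j k))).toContinuousLinearMap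

/-! ### Bounded operators given by a formula -/

/-- The formula `K`, which turns functions on `ℝ^N` into functions on `ℝ^M`, induces a bounded
linear operator `L²(J^N) → L²(J^M)`. -/
structure IsL2Bounded (L : ℝ) {N M : ℕ} (K : ((Fin N → ℝ) → ℂ) → (Fin M → ℝ) → ℂ) : Prop where
  memLp : ∀ f, MemLp f 2 (cubeMeasure L N) → MemLp (K f) 2 (cubeMeasure L M)
  bound : ∃ C : ℝ≥0, ∀ f, MemLp f 2 (cubeMeasure L N) →
    eLpNorm (K f) 2 (cubeMeasure L M) ≤ C * eLpNorm f 2 (cubeMeasure L N)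
  congr : ∀ f g, f =ᵐ[cubeMeasure L N] g → K f =ᵐ[cubeMeasure L M] K g
  add : ∀ f g, MemLp f 2 (cubeMeasure L N) → MemLp g 2 (cubeMeasure L N) →
    K (f + g) =ᵐ[cubeMeasure L M] K f + K g
  smul : ∀ (c : ℂ) f, MemLp f 2 (cubeMeasure L N) → K (c • f) =ᵐ[cubeMeasure L M] c • K f

/-- The bounded operator `L²(J^N) → L²(J^M)` sending the class of `f` to the class of `K f`. -/
def opOf (L : ℝ) {N M : ℕ} (K : ((Fin N → ℝ) → ℂ) → (Fin M → ℝ) → ℂ) (h : IsL2Bounded L K) :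
    Sector L N →L[ℂ] Sector L M :=
  LinearMap.mkContinuousOfExistsBound
    { toFun := fun f => (h.memLp f (Lp.memLp f)).toLp (K f)
      map_add' := fun f g => by
        rw [← MemLp.toLp_add]
        apply MemLp.toLp_congr
        exact (h.congr _ _ (Lp.coeFn_add f g)).trans (h.add _ _ (Lp.memLp f) (Lp.memLp g))
      map_smul' := fun c f => by
        rw [RingHom.id_apply, ← MemLp.toLp_const_smul]
        apply MemLp.toLp_congr
        exact (h.congr _ _ (Lp.coeFn_smul c f)).trans (h.smul c _ (Lp.memLp f)) }
    (by
      obtain ⟨C, hC⟩ := h.bound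
      refine ⟨C, fun f => ?_⟩
      simp only [LinearMap.coe_mk, AddHom.coe_mk]
      rw [Lp.norm_toLp, Lp.norm_def]
      have h2 := ENNReal.toReal_mono
        (ENNReal.mul_ne_top ENNReal.coe_ne_top (Lp.memLp f).eLpNorm_ne_top)
        (hC f (Lp.memLp f))
      simpa [ENNReal.toReal_mul] using h2)

/-- The operator `opOf` is computed by its formula on every representative. -/
theorem opOf_toLp (L : ℝ) {N M : ℕ} (K : ((Fin N → ℝ) → ℂ) → (Fin M → ℝ) → ℂ)
    (h : IsL2Bounded L K) (f : (Fin N → ℝ) → ℂ) (hf : MemLp f 2 (cubeMeasure L N)) :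
    opOf L K h (hf.toLp f) = (h.memLp f hf).toLp (K f) :=
  MemLp.toLp_congr (h.memLp _ (Lp.memLp _)) (h.memLp f hf) (h.congr _ _ hf.coeFn_toLp)

/-- Pushing the product measure of the cube forward along a map `z ↦ z ∘ ρ`, `ρ` injective. -/
theorem map_comp_pi (L : ℝ) {ι : Type*} [Fintype ι] {N : ℕ} (ρ : Fin N → ι)
    (hρ : Function.Injective ρ) :
    ∃ c : ℝ≥0∞, c ≠ ∞ ∧
      (Measure.pi fun _ : ι => (volume : Measure ℝ).restrict (Set.Icc (-(L / 2)) (L / 2))).map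
        (fun z => z ∘ ρ) = c • cubeMeasure L N := by
  classical
  set m := (volume : Measure ℝ).restrict (Set.Icc (-(L / 2)) (L / 2)) with hm
  have hmeas : Measurable (fun z : ι → ℝ => z ∘ ρ) :=
    measurable_pi_lambda _ fun j => measurable_pi_apply _
  have hbox : ∀ s : Fin N → Set ℝ, (∀ j, MeasurableSet (s j)) →
      (Measure.pi fun _ : ι => m).map (fun z => z ∘ ρ) (Set.pi Set.univ s)
        = m Set.univ ^ (Finset.univ.filter fun z => z ∉ Set.range ρ).card * ∏ j, m (s j) := by
    intro s hs
    rw [Measure.map_apply hmeas (MeasurableSet.univ_pi hs)]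
    have e : (fun z : ι → ℝ => z ∘ ρ) ⁻¹' (Set.pi Set.univ s)
        = Set.pi Set.univ (Function.extend ρ s fun _ => Set.univ) := by
      ext z
      simp only [Set.mem_preimage, Set.mem_pi, Set.mem_univ, true_implies, Function.comp]
      constructor
      · intro h i
        by_cases hi : ∃ j, ρ j = i
        · obtain ⟨j, rfl⟩ := hi
          rw [hρ.extend_apply]; exact h j
        · rw [Function.extend_apply' _ _ _ hi]; trivial
      · intro h j
        have := h (ρ j)
        rwa [hρ.extend_apply] at this
    rw [e, Measure.pi_pi]
    rw [← Finset.prod_filter_mul_prod_filter_not Finset.univ (fun z => z ∉ Set.range ρ)]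
    congr 1
    · rw [Finset.prod_congr rfl (g := fun _ => m Set.univ), Finset.prod_const]
      intro i hi
      rw [Function.extend_apply' _ _ _ (by simpa using hi)]
    · have : (Finset.univ.filter fun z => ¬ z ∉ Set.range ρ) = Finset.univ.image ρ := by
        ext z; simp
      rw [this, Finset.prod_image (fun a _ b _ h => hρ h)]
      simp [hρ.extend_apply]
  set c := m Set.univ ^ (Finset.univ.filter fun z => z ∉ Set.range ρ).card with hc
  have hctop : c ≠ ∞ := ENNReal.pow_ne_top (measure_ne_top _ _)
  refine ⟨c, hctop, ?_⟩
  by_cases h0 : c = 0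
  · rw [h0, zero_smul]
    have := hbox (fun _ => Set.univ) (fun _ => MeasurableSet.univ)
    rw [h0, zero_mul, Set.pi_univ] at this
    exact Measure.measure_univ_eq_zero.mp this
  · have : cubeMeasure L N = c⁻¹ • (Measure.pi fun _ : ι => m).map (fun z => z ∘ ρ) := by
      refine Measure.pi_eq fun s hs => ?_
      rw [Measure.smul_apply, hbox s hs, smul_eq_mul, ← mul_assoc,
        ENNReal.inv_mul_cancel h0 hctop, one_mul]
    rw [this, smul_smul, ENNReal.mul_inv_cancel h0 hctop, one_smul]

/-- The replacement operation `φ_{i → y}` on points: the coordinates `i_1, …, i_n` of `x` are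
replaced by `y_1, …, y_n`. -/
def replace {N n : ℕ} (i : Fin n ↪ Fin N) (y : Fin n → ℝ) (x : Fin N → ℝ) : Fin N → ℝ :=
  Function.extend i y x

/-- Measurability and push-forward of the map `(x, y) ↦ φ_{i → y} (x ∘ e)`. -/
theorem map_replace (L : ℝ) {N M n : ℕ} (e : Fin N ↪ Fin M) (i : Fin n ↪ Fin N) :
    Measurable (fun p : (Fin M → ℝ) × (Fin n → ℝ) => replace i p.2 (p.1 ∘ e)) ∧
    ∃ c : ℝ≥0∞, c ≠ ∞ ∧
      ((cubeMeasure L M).prod (cubeMeasure L n)).map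
        (fun p : (Fin M → ℝ) × (Fin n → ℝ) => replace i p.2 (p.1 ∘ e)) = c • cubeMeasure L N := by
  classical
  let ρ : Fin N → Fin M ⊕ Fin n :=
    fun j => if h : ∃ m, i m = j then Sum.inr h.choose else Sum.inl (e j)
  have hρi : ∀ m, ρ (i m) = Sum.inr m := by
    intro m
    have h : ∃ m', i m' = i m := ⟨m, rfl⟩
    simp only [ρ, dif_pos h]
    exact congrArg _ (i.injective h.choose_spec)
  have hρe : ∀ j, (¬ ∃ m, i m = j) → ρ j = Sum.inl (e j) := fun j h => by simp only [ρ, dif_neg h]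
  have hρ : Function.Injective ρ := by
    intro a b hab
    by_cases ha : ∃ m, i m = a <;> by_cases hb : ∃ m, i m = b
    · obtain ⟨m, rfl⟩ := ha; obtain ⟨m', rfl⟩ := hb
      rw [hρi, hρi] at hab; rw [Sum.inr.inj hab]
    · obtain ⟨m, rfl⟩ := ha
      rw [hρi, hρe b hb] at hab; cases hab
    · obtain ⟨m, rfl⟩ := hb
      rw [hρi, hρe a ha] at hab; cases hab
    · rw [hρe a ha, hρe b hb] at hab
      exact e.injective (Sum.inl.inj hab)
  let E := (MeasurableEquiv.sumPiEquivProdPi (fun _ : Fin M ⊕ Fin n => ℝ)).symm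
  have hE := measurePreserving_sumPiEquivProdPi_symm
    (fun _ : Fin M ⊕ Fin n => (volume : Measure ℝ).restrict (Set.Icc (-(L / 2)) (L / 2)))
  have hcomp : (fun p : (Fin M → ℝ) × (Fin n → ℝ) => replace i p.2 (p.1 ∘ e))
      = (fun z : Fin M ⊕ Fin n → ℝ => z ∘ ρ) ∘ E := by
    funext p j
    by_cases hj : ∃ m, i m = j
    · obtain ⟨m, rfl⟩ := hj
      simp only [replace, i.injective.extend_apply, Function.comp, hρi]
      rfl
    · simp only [replace, Function.extend_apply' _ _ _ hj, Function.comp, hρe j hj]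
      rfl
  have hmeas : Measurable (fun z : Fin M ⊕ Fin n → ℝ => z ∘ ρ) :=
    measurable_pi_lambda _ fun j => measurable_pi_apply _
  refine ⟨hcomp ▸ hmeas.comp E.measurable, ?_⟩
  obtain ⟨c, hc, h⟩ := map_comp_pi L ρ hρ
  refine ⟨c, hc, ?_⟩
  rw [hcomp, ← h, ← Measure.map_map hmeas E.measurable]
  congr 1
  exact hE.map_eq

theorem eLpNorm_integral_prod_le {X Y : Type*} [MeasurableSpace X] [MeasurableSpace Y]
    (μ : Measure X) (ν : Measure Y) [IsFiniteMeasure μ] [IsFiniteMeasure ν] (G : X × Y → ℂ)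
    (hG : AEStronglyMeasurable G (μ.prod ν)) :
    eLpNorm (fun x => ∫ y, G (x, y) ∂ν) 2 μ
      ≤ ν Set.univ ^ (1 / 2 : ℝ) * eLpNorm G 2 (μ.prod ν) := by
  have key : ∀ᵐ x ∂μ, ‖∫ y, G (x, y) ∂ν‖ₑ ^ (2 : ℝ)
      ≤ ν Set.univ * ∫⁻ y, ‖G (x, y)‖ₑ ^ (2 : ℝ) ∂ν := by
    filter_upwards [hG.prodMk_left] with x hx
    have h1 : ‖∫ y, G (x, y) ∂ν‖ₑ ≤ eLpNorm (fun y => G (x, y)) 1 ν := by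
      rw [eLpNorm_one_eq_lintegral_enorm]; exact enorm_integral_le_lintegral_enorm _
    have h2 := eLpNorm_le_eLpNorm_mul_rpow_measure_univ (p := 1) (q := 2) (μ := ν)
      (by norm_num) hx
    calc ‖∫ y, G (x, y) ∂ν‖ₑ ^ (2 : ℝ)
        ≤ (eLpNorm (fun y => G (x, y)) 2 ν * ν Set.univ ^ (1 / 2 : ℝ)) ^ (2 : ℝ) := by
          refine ENNReal.rpow_le_rpow (h1.trans (h2.trans (le_of_eq ?_))) (by norm_num)
          norm_num
      _ = ν Set.univ * ∫⁻ y, ‖G (x, y)‖ₑ ^ (2 : ℝ) ∂ν := by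
          rw [ENNReal.mul_rpow_of_nonneg _ _ (by norm_num), ← ENNReal.rpow_mul,
            eLpNorm_eq_lintegral_rpow_enorm_toReal (by norm_num) (by norm_num),
            ← ENNReal.rpow_mul]
          norm_num [mul_comm]
  rw [eLpNorm_eq_lintegral_rpow_enorm_toReal (by norm_num) (by norm_num),
    eLpNorm_eq_lintegral_rpow_enorm_toReal (by norm_num) (by norm_num),
    ENNReal.toReal_ofNat, ← ENNReal.mul_rpow_of_nonneg _ _ (by norm_num)]
  refine ENNReal.rpow_le_rpow ((lintegral_mono_ae key).trans (le_of_eq ?_)) (by norm_num)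
  rw [lintegral_const_mul' _ _ (measure_ne_top _ _), lintegral_prod _ (by fun_prop)]

/-- An integral formula with a bounded measurable kernel induces a bounded operator. -/
theorem isL2Bounded_of_kernel (L : ℝ) {N M n : ℕ} (e : Fin N ↪ Fin M) (i : Fin n ↪ Fin N)
    (K : ((Fin N → ℝ) → ℂ) → (Fin M → ℝ) → ℂ) (κ : (Fin M → ℝ) × (Fin n → ℝ) → ℂ)
    (hκ : Measurable κ) (C : ℝ)
    (hC : ∀ᵐ p ∂((cubeMeasure L M).prod (cubeMeasure L n)), ‖κ p‖ ≤ C)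
    (hK : ∀ x : Fin M → ℝ, (∀ j, x j ∈ Set.Icc (-(L / 2)) (L / 2)) → ∀ f,
      K f x = ∫ y, κ (x, y) * f (replace i y (x ∘ e)) ∂(cubeMeasure L n)) :
    IsL2Bounded L K := by
  obtain ⟨hr, c, hc, hmap⟩ := map_replace L e i
  have hK' : ∀ f, K f =ᵐ[cubeMeasure L M]
      fun x => ∫ y, κ (x, y) * f (replace i y (x ∘ e)) ∂(cubeMeasure L n) := fun f => by
    filter_upwards [ae_cube L M] with x hx using hK x hx f
  have hcomp : ∀ f, MemLp f 2 (cubeMeasure L N) →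
      MemLp (fun p : (Fin M → ℝ) × (Fin n → ℝ) => f (replace i p.2 (p.1 ∘ e))) 2
        ((cubeMeasure L M).prod (cubeMeasure L n)) := fun f hf => by
    have h : MemLp f 2 (c • cubeMeasure L N) := MemLp.smul_measure (ε := ℂ) hf hc
    rw [← hmap] at h
    exact h.comp_of_map hr.aemeasurable
  have hnorm : ∀ f, MemLp f 2 (cubeMeasure L N) →
      eLpNorm (fun p : (Fin M → ℝ) × (Fin n → ℝ) => f (replace i p.2 (p.1 ∘ e))) 2
        ((cubeMeasure L M).prod (cubeMeasure L n))
        = c ^ (1 / 2 : ℝ) * eLpNorm f 2 (cubeMeasure L N) := fun f hf => by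
    have h : MemLp f 2 (c • cubeMeasure L N) := MemLp.smul_measure (ε := ℂ) hf hc
    rw [← hmap] at h
    have h2 := eLpNorm_map_measure (p := 2) h.aestronglyMeasurable hr.aemeasurable
    rw [hmap, eLpNorm_smul_measure_of_ne_top (by norm_num)] at h2
    rw [show (fun p : (Fin M → ℝ) × (Fin n → ℝ) => f (replace i p.2 (p.1 ∘ e)))
      = f ∘ (fun p : (Fin M → ℝ) × (Fin n → ℝ) => replace i p.2 (p.1 ∘ e)) from rfl, ← h2]
    simp
  have hmul : ∀ f, MemLp f 2 (cubeMeasure L N) →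
      MemLp (fun p : (Fin M → ℝ) × (Fin n → ℝ) => κ p * f (replace i p.2 (p.1 ∘ e))) 2
        ((cubeMeasure L M).prod (cubeMeasure L n)) := fun f hf => by
    refine (hcomp f hf).of_le_mul (c := C)
      (hκ.aestronglyMeasurable.mul (hcomp f hf).aestronglyMeasurable) ?_
    filter_upwards [hC] with p hp
    rw [norm_mul]
    exact mul_le_mul_of_nonneg_right hp (norm_nonneg _)
  have hbd : ∀ f, MemLp f 2 (cubeMeasure L N) → eLpNorm (K f) 2 (cubeMeasure L M)
      ≤ (cubeMeasure L n Set.univ ^ (1 / 2 : ℝ) * (ENNReal.ofReal C * c ^ (1 / 2 : ℝ)))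
        * eLpNorm f 2 (cubeMeasure L N) := fun f hf => by
    rw [eLpNorm_congr_ae (hK' f)]
    refine (eLpNorm_integral_prod_le _ _ _ (hmul f hf).aestronglyMeasurable).trans ?_
    rw [mul_assoc, mul_assoc, ← hnorm f hf]
    gcongr
    refine eLpNorm_le_mul_eLpNorm_of_ae_le_mul ?_ 2
    filter_upwards [hC] with p hp
    rw [norm_mul]
    exact mul_le_mul_of_nonneg_right hp (norm_nonneg _)
  have hCtop : cubeMeasure L n Set.univ ^ (1 / 2 : ℝ) * (ENNReal.ofReal C * c ^ (1 / 2 : ℝ)) ≠ ∞ :=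
    ENNReal.mul_ne_top (ENNReal.rpow_ne_top_of_nonneg (by norm_num) (measure_ne_top _ _))
      (ENNReal.mul_ne_top ENNReal.ofReal_ne_top (ENNReal.rpow_ne_top_of_nonneg (by norm_num) hc))
  have hint : ∀ f, MemLp f 2 (cubeMeasure L N) → ∀ᵐ x ∂(cubeMeasure L M),
      Integrable (fun y => κ (x, y) * f (replace i y (x ∘ e))) (cubeMeasure L n) := fun f hf =>
    ((hmul f hf).integrable (by norm_num)).prod_right_ae
  refine ⟨fun f hf => ⟨?_, ?_⟩, ⟨(cubeMeasure L n Set.univ ^ (1 / 2 : ℝ) *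
      (ENNReal.ofReal C * c ^ (1 / 2 : ℝ))).toNNReal, fun f hf => ?_⟩,
    fun f g hfg => ?_, fun f g hf hg => ?_, fun a f hf => ?_⟩
  · exact (hmul f hf).aestronglyMeasurable.integral_prod_right'.congr (hK' f).symm
  · exact (hbd f hf).trans_lt (ENNReal.mul_lt_top hCtop.lt_top hf.eLpNorm_lt_top)
  · rw [ENNReal.coe_toNNReal hCtop]
    exact hbd f hf
  · have h1 : ∀ᵐ p ∂((cubeMeasure L M).prod (cubeMeasure L n)),
        f (replace i p.2 (p.1 ∘ e)) = g (replace i p.2 (p.1 ∘ e)) := by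
      refine ae_of_ae_map (f := fun p : (Fin M → ℝ) × (Fin n → ℝ) => replace i p.2 (p.1 ∘ e))
        (p := fun z => f z = g z) hr.aemeasurable ?_
      rw [hmap]
      exact Measure.ae_smul_measure hfg c
    filter_upwards [hK' f, hK' g, Measure.ae_ae_of_ae_prod h1] with x hf hg hx
    rw [hf, hg]
    refine integral_congr_ae ?_
    filter_upwards [hx] with y hy
    rw [hy]
  · filter_upwards [hK' f, hK' g, hK' (f + g), hint f hf, hint g hg] with x h1 h2 h3 h4 h5
    rw [Pi.add_apply, h1, h2, h3, ← integral_add h4 h5]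
    simp [mul_add]
  · filter_upwards [hK' f, hK' (a • f)] with x h1 h2
    rw [Pi.smul_apply, h1, h2, smul_eq_mul, ← integral_const_mul]
    simp [mul_left_comm]

/-! ### Elementary integral operators -/

/-- The unit step function of a proposition. -/
def theta (p : Prop) : ℂ := open Classical in if p then 1 else 0

/-- `∏_m ∫ dy_m e^{i l (x_{i_m} - y_m)} φ_{i → y} f`, the integration being over `y ∈ B`. -/
def shiftIntegral {N n : ℕ} (l : ℂ) (i : Fin n ↪ Fin N) (B : Set (Fin n → ℝ))
    (f : (Fin N → ℝ) → ℂ) (x : Fin N → ℝ) : ℂ :=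
  ∫ y in B, (∏ m, Complex.exp (Complex.I * l * ((x (i m) : ℂ) - y m))) * f (replace i y x)

/-- The box `∏_{m=1}^n (v_{m+1}, v_m]`, where `v_{n+1} = t`. -/
def boxBelow {n : ℕ} (v : Fin n → ℝ) (t : ℝ) : Set (Fin n → ℝ) :=
  Set.pi Set.univ fun m => Set.Ioc ((Fin.snoc v t : Fin (n + 1) → ℝ) m.succ) (v m)

/-- The box `∏_{m=1}^n (v_m, v_{m-1}]`, where `v_0 = t`. -/
def boxAbove {n : ℕ} (t : ℝ) (v : Fin n → ℝ) : Set (Fin n → ℝ) :=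
  Set.pi Set.univ fun m => Set.Ioc (v m) ((Fin.cons t v : Fin (n + 1) → ℝ) m.castSucc)

/-- The formula for `ê⁺_{l;i}`; here `x' = (x_2, …, x_{N+1})` and `x'_{i_{n+1}} = x_1`. -/
def hatPlusFun {N n : ℕ} (l : ℂ) (i : Fin n ↪ Fin N) (f : (Fin N → ℝ) → ℂ)
    (x : Fin (N + 1) → ℝ) : ℂ :=
  Complex.exp (Complex.I * l * x 0) *
    theta (StrictAnti (Fin.snoc ((x ∘ Fin.succ) ∘ i) (x 0) : Fin (n + 1) → ℝ)) *
    shiftIntegral l i (boxBelow ((x ∘ Fin.succ) ∘ i) (x 0)) f (x ∘ Fin.succ)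

/-- The formula for `ê⁻_{l;i}`; here `x' = (x_1, …, x_N)` and `x'_{i_0} = x_{N+1}`. -/
def hatMinusFun {N n : ℕ} (l : ℂ) (i : Fin n ↪ Fin N) (f : (Fin N → ℝ) → ℂ)
    (x : Fin (N + 1) → ℝ) : ℂ :=
  Complex.exp (Complex.I * l * x (Fin.last N)) *
    theta (StrictAnti
      (Fin.cons (x (Fin.last N)) ((x ∘ Fin.castSucc) ∘ i) : Fin (n + 1) → ℝ)) *
    shiftIntegral l i (boxAbove (x (Fin.last N)) ((x ∘ Fin.castSucc) ∘ i)) f (x ∘ Fin.castSucc)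

/-- The formula for `ē⁺_{l;i}`, where `x_{i_{n+1}} = -L/2`. -/
def barPlusFun (L : ℝ) {N n : ℕ} (l : ℂ) (i : Fin n ↪ Fin N) (f : (Fin N → ℝ) → ℂ)
    (x : Fin N → ℝ) : ℂ :=
  Complex.exp (-(Complex.I * l * L / 2)) * theta (StrictAnti (x ∘ i)) *
    shiftIntegral l i (boxBelow (x ∘ i) (-(L / 2))) f x

/-- The formula for `ē⁻_{l;i}`, where `x_{i_0} = L/2`. -/
def barMinusFun (L : ℝ) {N n : ℕ} (l : ℂ) (i : Fin n ↪ Fin N) (f : (Fin N → ℝ) → ℂ)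
    (x : Fin N → ℝ) : ℂ :=
  Complex.exp (Complex.I * l * L / 2) * theta (StrictAnti (x ∘ i)) *
    shiftIntegral l i (boxAbove (L / 2) (x ∘ i)) f x

theorem cubeMeasure_eq (L : ℝ) (N : ℕ) : cubeMeasure L N =
    (volume : Measure (Fin N → ℝ)).restrict
      (Set.pi Set.univ fun _ => Set.Icc (-(L / 2)) (L / 2)) := by
  rw [cubeMeasure, volume_pi, Measure.restrict_pi_pi]

theorem measurableSet_strictAnti {X : Type*} [MeasurableSpace X] {k : ℕ} (g : X → Fin k → ℝ)
    (hg : Measurable g) : MeasurableSet {x | StrictAnti (g x)} := by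
  have : {x | StrictAnti (g x)} = ⋂ a, ⋂ b, {x | a < b → g x b < g x a} := by
    ext x
    simp only [Set.mem_ofPred_eq, Set.mem_iInter]
    exact Iff.rfl
  rw [this]
  refine MeasurableSet.iInter fun a => MeasurableSet.iInter fun b => ?_
  by_cases h : a < b
  · simp only [h, true_implies]
    exact measurableSet_lt ((measurable_pi_apply b).comp hg) ((measurable_pi_apply a).comp hg)
  · simp [h]

theorem isL2Bounded_elementary (L : ℝ) {N M n : ℕ} (e : Fin N ↪ Fin M) (i : Fin n ↪ Fin N)
    (l : ℂ) (pre : (Fin M → ℝ) → ℂ) (hpre : Continuous pre) (Q : (Fin M → ℝ) → Prop)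
    (hQ : MeasurableSet {x | Q x}) (lo hi : (Fin M → ℝ) → Fin n → ℝ) (hlo : Measurable lo)
    (hhi : Measurable hi)
    (hsub : ∀ x : Fin M → ℝ, (∀ j, x j ∈ Set.Icc (-(L / 2)) (L / 2)) →
      ∀ m, -(L / 2) ≤ lo x m ∧ hi x m ≤ L / 2) :
    IsL2Bounded L fun (f : (Fin N → ℝ) → ℂ) x => pre x * theta (Q x) *
      shiftIntegral l i (Set.pi Set.univ fun m => Set.Ioc (lo x m) (hi x m)) f (x ∘ e) := by
  classical
  let S : Set ((Fin M → ℝ) × (Fin n → ℝ)) :=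
    {p | Q p.1 ∧ ∀ m, p.2 m ∈ Set.Ioc (lo p.1 m) (hi p.1 m)}
  let F : (Fin M → ℝ) × (Fin n → ℝ) → ℂ := fun p =>
    pre p.1 * ∏ m, Complex.exp (Complex.I * l * ((p.1 (e (i m)) : ℂ) - p.2 m))
  have hF : Continuous F := by fun_prop
  have hS : MeasurableSet S := by
    refine (measurable_fst hQ).inter ?_
    have : {p : (Fin M → ℝ) × (Fin n → ℝ) | ∀ m, p.2 m ∈ Set.Ioc (lo p.1 m) (hi p.1 m)}
        = ⋂ m, ({p | lo p.1 m < p.2 m} ∩ {p | p.2 m ≤ hi p.1 m}) := by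
      ext p; simp
    change MeasurableSet
      {p : (Fin M → ℝ) × (Fin n → ℝ) | ∀ m, p.2 m ∈ Set.Ioc (lo p.1 m) (hi p.1 m)}
    rw [this]
    refine MeasurableSet.iInter fun m => (measurableSet_lt ?_ ?_).inter (measurableSet_le ?_ ?_)
    · exact (measurable_pi_apply m).comp (hlo.comp measurable_fst)
    · exact (measurable_pi_apply m).comp measurable_snd
    · exact (measurable_pi_apply m).comp measurable_snd
    · exact (measurable_pi_apply m).comp (hhi.comp measurable_fst)
  obtain ⟨C, hC⟩ := (((isCompact_univ_pi fun _ : Fin M =>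
    isCompact_Icc (a := -(L / 2)) (b := L / 2)).prod (isCompact_univ_pi fun _ : Fin n =>
    isCompact_Icc (a := -(L / 2)) (b := L / 2)))).exists_bound_of_continuousOn hF.continuousOn
  refine isL2Bounded_of_kernel L e i _ (S.indicator F) (hF.measurable.indicator hS) C ?_ ?_
  · have h1 := Measure.quasiMeasurePreserving_fst (μ := cubeMeasure L M) (ν := cubeMeasure L n)
      |>.ae (ae_cube L M)
    have h2 := Measure.quasiMeasurePreserving_snd (μ := cubeMeasure L M) (ν := cubeMeasure L n)
      |>.ae (ae_cube L n)
    filter_upwards [h1, h2] with p hp1 hp2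
    exact (norm_indicator_le_norm_self _ _).trans
      (hC p ⟨fun j _ => hp1 j, fun j _ => hp2 j⟩)
  · intro x hx f
    by_cases hq : Q x
    · have hB : MeasurableSet (Set.pi Set.univ fun m => Set.Ioc (lo x m) (hi x m)) :=
        MeasurableSet.univ_pi fun _ => measurableSet_Ioc
      have hBs : (Set.pi Set.univ fun m => Set.Ioc (lo x m) (hi x m)) ⊆
          Set.pi Set.univ fun _ : Fin n => Set.Icc (-(L / 2)) (L / 2) :=
        Set.pi_mono fun m _ t ht =>
          ⟨(hsub x hx m).1.trans ht.1.le, ht.2.trans (hsub x hx m).2⟩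
      have hind : ∀ y, S.indicator F (x, y) * f (replace i y (x ∘ e))
          = (Set.pi Set.univ fun m => Set.Ioc (lo x m) (hi x m)).indicator (fun y => pre x *
            ((∏ m, Complex.exp (Complex.I * l * (((x ∘ e) (i m) : ℂ) - y m))) *
              f (replace i y (x ∘ e)))) y := by
        intro y
        by_cases hy : y ∈ Set.pi Set.univ fun m => Set.Ioc (lo x m) (hi x m)
        · have hm : (x, y) ∈ S := ⟨hq, fun m => hy m (Set.mem_univ m)⟩
          rw [Set.indicator_of_mem hm, Set.indicator_of_mem hy]
          simp only [F, Function.comp, mul_assoc]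
        · have hm : (x, y) ∉ S := fun h => hy fun m _ => h.2 m
          rw [Set.indicator_of_notMem hm, Set.indicator_of_notMem hy, zero_mul]
      simp_rw [hind]
      rw [integral_indicator hB, cubeMeasure_eq, Measure.restrict_restrict hB,
        Set.inter_eq_left.mpr hBs, integral_const_mul]
      simp [theta, hq, shiftIntegral]
    · have hm : ∀ y, (x, y) ∉ S := fun y h => hq h.1
      simp [theta, hq, Set.indicator_of_notMem (hm _)]

theorem measurable_snoc {X : Type*} [MeasurableSpace X] {n : ℕ} (v : X → Fin n → ℝ) (t : X → ℝ)
    (hv : Measurable v) (ht : Measurable t) :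
    Measurable fun x => (Fin.snoc (v x) (t x) : Fin (n + 1) → ℝ) := by
  refine measurable_pi_lambda _ fun j => ?_
  refine Fin.lastCases ?_ (fun j => ?_) j
  · simpa using ht
  · simpa [Function.comp_def] using (measurable_pi_apply j).comp hv

theorem measurable_cons {X : Type*} [MeasurableSpace X] {n : ℕ} (v : X → Fin n → ℝ) (t : X → ℝ)
    (hv : Measurable v) (ht : Measurable t) :
    Measurable fun x => (Fin.cons (t x) (v x) : Fin (n + 1) → ℝ) := by
  refine measurable_pi_lambda _ fun j => ?_
  refine Fin.cases ?_ (fun j => ?_) j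
  · simpa using ht
  · simpa [Function.comp_def] using (measurable_pi_apply j).comp hv

theorem snoc_ge {n : ℕ} (v : Fin n → ℝ) (t a : ℝ) (hv : ∀ m, a ≤ v m) (ht : a ≤ t)
    (j : Fin (n + 1)) : a ≤ (Fin.snoc v t : Fin (n + 1) → ℝ) j := by
  refine Fin.lastCases ?_ (fun j => ?_) j
  · simpa using ht
  · simpa using hv j

theorem cons_le {n : ℕ} (v : Fin n → ℝ) (t a : ℝ) (hv : ∀ m, v m ≤ a) (ht : t ≤ a)
    (j : Fin (n + 1)) : (Fin.cons t v : Fin (n + 1) → ℝ) j ≤ a := by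
  refine Fin.cases ?_ (fun j => ?_) j
  · simpa using ht
  · simpa using hv j

theorem isL2Bounded_hatPlus (L : ℝ) {N n : ℕ} (l : ℂ) (i : Fin n ↪ Fin N) :
    IsL2Bounded L (hatPlusFun l i) := by
  have hv : Measurable fun x : Fin (N + 1) → ℝ => (x ∘ Fin.succ) ∘ i :=
    measurable_pi_lambda _ fun j => measurable_pi_apply _
  have hs := measurable_snoc _ _ hv (measurable_pi_apply (0 : Fin (N + 1)))
  exact isL2Bounded_elementary L ⟨Fin.succ, Fin.succ_injective N⟩ i l
    (fun x => Complex.exp (Complex.I * l * x 0)) (by fun_prop)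
    (fun x => StrictAnti (Fin.snoc ((x ∘ Fin.succ) ∘ i) (x 0) : Fin (n + 1) → ℝ))
    (measurableSet_strictAnti _ hs)
    (fun x m => (Fin.snoc ((x ∘ Fin.succ) ∘ i) (x 0) : Fin (n + 1) → ℝ) m.succ)
    (fun x => (x ∘ Fin.succ) ∘ i)
    (measurable_pi_lambda _ fun m => (measurable_pi_apply m.succ).comp hs) hv
    (fun x hx m => ⟨snoc_ge _ _ _ (fun _ => (hx _).1) (hx _).1 _, (hx _).2⟩)

theorem isL2Bounded_hatMinus (L : ℝ) {N n : ℕ} (l : ℂ) (i : Fin n ↪ Fin N) :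
    IsL2Bounded L (hatMinusFun l i) := by
  have hv : Measurable fun x : Fin (N + 1) → ℝ => (x ∘ Fin.castSucc) ∘ i :=
    measurable_pi_lambda _ fun j => measurable_pi_apply _
  have hs := measurable_cons _ _ hv (measurable_pi_apply (Fin.last N))
  exact isL2Bounded_elementary L ⟨Fin.castSucc, Fin.castSucc_injective N⟩ i l
    (fun x => Complex.exp (Complex.I * l * x (Fin.last N))) (by fun_prop)
    (fun x => StrictAnti
      (Fin.cons (x (Fin.last N)) ((x ∘ Fin.castSucc) ∘ i) : Fin (n + 1) → ℝ))
    (measurableSet_strictAnti _ hs)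
    (fun x => (x ∘ Fin.castSucc) ∘ i)
    (fun x m => (Fin.cons (x (Fin.last N)) ((x ∘ Fin.castSucc) ∘ i) : Fin (n + 1) → ℝ)
      m.castSucc) hv
    (measurable_pi_lambda _ fun m => (measurable_pi_apply m.castSucc).comp hs)
    (fun x hx m => ⟨(hx _).1, cons_le _ _ _ (fun _ => (hx _).2) (hx _).2 _⟩)

theorem isL2Bounded_barPlus (L : ℝ) {N n : ℕ} (l : ℂ) (i : Fin n ↪ Fin N) :
    IsL2Bounded L (barPlusFun L l i) := by
  have hv : Measurable fun x : Fin N → ℝ => x ∘ i :=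
    measurable_pi_lambda _ fun j => measurable_pi_apply _
  have hs := measurable_snoc _ (fun _ => -(L / 2)) hv measurable_const
  exact isL2Bounded_elementary L ⟨id, Function.injective_id⟩ i l
    (fun _ => Complex.exp (-(Complex.I * l * L / 2))) continuous_const
    (fun x => StrictAnti (x ∘ i)) (measurableSet_strictAnti _ hv)
    (fun x m => (Fin.snoc (x ∘ i) (-(L / 2)) : Fin (n + 1) → ℝ) m.succ) (fun x => x ∘ i)
    (measurable_pi_lambda _ fun m => (measurable_pi_apply m.succ).comp hs) hv
    (fun x hx m => ⟨snoc_ge _ _ _ (fun _ => (hx _).1) le_rfl _, (hx _).2⟩)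

theorem isL2Bounded_barMinus (L : ℝ) {N n : ℕ} (l : ℂ) (i : Fin n ↪ Fin N) :
    IsL2Bounded L (barMinusFun L l i) := by
  have hv : Measurable fun x : Fin N → ℝ => x ∘ i :=
    measurable_pi_lambda _ fun j => measurable_pi_apply _
  have hs := measurable_cons _ (fun _ => L / 2) hv measurable_const
  exact isL2Bounded_elementary L ⟨id, Function.injective_id⟩ i l
    (fun _ => Complex.exp (Complex.I * l * L / 2)) continuous_const
    (fun x => StrictAnti (x ∘ i)) (measurableSet_strictAnti _ hv)
    (fun x => x ∘ i) (fun x m => (Fin.cons (L / 2) (x ∘ i) : Fin (n + 1) → ℝ) m.castSucc) hv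
    (measurable_pi_lambda _ fun m => (measurable_pi_apply m.castSucc).comp hs)
    (fun x hx m => ⟨(hx _).1, cons_le _ _ _ (fun _ => (hx _).2) le_rfl _⟩)

/-- `ê⁺_{l;i} : 𝔥_N → 𝔥_{N+1}`. -/
def hatPlus (L : ℝ) {N n : ℕ} (l : ℂ) (i : Fin n ↪ Fin N) : Sector L N →L[ℂ] Sector L (N + 1) :=
  opOf L (hatPlusFun l i) (isL2Bounded_hatPlus L l i)

/-- `ê⁻_{l;i} : 𝔥_N → 𝔥_{N+1}`. -/
def hatMinus (L : ℝ) {N n : ℕ} (l : ℂ) (i : Fin n ↪ Fin N) : Sector L N →L[ℂ] Sector L (N + 1) :=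
  opOf L (hatMinusFun l i) (isL2Bounded_hatMinus L l i)

/-- `ē⁺_{l;i} : 𝔥_N → 𝔥_N`. -/
def barPlus (L : ℝ) {N n : ℕ} (l : ℂ) (i : Fin n ↪ Fin N) : Sector L N →L[ℂ] Sector L N :=
  opOf L (barPlusFun L l i) (isL2Bounded_barPlus L l i)

/-- `ē⁻_{l;i} : 𝔥_N → 𝔥_N`. -/
def barMinus (L : ℝ) {N n : ℕ} (l : ℂ) (i : Fin n ↪ Fin N) : Sector L N →L[ℂ] Sector L N :=
  opOf L (barMinusFun L l i) (isL2Bounded_barMinus L l i)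

/-! ### The operators `a_l`, `b^±_l`, `d_l`

An injective tuple `(i_1, …, i_n)` in `{1, …, N}` is an element of `Fin n ↪ Fin N`; there are none
for `n > N`. -/

/-- `a_l = ∑_n γ^n ∑_i ē⁺_{l;i}` on `𝔥_N`. -/
def opA (L γ : ℝ) (N : ℕ) (l : ℂ) : Sector L N →L[ℂ] Sector L N :=
  ∑ n ∈ Finset.range (N + 1), (γ : ℂ) ^ n • ∑ i : Fin n ↪ Fin N, barPlus L l i

/-- `b⁺_l = ∑_n γ^n ∑_i ê⁺_{l;i}` on `𝔥_N`. -/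
def opBPlus (L γ : ℝ) (N : ℕ) (l : ℂ) : Sector L N →L[ℂ] Sector L (N + 1) :=
  ∑ n ∈ Finset.range (N + 1), (γ : ℂ) ^ n • ∑ i : Fin n ↪ Fin N, hatPlus L l i

/-- `b⁻_l = ∑_n γ^n ∑_i ê⁻_{l;i}` on `𝔥_N`. -/
def opBMinus (L γ : ℝ) (N : ℕ) (l : ℂ) : Sector L N →L[ℂ] Sector L (N + 1) :=
  ∑ n ∈ Finset.range (N + 1), (γ : ℂ) ^ n • ∑ i : Fin n ↪ Fin N, hatMinus L l i

/-- `d_l = ∑_n γ^n ∑_i ē⁻_{l;i}` on `𝔥_N`. -/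
def opD (L γ : ℝ) (N : ℕ) (l : ℂ) : Sector L N →L[ℂ] Sector L N :=
  ∑ n ∈ Finset.range (N + 1), (γ : ℂ) ^ n • ∑ i : Fin n ↪ Fin N, barMinus L l i

/-! ### The propagation operator and the pre-wavefunctions -/

/-- Words in the simple transpositions `s_j = (j  j+1)` of `S_N`. -/
abbrev SimpleWord (N : ℕ) : Type := List {p : Fin N × Fin N // (p.1 : ℕ) + 1 = p.2}

/-- The permutation `s_{i_1} ⋯ s_{i_l}` represented by a word. -/
def wordPerm {N : ℕ} (w : SimpleWord N) : Equiv.Perm (Fin N) :=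
  (w.map fun p => Equiv.swap p.1.1 p.1.2).prod

theorem exists_word {N : ℕ} (σ : Equiv.Perm (Fin N)) : ∃ w : SimpleWord N, wordPerm w = σ := by
  cases N with
  | zero => exact ⟨[], Subsingleton.elim _ _⟩
  | succ n =>
    have h : σ ∈ Submonoid.closure
        (Set.range fun i : Fin n => Equiv.swap i.castSucc i.succ) := by
      rw [Equiv.Perm.mclosure_swap_castSucc_succ]; trivial
    induction h using Submonoid.closure_induction with
    | mem x hx =>
      obtain ⟨i, rfl⟩ := hx
      exact ⟨[⟨(i.castSucc, i.succ), by simp⟩], by simp [wordPerm]⟩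
    | one => exact ⟨[], rfl⟩
    | mul x y _ _ hx hy =>
      obtain ⟨u, rfl⟩ := hx
      obtain ⟨v, rfl⟩ := hy
      exact ⟨u ++ v, by simp [wordPerm]⟩

/-- `(I_{jk} f)(x) = ∫_0^{x_j - x_k} f(x - y (e_j - e_k)) dy`. -/
def intOp {N : ℕ} (j k : Fin N) (f : (Fin N → ℝ) → ℂ) (x : Fin N → ℝ) : ℂ :=
  ∫ y in (0 : ℝ)..(x j - x k), f (x - y • (Pi.single j 1 - Pi.single k 1))

/-- The deformed transposition in position space, `s_{jk} + γ I_{jk}` (used for `k = j + 1`). -/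
def posSwap {N : ℕ} (γ : ℝ) (j k : Fin N) (f : (Fin N → ℝ) → ℂ) (x : Fin N → ℝ) : ℂ :=
  f (x ∘ Equiv.swap j k) + γ * intOp j k f x

/-- `s_{i_1,γ} ⋯ s_{i_l,γ}` for a word. -/
def wordOp {N : ℕ} (γ : ℝ) (w : SimpleWord N) (f : (Fin N → ℝ) → ℂ) : (Fin N → ℝ) → ℂ :=
  w.foldr (fun p g => posSwap γ p.1.1 p.1.2 g) f

/-- The deformed permutation `w_γ = s_{i_1,γ} ⋯ s_{i_l,γ}`, where `w = s_{i_1} ⋯ s_{i_l}` is some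
decomposition into simple transpositions. (The `s_{j,γ}` satisfy the Coxeter relations on continuous
functions, so that the choice of the decomposition is irrelevant.) -/
def deformedPerm {N : ℕ} (γ : ℝ) (σ : Equiv.Perm (Fin N)) (f : (Fin N → ℝ) → ℂ) :
    (Fin N → ℝ) → ℂ :=
  wordOp γ (exists_word σ).choose f

/-- The propagation operator `P_γ = ∑_w χ_{w⁻¹ ℝ^N_+} w⁻¹ w_γ`, where
`ℝ^N_+ = {x | x_1 > ⋯ > x_N}`; the action on points is `w x = x ∘ w⁻¹`, so that
`(w⁻¹ g)(x) = g(w x)`. The value is `0` on the null set where two coordinates coincide. -/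
def propagation {N : ℕ} (γ : ℝ) (f : (Fin N → ℝ) → ℂ) (x : Fin N → ℝ) : ℂ :=
  ∑ σ : Equiv.Perm (Fin N),
    theta (StrictAnti (x ∘ (σ⁻¹ : Equiv.Perm (Fin N)))) *
      deformedPerm γ σ f (x ∘ (σ⁻¹ : Equiv.Perm (Fin N)))

/-- The plane wave `e^{i λ}(x) = e^{i ∑_j λ_j x_j}`. -/
def planeWave {N : ℕ} (lam : Fin N → ℂ) (x : Fin N → ℝ) : ℂ :=
  Complex.exp (Complex.I * ∑ j, lam j * x j)

/-- The pre-wavefunction `ψ_λ = P_γ e^{i λ}`. -/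
def preWaveFun {N : ℕ} (γ : ℝ) (lam : Fin N → ℂ) : (Fin N → ℝ) → ℂ :=
  propagation γ (planeWave lam)

theorem continuous_posSwap {N : ℕ} (γ : ℝ) (j k : Fin N) (f : (Fin N → ℝ) → ℂ)
    (hf : Continuous f) : Continuous (posSwap γ j k f) := by
  have h1 : Continuous fun x : Fin N → ℝ => x ∘ Equiv.swap j k :=
    continuous_pi fun _ => continuous_apply _
  have h2 : Continuous (intOp j k f) := by
    unfold intOp
    refine intervalIntegral.continuous_parametric_intervalIntegral_of_continuous ?_ (by fun_prop)
    exact hf.comp (by fun_prop)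
  exact (hf.comp h1).add (continuous_const.mul h2)

theorem continuous_wordOp {N : ℕ} (γ : ℝ) (w : SimpleWord N) (f : (Fin N → ℝ) → ℂ)
    (hf : Continuous f) : Continuous (wordOp γ w f) := by
  induction w with
  | nil => exact hf
  | cons p w ih => exact continuous_posSwap γ _ _ _ ih

theorem memLp_preWaveFun (L γ : ℝ) {N : ℕ} (lam : Fin N → ℂ) :
    MemLp (preWaveFun γ lam) 2 (cubeMeasure L N) := by
  classical
  have hsum : preWaveFun γ lam = fun x => ∑ σ : Equiv.Perm (Fin N),
      theta (StrictAnti (x ∘ (σ⁻¹ : Equiv.Perm (Fin N)))) *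
        deformedPerm γ σ (planeWave lam) (x ∘ (σ⁻¹ : Equiv.Perm (Fin N))) := rfl
  rw [hsum]
  refine memLp_finsetSum _ fun σ _ => ?_
  have hperm : Continuous fun x : Fin N → ℝ => x ∘ (σ⁻¹ : Equiv.Perm (Fin N)) :=
    continuous_pi fun _ => continuous_apply _
  have hpw : Continuous (planeWave lam) := by unfold planeWave; fun_prop
  have hc : Continuous fun x : Fin N → ℝ =>
      deformedPerm γ σ (planeWave lam) (x ∘ (σ⁻¹ : Equiv.Perm (Fin N))) :=
    (continuous_wordOp γ _ _ hpw).comp hperm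
  have hm : MeasurableSet {x : Fin N → ℝ | StrictAnti (x ∘ (σ⁻¹ : Equiv.Perm (Fin N)))} :=
    measurableSet_strictAnti _ hperm.measurable
  have ht : Measurable fun x : Fin N → ℝ =>
      theta (StrictAnti (x ∘ (σ⁻¹ : Equiv.Perm (Fin N)))) :=
    Measurable.ite hm measurable_const measurable_const
  obtain ⟨C, hC⟩ := (isCompact_univ_pi fun _ : Fin N =>
    isCompact_Icc (a := -(L / 2)) (b := L / 2)).exists_bound_of_continuousOn hc.continuousOn
  refine MemLp.of_bound (ht.mul hc.measurable).aestronglyMeasurable C ?_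
  filter_upwards [ae_cube L N] with x hx
  refine le_trans ?_ (hC x fun j _ => hx j)
  rw [norm_mul]
  refine mul_le_of_le_one_left (norm_nonneg _) ?_
  unfold theta
  split_ifs <;> simp

/-- The pre-wavefunction `ψ_λ` as an element of `𝔥_N = L²(J^N)`. -/
def preWave (L γ : ℝ) {N : ℕ} (lam : Fin N → ℂ) : Sector L N :=
  (memLp_preWaveFun L γ lam).toLp (preWaveFun γ lam)

/-- `𝔷_N`, the closed linear span in `𝔥_N` of all pre-wavefunctions. -/
def zSpace (L γ : ℝ) (N : ℕ) : Submodule ℂ (Sector L N) :=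
  (Submodule.span ℂ (Set.range fun lam : Fin N → ℂ => preWave L γ lam)).topologicalClosure

/-! ### Deformed transpositions in momentum space -/

/-- The divided difference `(F(μ, ν) - F(ν, μ)) / (μ - ν)` of an entire function of two complex
variables; on the diagonal `μ = ν` it is the limit along `(μ + ε, ν - ε)`, `ε → 0`. -/
def dividedDifference {E : Type*} [NormedAddCommGroup E] [NormedSpace ℂ E] (F : ℂ → ℂ → E)
    (μ ν : ℂ) : E :=
  open Classical in
  if μ = ν then
    Filter.limUnder (nhdsWithin (0 : ℂ) {0}ᶜ) fun ε : ℂ =>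
      (2 * ε)⁻¹ • (F (μ + ε) (ν - ε) - F (ν - ε) (μ + ε))
  else (μ - ν)⁻¹ • (F μ ν - F ν μ)

/-- The deformed transposition `s̃_γ = s̃ - i γ Δ̃`, acting on functions of the two momenta which it
exchanges; all other momenta are inert. -/
def momentumSwap {E : Type*} [NormedAddCommGroup E] [NormedSpace ℂ E] (γ : ℝ) (F : ℂ → ℂ → E)
    (μ ν : ℂ) : E :=
  F ν μ - (Complex.I * γ) • dividedDifference F μ ν

end QNLS

end

open MeasureTheory
open scoped ENNReal NNReal

noncomputable section

namespace QNLS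

/-! Everything rests on the values of the operators on pre-wavefunctions. Appending a particle is
what `b⁻` does: `b⁻_μ ψ_λ = ψ_{(λ,μ)}` (`bMinusFun_preWaveFun`), and `d_μ ψ_λ` is the boundary value
of `ψ_{(λ,μ)}` where the last coordinate is `L/2` (`coeFn_opD_preWave`). Exchanging two neighbouring
coordinates in `ψ_κ` amounts to the deformed transposition of the two corresponding momenta
(`preWaveFun_comp_swap`). Applied to the last two coordinates this is the relation for `b⁻ b⁻`.
Moreover `d_ν b⁻_μ ψ_λ` is `z ↦ ψ_{(λ,μ,ν)}(z, L/2)`, while `b⁻_ν d_μ ψ_λ` is `(z', t) ↦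
ψ_{(λ,μ,ν)}(z', L/2, t)`; the two points differ by the same exchange, which gives one mixed
relation, and the other follows because `s̃_γ` is an involution (`SwapRelated.symm`).

The formula for `b⁻ d` and the invariance of `𝔷_N` under `d` come from moving the coordinate `L/2`
to the first place, where it exceeds all others and decouples, so that `d_μ ψ_λ` is a finite
combination of pre-wavefunctions (`exists_opD_preWave`).

The recursion `b⁻_μ ψ_λ = ψ_{(λ,μ)}` is proved for pairwise distinct momenta. There the operators
`w_γ` act on coefficients of permuted plane waves by rational matrices, the Coxeter relations are
rational identities, and `w_γ` does not depend on the word (`coeffWord_eq_of_wordPerm_eq`). Hence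
`ψ` solves Dunkl-type differential equations off the walls (`hasDerivAt_preWaveFun`). It is
continuous in its last coordinate across the walls, and the last particle decouples when it is
leftmost; integrating gives a Volterra equation (`preWaveFun_addLast_eq`). Peeling off the first
integral in the definition of `b⁻` gives the same equation (`bMinusFun_addLast_eq`), whose solution
is unique by induction on the number of coordinates below the last one.

Coinciding momenta are reached by density and continuity of `λ ↦ ψ_λ` in `L²`, general vectors of
`𝔷_N` by linearity and closedness, and the diagonal `μ = ν` by holomorphy in operator norm. The
statements for `b⁺` and `a` are the images of those for `b⁻` and `d` under `x ↦ (-x_N, …, -x_1)`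
with the momenta negated. -/

/-! ### The presentation of the symmetric group by simple transpositions -/

section Presentation

variable {M : Type*} [Monoid M]

/-- The descending product `τ_n τ_{n-1} ⋯ τ_{n-m+1}` of length `m`. -/
def descProd (τ : ℕ → M) (n : ℕ) : ℕ → M
  | 0 => 1
  | m + 1 => descProd τ n m * τ (n - m)

/-- All factors of the product have index at least `n - m + 1`, hence at least `j + 2`. -/
theorem descProd_mul_far (τ : ℕ → M) (n : ℕ)
    (hcomm : ∀ i j, i ≤ n → j ≤ n → i + 2 ≤ j → τ i * τ j = τ j * τ i) (m j : ℕ)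
    (hm : m ≤ n) (hj : j < n - m) :
    descProd τ n m * τ j = τ j * descProd τ n m := by
  induction m with
  | zero => simp [descProd]
  | succ m ih =>
    rw [descProd, mul_assoc, ← hcomm j (n - m) (by omega) (by omega) (by omega), ← mul_assoc,
      ih (by omega) (by omega), mul_assoc]

/-- Both `τ_j` and `τ_{j-1}` occur in the product. The new `τ_j` commutes past the factors of
smaller index until it meets `τ_j τ_{j-1}`; the braid relation then produces a `τ_{j-1}` that
commutes with all factors of larger index. -/
theorem descProd_mul_shift (τ : ℕ → M) (n : ℕ)
    (hcomm : ∀ i j, i ≤ n → j ≤ n → i + 2 ≤ j → τ i * τ j = τ j * τ i)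
    (hbraid : ∀ i, i + 1 ≤ n → τ i * τ (i + 1) * τ i = τ (i + 1) * τ i * τ (i + 1)) (m j : ℕ)
    (hm : m ≤ n + 1) (hj : n + 1 - m < j) (hjn : j ≤ n) :
    descProd τ n m * τ j = τ (j - 1) * descProd τ n m := by
  induction m with
  | zero => omega
  | succ m ih =>
    by_cases h : n + 1 - m < j
    · rw [descProd, mul_assoc, hcomm (n - m) j (by omega) (by omega) (by omega), ← mul_assoc,
        ih (by omega) h, mul_assoc]
    · obtain ⟨m, rfl⟩ : ∃ m', m = m' + 1 := ⟨m - 1, by omega⟩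
      have e1 : n - m = j := by omega
      have e2 : n - (m + 1) = j - 1 := by omega
      rw [descProd, descProd, e1, e2]
      have hb := hbraid (j - 1) (by omega)
      rw [show j - 1 + 1 = j by omega] at hb
      calc descProd τ n m * τ j * τ (j - 1) * τ j
          = descProd τ n m * (τ j * τ (j - 1) * τ j) := by simp only [mul_assoc]
        _ = descProd τ n m * τ (j - 1) * (τ j * τ (j - 1)) := by
            rw [← hb]; simp only [mul_assoc]
        _ = τ (j - 1) * (descProd τ n m * τ j * τ (j - 1)) := by
            rw [descProd_mul_far τ n hcomm m (j - 1) (by omega) (by omega)]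
            simp only [mul_assoc]

/-- Multiplying a normal form on the right by `τ_j` has four outcomes: `τ_j` passes into `u`,
lengthens the descending product, cancels its last factor, or passes into `u` as `τ_{j-1}`. -/
theorem exists_normalForm (τ : ℕ → M) (n : ℕ) (hsq : ∀ i, i ≤ n → τ i * τ i = 1)
    (hcomm : ∀ i j, i ≤ n → j ≤ n → i + 2 ≤ j → τ i * τ j = τ j * τ i)
    (hbraid : ∀ i, i + 1 ≤ n → τ i * τ (i + 1) * τ i = τ (i + 1) * τ i * τ (i + 1))
    (p : M) (hp : p ∈ Submonoid.closure (τ '' Set.Iio (n + 1))) :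
    ∃ u ∈ Submonoid.closure (τ '' Set.Iio n), ∃ m ≤ n + 1, p = u * descProd τ n m := by
  induction hp using Submonoid.closure_induction_right with
  | one => exact ⟨1, one_mem _, 0, by omega, by simp [descProd]⟩
  | mul_right p _ q hq ih =>
    obtain ⟨j, hj, rfl⟩ := hq
    obtain ⟨u, hu, m, hm, rfl⟩ := ih
    have hj : j ≤ n := Nat.lt_succ_iff.mp hj
    rcases lt_trichotomy j (n - m) with h | h | h
    · refine ⟨u * τ j, mul_mem hu (Submonoid.subset_closure ⟨j, ?_, rfl⟩), m, hm, ?_⟩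
      · simp only [Set.mem_Iio]; omega
      · rw [mul_assoc, descProd_mul_far τ n hcomm m j (by omega) h, mul_assoc]
    -- For `m = n + 1` the subtraction `n - m` is truncated to `0`: the product already ends in `τ
    -- 0`, so `j = 0` cancels a factor instead of adding one.
    · by_cases hmn : m = n + 1
      · subst hmn
        refine ⟨u, hu, n, by omega, ?_⟩
        have : n - n = j := by omega
        rw [descProd, this, mul_assoc, mul_assoc, hsq j hj, mul_one]
      · exact ⟨u, hu, m + 1, by omega, by rw [descProd, ← h, mul_assoc]⟩
    · by_cases h2 : j = n + 1 - m
      · obtain ⟨m, rfl⟩ : ∃ m', m = m' + 1 := ⟨m - 1, by omega⟩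
        refine ⟨u, hu, m, by omega, ?_⟩
        have : n - m = j := by omega
        rw [descProd, this, mul_assoc, mul_assoc, hsq j hj, mul_one]
      · refine ⟨u * τ (j - 1), mul_mem hu (Submonoid.subset_closure ⟨j - 1, ?_, rfl⟩), m, hm, ?_⟩
        · simp only [Set.mem_Iio]; omega
        · rw [mul_assoc, descProd_mul_shift τ n hcomm hbraid m j hm (by omega) hj, mul_assoc]

/-- The simple transposition `(i  i+1)` of `ℕ`. -/
def natSwap (i : ℕ) : Equiv.Perm ℕ := Equiv.swap i (i + 1)

theorem natSwap_comm {i j : ℕ} (h : i + 2 ≤ j) : natSwap i * natSwap j = natSwap j * natSwap i := by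
  ext k
  simp only [natSwap, Equiv.Perm.mul_apply, Equiv.swap_apply_def]
  split_ifs <;> omega

theorem natSwap_braid (i : ℕ) : natSwap i * natSwap (i + 1) * natSwap i
    = natSwap (i + 1) * natSwap i * natSwap (i + 1) := by
  ext k
  simp only [natSwap, Equiv.Perm.mul_apply, Equiv.swap_apply_def]
  split_ifs <;> omega

/-- Each factor, from the right, raises the point by one. The preimage of `n + 1` thus reveals the
length `m` of the descending product. -/
theorem descProd_natSwap_apply (n m : ℕ) (hm : m ≤ n + 1) :
    descProd natSwap n m (n + 1 - m) = n + 1 := by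
  induction m with
  | zero => simp [descProd]
  | succ m ih =>
    rw [descProd, Equiv.Perm.mul_apply, show n + 1 - (m + 1) = n - m by omega, natSwap,
      Equiv.swap_apply_left, show n - m + 1 = n + 1 - m by omega, ih (by omega)]

theorem apply_of_mem_closure_natSwap (n : ℕ) (p : Equiv.Perm ℕ)
    (hp : p ∈ Submonoid.closure (natSwap '' Set.Iio n)) (k : ℕ) (hk : n < k) : p k = k := by
  induction hp using Submonoid.closure_induction with
  | mem x hx =>
    obtain ⟨i, hi, rfl⟩ := hx
    simp only [Set.mem_Iio] at hi
    exact Equiv.swap_apply_of_ne_of_ne (by omega) (by omega)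
  | one => rfl
  | mul x y _ _ hx hy => rw [Equiv.Perm.mul_apply, hy, hx]

/-- The Coxeter presentation of the symmetric group, in the form that the pairs `(τ_i, natSwap i)`
generate the graph of a map. The pairs satisfy the Coxeter relations themselves, so normal forms
exist for them; the permutation determines `m` because `u` fixes `n + 1`, and the remaining factor
`u` is treated by induction after cancelling on the side of permutations. -/
theorem fst_eq_of_snd_eq (τ : ℕ → M) (n : ℕ) (hsq : ∀ i, i < n → τ i * τ i = 1)
    (hcomm : ∀ i j, i < n → j < n → i + 2 ≤ j → τ i * τ j = τ j * τ i)
    (hbraid : ∀ i, i + 1 < n → τ i * τ (i + 1) * τ i = τ (i + 1) * τ i * τ (i + 1))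
    (p q : M × Equiv.Perm ℕ)
    (hp : p ∈ Submonoid.closure ((fun i => (τ i, natSwap i)) '' Set.Iio n))
    (hq : q ∈ Submonoid.closure ((fun i => (τ i, natSwap i)) '' Set.Iio n))
    (h : p.2 = q.2) : p = q := by
  induction n generalizing p q with
  | zero =>
    simp only [Set.Iio_zero_eq_empty, Set.image_empty, Submonoid.closure_empty,
      Submonoid.mem_bot] at hp hq
    rw [hp, hq]
  | succ n ih =>
    set T : ℕ → M × Equiv.Perm ℕ := fun i => (τ i, natSwap i) with hT
    have hnf := exists_normalForm T n
      (fun i hi => Prod.ext (hsq i (by omega)) (Equiv.swap_mul_self _ _))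
      (fun i j hi hj hij => Prod.ext (hcomm i j (by omega) (by omega) hij) (natSwap_comm hij))
      (fun i hi => Prod.ext (hbraid i (by omega)) (natSwap_braid i))
    have hsnd : ∀ m, (descProd T n m).2 = descProd natSwap n m := fun m => by
      induction m with
      | zero => rfl
      | succ m ih => rw [descProd, descProd, Prod.snd_mul, ih]
    have hval : ∀ u ∈ Submonoid.closure (T '' Set.Iio n), ∀ m ≤ n + 1,
        (u * descProd T n m).2 (n + 1 - m) = n + 1 := fun u hu m hm => by
      rw [Prod.snd_mul, Equiv.Perm.mul_apply, hsnd, descProd_natSwap_apply n m hm]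
      refine apply_of_mem_closure_natSwap n _ ?_ _ (by omega)
      have := Submonoid.mem_map_of_mem (MonoidHom.snd M (Equiv.Perm ℕ)) hu
      rw [MonoidHom.map_mclosure, ← Set.image_comp] at this
      exact this
    obtain ⟨u, hu, m, hm, rfl⟩ := hnf p hp
    obtain ⟨v, hv, m', hm', rfl⟩ := hnf q hq
    have e : n + 1 - m = n + 1 - m' := by
      apply (u * descProd T n m).2.injective
      rw [hval u hu m hm, h, hval v hv m' hm']
    obtain rfl : m = m' := by omega
    rw [Prod.snd_mul, Prod.snd_mul] at h
    rw [ih (fun i hi => hsq i (by omega)) (fun i j hi hj => hcomm i j (by omega) (by omega))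
      (fun i hi => hbraid i (by omega)) u v hu hv (mul_right_cancel h)]

end Presentation

/-! ### Deformed transpositions on combinations of permuted plane waves -/

open Complex in
/-- The deformed transposition on the coefficients of a combination of the plane waves
`e^{i κ ∘ v}`, `v ∈ S_N`. -/
def coeffSwap {N : ℕ} (γ : ℝ) (κ : Fin N → ℂ) (j k : Fin N) :
    Module.End ℂ (Equiv.Perm (Fin N) → ℂ) where
  toFun c v := (1 - I * γ / (κ (v j) - κ (v k))) * c (v * Equiv.swap j k)
    - I * γ / (κ (v j) - κ (v k)) * c v
  map_add' c d := by ext v; simp only [Pi.add_apply]; ring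
  map_smul' a c := by ext v; simp only [Pi.smul_apply, smul_eq_mul, RingHom.id_apply]; ring

theorem coeffSwap_apply {N : ℕ} (γ : ℝ) (κ : Fin N → ℂ) (j k : Fin N)
    (c : Equiv.Perm (Fin N) → ℂ) (v : Equiv.Perm (Fin N)) : coeffSwap γ κ j k c v =
      (1 - Complex.I * γ / (κ (v j) - κ (v k))) * c (v * Equiv.swap j k)
        - Complex.I * γ / (κ (v j) - κ (v k)) * c v := rfl

theorem sub_ne_zero_of_injective {N : ℕ} {κ : Fin N → ℂ} (hκ : Function.Injective κ)
    (v : Equiv.Perm (Fin N)) {j k : Fin N} (h : j ≠ k) : κ (v j) - κ (v k) ≠ 0 :=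
  sub_ne_zero.mpr fun e => h (v.injective (hκ e))

theorem coeffSwap_sq {N : ℕ} (γ : ℝ) {κ : Fin N → ℂ} (hκ : Function.Injective κ) {j k : Fin N}
    (h : j ≠ k) : coeffSwap γ κ j k * coeffSwap γ κ j k = 1 := by
  refine LinearMap.ext fun c => funext fun v => ?_
  have h1 := sub_ne_zero_of_injective hκ v h
  have h2 := sub_ne_zero_of_injective hκ v h.symm
  simp only [Module.End.mul_apply, Module.End.one_apply, coeffSwap_apply, mul_assoc,
    Equiv.Perm.mul_apply, Equiv.swap_apply_left, Equiv.swap_apply_right, Equiv.swap_mul_self,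
    mul_one]
  rw [← neg_sub (κ (v j))]
  generalize κ (v j) - κ (v k) = a at *
  field_simp
  ring

theorem coeffSwap_comm {N : ℕ} (γ : ℝ) {κ : Fin N → ℂ} {j k l m : Fin N}
    (h1 : j ≠ l) (h2 : j ≠ m) (h3 : k ≠ l) (h4 : k ≠ m) :
    coeffSwap γ κ j k * coeffSwap γ κ l m = coeffSwap γ κ l m * coeffSwap γ κ j k := by
  refine LinearMap.ext fun c => funext fun v => ?_
  have hc : Equiv.swap j k * Equiv.swap l m = Equiv.swap l m * Equiv.swap j k :=
    Equiv.Perm.Disjoint.commute (by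
      intro i
      simp only [Equiv.swap_apply_def]
      split_ifs <;> simp_all)
  simp only [Module.End.mul_apply, coeffSwap_apply, mul_assoc, hc,
    Equiv.Perm.mul_apply, Equiv.swap_apply_of_ne_of_ne h1 h2, Equiv.swap_apply_of_ne_of_ne h3 h4,
    Equiv.swap_apply_of_ne_of_ne h1.symm h3.symm, Equiv.swap_apply_of_ne_of_ne h2.symm h4.symm]
  ring

theorem coeffSwap_braid {N : ℕ} (γ : ℝ) {κ : Fin N → ℂ} (hκ : Function.Injective κ)
    {j k l : Fin N} (h1 : j ≠ k) (h2 : k ≠ l) (h3 : j ≠ l) :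
    coeffSwap γ κ j k * coeffSwap γ κ k l * coeffSwap γ κ j k
      = coeffSwap γ κ k l * coeffSwap γ κ j k * coeffSwap γ κ k l := by
  refine LinearMap.ext fun c => funext fun v => ?_
  have hb : Equiv.swap k l * (Equiv.swap j k * Equiv.swap k l)
      = Equiv.swap j k * (Equiv.swap k l * Equiv.swap j k) := by
    ext i
    simp only [Equiv.Perm.mul_apply, Equiv.swap_apply_def]
    split_ifs <;> simp_all
  have e1 := sub_ne_zero_of_injective hκ v h1
  have e2 := sub_ne_zero_of_injective hκ v h2
  have e3 := sub_ne_zero_of_injective hκ v h3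
  simp only [Module.End.mul_apply, coeffSwap_apply, mul_assoc, hb,
    Equiv.Perm.mul_apply, Equiv.swap_apply_left, Equiv.swap_apply_right,
    Equiv.swap_apply_of_ne_of_ne h1 h3, Equiv.swap_apply_of_ne_of_ne h3.symm h2.symm,
    Equiv.swap_mul_self, mul_one]
  rw [← neg_sub (κ (v j)) (κ (v k)), ← neg_sub (κ (v k)) (κ (v l))]
  -- Only two of the three momentum differences are independent; with the third written as `a + b`
  -- the claim is an identity of rational functions.
  have e4 : κ (v j) - κ (v l) = (κ (v j) - κ (v k)) + (κ (v k) - κ (v l)) := by ring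
  rw [e4] at e3 ⊢
  generalize κ (v j) - κ (v k) = a at *
  generalize κ (v k) - κ (v l) = b at *
  field_simp
  ring

/-- The product of the deformed transpositions along a word, on coefficients. -/
def coeffWord {N : ℕ} (γ : ℝ) (κ : Fin N → ℂ) (w : SimpleWord N) :
    Module.End ℂ (Equiv.Perm (Fin N) → ℂ) :=
  (w.map fun p => coeffSwap γ κ p.1.1 p.1.2).prod

/-- This is what makes `w_γ` well defined: `coeffSwap` satisfies the Coxeter relations, distinct
momenta keeping the denominators nonzero, so the presentation of the symmetric group applies. -/
theorem coeffWord_eq_of_wordPerm_eq {N : ℕ} (γ : ℝ) {κ : Fin N → ℂ} (hκ : Function.Injective κ)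
    {u w : SimpleWord N} (h : wordPerm u = wordPerm w) : coeffWord γ κ u = coeffWord γ κ w := by
  -- The presentation is indexed by `ℕ`. The value `1` outside the range never enters, since only `i
  -- < N - 1` occurs.
  let τ : ℕ → Module.End ℂ (Equiv.Perm (Fin N) → ℂ) := fun i =>
    if h : i + 1 < N then coeffSwap γ κ ⟨i, by omega⟩ ⟨i + 1, h⟩ else 1
  have hτ : ∀ i (h : i < N - 1), τ i = coeffSwap γ κ ⟨i, by omega⟩ ⟨i + 1, by omega⟩ :=
    fun i h => dif_pos (by omega)
  let e : Equiv.Perm (Fin N) →* Equiv.Perm ℕ := Equiv.Perm.viaEmbeddingHom Fin.valEmbedding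
  have he : ∀ p : {p : Fin N × Fin N // (p.1 : ℕ) + 1 = p.2},
      e (Equiv.swap p.1.1 p.1.2) = natSwap p.1.1 := by
    rintro ⟨⟨j, k⟩, hjk⟩
    ext i
    change Equiv.Perm.viaEmbedding _ Fin.valEmbedding i = _
    by_cases hi : i < N
    · have := Equiv.Perm.viaEmbedding_apply (Equiv.swap j k) Fin.valEmbedding ⟨i, hi⟩
      simp only [Fin.valEmbedding_apply] at this
      rw [this]
      simp only at hjk
      simp only [natSwap, Equiv.swap_apply_def, Fin.ext_iff, apply_ite Fin.val]
      split_ifs <;> omega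
    · rw [Equiv.Perm.viaEmbedding_apply_of_notMem]
      · simp only at hjk
        rw [natSwap, Equiv.swap_apply_of_ne_of_ne] <;> dsimp only <;> omega
      · rintro ⟨a, rfl⟩; exact hi a.2
  have hmem : ∀ w : SimpleWord N, (coeffWord γ κ w, e (wordPerm w)) ∈
      Submonoid.closure ((fun i => (τ i, natSwap i)) '' Set.Iio (N - 1)) := by
    intro w
    induction w with
    | nil =>
      have : (coeffWord γ κ [], e (wordPerm [])) = 1 := by simp [coeffWord, wordPerm]
      rw [this]; exact one_mem _
    | cons p w ih =>
      have : (coeffWord γ κ (p :: w), e (wordPerm (p :: w)))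
          = (τ p.1.1, natSwap p.1.1) * (coeffWord γ κ w, e (wordPerm w)) := by
        have hp := p.2
        have h2 := p.1.2.2
        refine Prod.ext ?_ ?_
        · simp only [coeffWord, List.map_cons, List.prod_cons, Prod.mk_mul_mk]
          rw [hτ _ (by omega)]
          congr 2
          exact Fin.ext hp.symm
        · simp only [wordPerm, List.map_cons, List.prod_cons, Prod.mk_mul_mk, map_mul, he]
      rw [this]
      refine mul_mem (Submonoid.subset_closure ⟨p.1.1, ?_, rfl⟩) ih
      have hp := p.2
      have h2 := p.1.2.2
      simp only [Set.mem_Iio]; omega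
  have := fst_eq_of_snd_eq τ (N - 1)
    (fun i hi => by rw [hτ i hi]; exact coeffSwap_sq γ hκ (by simp))
    (fun i j hi hj hij => by
      rw [hτ i hi, hτ j hj]
      exact coeffSwap_comm γ (by simp; omega) (by simp; omega) (by simp; omega) (by simp; omega))
    (fun i hi => by
      rw [hτ i (by omega), hτ (i + 1) hi]
      exact coeffSwap_braid γ hκ (by simp) (by simp) (by simp; omega))
    _ _ (hmem u) (hmem w) (by simp only [h])
  exact congrArg Prod.fst this

/-! ### Pre-wavefunctions with pairwise distinct momenta -/

theorem continuous_planeWave {N : ℕ} (κ : Fin N → ℂ) : Continuous (planeWave κ) := by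
  unfold planeWave; fun_prop

/-- The combination of permuted plane waves with given coefficients. -/
def waveComb {N : ℕ} (κ : Fin N → ℂ) (c : Equiv.Perm (Fin N) → ℂ) (x : Fin N → ℝ) : ℂ :=
  ∑ v, c v * planeWave (κ ∘ v) x

theorem waveComb_single {N : ℕ} (κ : Fin N → ℂ) (v : Equiv.Perm (Fin N)) :
    waveComb κ (Pi.single v 1) = planeWave (κ ∘ v) := by
  funext x
  rw [waveComb, Finset.sum_eq_single v (fun u _ hu => by rw [Pi.single_eq_of_ne hu, zero_mul])
    (by simp), Pi.single_eq_same, one_mul]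

theorem planeWave_comp {N : ℕ} (κ : Fin N → ℂ) (x : Fin N → ℝ) (σ : Equiv.Perm (Fin N)) :
    planeWave κ (x ∘ σ) = planeWave (κ ∘ (σ⁻¹ : Equiv.Perm (Fin N))) x := by
  simp only [planeWave, Function.comp]
  congr 2
  refine Fintype.sum_equiv σ _ _ fun j => ?_
  simp

/-- In the direction `e_j - e_k` a plane wave is an exponential in `y` with rate `-i (κ_j - κ_k)`,
and at the upper limit `y = x_j - x_k` the coordinates `j` and `k` have been exchanged. -/
theorem intOp_planeWave {N : ℕ} (κ : Fin N → ℂ) {j k : Fin N} (h : j ≠ k) (hκ : κ j ≠ κ k)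
    (x : Fin N → ℝ) : intOp j k (planeWave κ) x = Complex.I / (κ j - κ k) *
      (planeWave (κ ∘ Equiv.swap j k) x - planeWave κ x) := by
  have hne : κ j - κ k ≠ 0 := sub_ne_zero.mpr hκ
  have h1 : ∀ y : ℝ, planeWave κ (x - y • (Pi.single j 1 - Pi.single k 1))
      = planeWave κ x * Complex.exp (-(Complex.I * (κ j - κ k)) * y) := fun y => by
    rw [planeWave, planeWave, ← Complex.exp_add]
    congr 1
    simp only [Pi.sub_apply, Pi.smul_apply, smul_eq_mul, Complex.ofReal_sub, Complex.ofReal_mul,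
      mul_sub, Finset.sum_sub_distrib, Pi.single_apply]
    simp only [apply_ite Complex.ofReal, Complex.ofReal_one, Complex.ofReal_zero, mul_ite, mul_one,
      mul_zero, Finset.sum_ite_eq', Finset.mem_univ, if_true]
    ring
  have h2 : planeWave (κ ∘ Equiv.swap j k) x
      = planeWave κ x * Complex.exp (-(Complex.I * (κ j - κ k)) * ((x j - x k : ℝ) : ℂ)) := by
    rw [planeWave, planeWave, ← Complex.exp_add]
    congr 1
    have : ∑ l, (κ ∘ Equiv.swap j k) l * (x l : ℂ)
        = ∑ l, κ l * x l - (κ j - κ k) * ((x j : ℂ) - x k) := by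
      have e : ∀ l, (κ ∘ Equiv.swap j k) l * (x l : ℂ) - κ l * x l
          = (if l = j then (κ k - κ j) * x j else 0) + (if l = k then (κ j - κ k) * x k else 0) := by
        intro l
        by_cases hj : l = j
        · subst hj; simp [h]; ring
        · by_cases hk : l = k
          · subst hk; simp [hj]; ring
          · simp [hj, hk, Equiv.swap_apply_of_ne_of_ne hj hk]
      have e2 := Finset.sum_congr (s₁ := Finset.univ) rfl fun l _ => e l
      rw [Finset.sum_sub_distrib, Finset.sum_add_distrib, Finset.sum_ite_eq', Finset.sum_ite_eq']
        at e2
      simp only [Finset.mem_univ, if_true] at e2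
      linear_combination e2
    rw [this]; push_cast; ring
  rw [intOp]
  simp_rw [h1]
  rw [intervalIntegral.integral_const_mul,
    integral_exp_mul_complex (neg_ne_zero.mpr (mul_ne_zero Complex.I_ne_zero hne)), h2]
  simp only [Complex.ofReal_zero, mul_zero, Complex.exp_zero]
  field_simp
  rw [Complex.I_sq]
  ring

theorem posSwap_planeWave {N : ℕ} (γ : ℝ) (κ : Fin N → ℂ) {j k : Fin N} (h : j ≠ k)
    (hκ : κ j ≠ κ k) (x : Fin N → ℝ) : posSwap γ j k (planeWave κ) x =
      (1 + Complex.I * γ / (κ j - κ k)) * planeWave (κ ∘ Equiv.swap j k) x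
        - Complex.I * γ / (κ j - κ k) * planeWave κ x := by
  rw [posSwap, intOp_planeWave κ h hκ, planeWave_comp, Equiv.swap_inv]
  ring

theorem posSwap_sum {N : ℕ} (γ : ℝ) (j k : Fin N) {ι : Type*} (s : Finset ι) (a : ι → ℂ)
    (F : ι → (Fin N → ℝ) → ℂ) (hF : ∀ i, Continuous (F i)) (x : Fin N → ℝ) :
    posSwap γ j k (fun x => ∑ i ∈ s, a i * F i x) x = ∑ i ∈ s, a i * posSwap γ j k (F i) x := by
  simp only [posSwap, intOp]
  rw [intervalIntegral.integral_finsetSum, Finset.mul_sum, ← Finset.sum_add_distrib]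
  · refine Finset.sum_congr rfl fun i _ => ?_
    rw [intervalIntegral.integral_const_mul]; ring
  · intro i _
    exact ((continuous_const.mul ((hF i).comp (by fun_prop)))).intervalIntegrable _ _

/-- Re-indexing the sum by `v ↦ v s_{jk}` reverses the sign of the momentum difference; this
accounts for the minus sign in the first factor of `coeffSwap`. -/
theorem posSwap_waveComb {N : ℕ} (γ : ℝ) {κ : Fin N → ℂ} (hκ : Function.Injective κ) {j k : Fin N}
    (h : j ≠ k) (c : Equiv.Perm (Fin N) → ℂ) :
    posSwap γ j k (waveComb κ c) = waveComb κ (coeffSwap γ κ j k c) := by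
  funext x
  unfold waveComb
  rw [posSwap_sum γ j k _ c (fun v => planeWave (κ ∘ v)) fun v => continuous_planeWave _]
  simp only [posSwap_planeWave γ (κ ∘ _) h (fun e => h ((hκ.comp (Equiv.injective _)) e)),
    coeffSwap_apply]
  have e : ∑ v : Equiv.Perm (Fin N), c v * ((1 + Complex.I * γ / ((κ ∘ v) j - (κ ∘ v) k)) *
        planeWave ((κ ∘ v) ∘ Equiv.swap j k) x)
      = ∑ v : Equiv.Perm (Fin N), (1 - Complex.I * γ / (κ (v j) - κ (v k))) *
        c (v * Equiv.swap j k) * planeWave (κ ∘ v) x := by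
    refine Fintype.sum_equiv (Equiv.mulRight (Equiv.swap j k)) _ _ fun v => ?_
    simp only [Equiv.coe_mulRight, mul_assoc, Equiv.swap_mul_self, mul_one, Equiv.Perm.mul_apply,
      Equiv.swap_apply_left, Equiv.swap_apply_right, Equiv.Perm.coe_mul, Function.comp_assoc]
    rw [← neg_sub (κ (v j)), div_neg, sub_neg_eq_add]
    simp only [Function.comp]
    ring
  simp only [mul_sub (c _), sub_mul _ _ (planeWave _ x), Finset.sum_sub_distrib]
  rw [e]
  congr 1
  exact Finset.sum_congr rfl fun v _ => by simp only [Function.comp]; ring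

theorem wordOp_waveComb {N : ℕ} (γ : ℝ) {κ : Fin N → ℂ} (hκ : Function.Injective κ)
    (w : SimpleWord N) (c : Equiv.Perm (Fin N) → ℂ) :
    wordOp γ w (waveComb κ c) = waveComb κ (coeffWord γ κ w c) := by
  induction w with
  | nil => rfl
  | cons p w ih =>
    change posSwap γ p.1.1 p.1.2 (wordOp γ w (waveComb κ c)) = _
    rw [ih, posSwap_waveComb γ hκ]
    · simp only [coeffWord, List.map_cons, List.prod_cons, Module.End.mul_apply]
    · intro h
      have := p.2
      rw [h] at this; omega

/-- A plane wave is the combination whose coefficients are supported at the identity, so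
independence of the word passes from coefficients to functions. -/
theorem wordOp_planeWave_congr {N : ℕ} (γ : ℝ) {κ : Fin N → ℂ} (hκ : Function.Injective κ)
    {u w : SimpleWord N} (h : wordPerm u = wordPerm w) :
    wordOp γ u (planeWave κ) = wordOp γ w (planeWave κ) := by
  have e : planeWave κ = waveComb κ (Pi.single 1 1) := (waveComb_single κ 1).symm
  rw [e, wordOp_waveComb γ hκ, wordOp_waveComb γ hκ, coeffWord_eq_of_wordPerm_eq γ hκ h]

theorem deformedPerm_planeWave {N : ℕ} (γ : ℝ) {κ : Fin N → ℂ} (hκ : Function.Injective κ)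
    (w : SimpleWord N) :
    deformedPerm γ (wordPerm w) (planeWave κ) = wordOp γ w (planeWave κ) :=
  wordOp_planeWave_congr γ hκ (exists_word (wordPerm w)).choose_spec

/-! ### Chambers and the words that sort a point -/

theorem injective_of_strictAnti {N : ℕ} {x : Fin N → ℝ} {σ : Equiv.Perm (Fin N)}
    (h : StrictAnti (x ∘ σ)) : Function.Injective x := by
  intro a b hab
  have := h.injective (a₁ := σ⁻¹ a) (a₂ := σ⁻¹ b) (by simpa using hab)
  simpa using this

theorem perm_eq_of_strictAnti {N : ℕ} {x : Fin N → ℝ} {σ τ : Equiv.Perm (Fin N)}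
    (hσ : StrictAnti (x ∘ σ)) (hτ : StrictAnti (x ∘ τ)) : σ = τ := by
  have hn : ∀ {ρ : Equiv.Perm (Fin N)}, StrictAnti (x ∘ ρ) → StrictMono fun i => -(x (ρ i)) :=
    fun h i j hij => neg_lt_neg (h hij)
  have hr : ∀ ρ : Equiv.Perm (Fin N), Set.range (fun i => -(x (ρ i))) = Set.range fun i => -(x i) :=
    fun ρ => ρ.surjective.range_comp fun i => -(x i)
  have := StrictMono.range_inj (hn hσ) (hn hτ) |>.mp ((hr σ).trans (hr τ).symm)
  ext1 i
  exact injective_of_strictAnti hσ (neg_injective (congrFun this i))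

theorem exists_strictAnti_comp {N : ℕ} {x : Fin N → ℝ} (hx : Function.Injective x) :
    ∃ σ : Equiv.Perm (Fin N), StrictAnti (x ∘ σ) := by
  refine ⟨Tuple.sort fun i => -x i, ?_⟩
  have h := Tuple.monotone_sort fun i => -x i
  have h2 := h.strictMono_of_injective
    ((neg_injective.comp hx).comp (Equiv.injective _))
  intro i j hij
  exact neg_lt_neg_iff.mp (h2 hij)

theorem exists_strictAnti_word {N : ℕ} {x : Fin N → ℝ} (hx : Function.Injective x) :
    ∃ w : SimpleWord N, StrictAnti (x ∘ ((wordPerm w)⁻¹ : Equiv.Perm (Fin N))) := by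
  obtain ⟨σ, hσ⟩ := exists_strictAnti_comp hx
  obtain ⟨w, hw⟩ := exists_word σ⁻¹
  exact ⟨w, by rwa [hw, inv_inv]⟩

theorem propagation_of_strictAnti {N : ℕ} (γ : ℝ) (f : (Fin N → ℝ) → ℂ) {x : Fin N → ℝ}
    {σ : Equiv.Perm (Fin N)} (h : StrictAnti (x ∘ (σ⁻¹ : Equiv.Perm (Fin N)))) :
    propagation γ f x = deformedPerm γ σ f (x ∘ (σ⁻¹ : Equiv.Perm (Fin N))) := by
  rw [propagation, Finset.sum_eq_single σ]
  · rw [theta, if_pos h, one_mul]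
  · intro τ _ hτ
    rw [theta, if_neg, zero_mul]
    exact fun h' => hτ (inv_injective (perm_eq_of_strictAnti h' h))
  · simp

/-- The value of a pre-wavefunction in a chamber, computed by any word. -/
theorem preWaveFun_eq_wordOp {N : ℕ} (γ : ℝ) {κ : Fin N → ℂ} (hκ : Function.Injective κ)
    {x : Fin N → ℝ} {w : SimpleWord N}
    (h : StrictAnti (x ∘ ((wordPerm w)⁻¹ : Equiv.Perm (Fin N)))) :
    preWaveFun γ κ x = wordOp γ w (planeWave κ) (x ∘ ((wordPerm w)⁻¹ : Equiv.Perm (Fin N))) := by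
  rw [preWaveFun, propagation_of_strictAnti γ _ h, deformedPerm_planeWave γ hκ]

theorem preWaveFun_of_strictAnti {N : ℕ} (γ : ℝ) {κ : Fin N → ℂ} (hκ : Function.Injective κ)
    {x : Fin N → ℝ} (h : StrictAnti x) : preWaveFun γ κ x = planeWave κ x :=
  preWaveFun_eq_wordOp γ hκ (w := []) h

theorem preWaveFun_of_not_injective {N : ℕ} (γ : ℝ) (κ : Fin N → ℂ) {x : Fin N → ℝ}
    (h : ¬ Function.Injective x) : preWaveFun γ κ x = 0 := by
  rw [preWaveFun, propagation]
  refine Finset.sum_eq_zero fun σ _ => ?_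
  rw [theta, if_neg (fun h' => h (injective_of_strictAnti h')), zero_mul]

theorem wordOp_append {N : ℕ} (γ : ℝ) (u w : SimpleWord N) (f : (Fin N → ℝ) → ℂ) :
    wordOp γ (u ++ w) f = wordOp γ u (wordOp γ w f) := by
  simp [wordOp, List.foldr_append]

theorem wordPerm_append {N : ℕ} (u w : SimpleWord N) :
    wordPerm (u ++ w) = wordPerm u * wordPerm w := by
  simp [wordPerm]

theorem wordOp_sum {N : ℕ} (γ : ℝ) (w : SimpleWord N) {ι : Type*} (s : Finset ι) (a : ι → ℂ)
    (F : ι → (Fin N → ℝ) → ℂ) (hF : ∀ i, Continuous (F i)) :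
    wordOp γ w (fun x => ∑ i ∈ s, a i * F i x) = fun x => ∑ i ∈ s, a i * wordOp γ w (F i) x := by
  induction w with
  | nil => rfl
  | cons p w ih =>
    funext x
    change posSwap γ p.1.1 p.1.2 (wordOp γ w _) x = _
    rw [ih, posSwap_sum γ _ _ s a _ fun i => continuous_wordOp γ w _ (hF i)]
    rfl

/-- The action of the simple transpositions on the pre-wavefunctions. -/
theorem preWaveFun_comp_swap {N : ℕ} (γ : ℝ) {κ : Fin N → ℂ} (hκ : Function.Injective κ)
    (p : {p : Fin N × Fin N // (p.1 : ℕ) + 1 = p.2}) (x : Fin N → ℝ) :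
    preWaveFun γ κ (x ∘ Equiv.swap p.1.1 p.1.2) =
      (1 + Complex.I * γ / (κ p.1.1 - κ p.1.2)) * preWaveFun γ (κ ∘ Equiv.swap p.1.1 p.1.2) x
        - Complex.I * γ / (κ p.1.1 - κ p.1.2) * preWaveFun γ κ x := by
  have hp : p.1.1 ≠ p.1.2 := fun h => by
    have := p.2
    rw [h] at this; omega
  by_cases hx : Function.Injective x
  · obtain ⟨w, hw⟩ := exists_strictAnti_word hx
    have hs : wordPerm [p] = Equiv.swap p.1.1 p.1.2 := by simp [wordPerm]
    -- If `w` sorts `x`, then `w s_p` sorts `s_p x`, and the sorted point is the same. The two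
    -- values therefore differ only by `s_{p,γ}` acting on the plane wave before `w_γ`.
    have e : (x ∘ Equiv.swap p.1.1 p.1.2) ∘ ((wordPerm (w ++ [p]))⁻¹ : Equiv.Perm (Fin N))
        = x ∘ ((wordPerm w)⁻¹ : Equiv.Perm (Fin N)) := by
      rw [wordPerm_append, hs, mul_inv_rev, Equiv.swap_inv]
      funext i
      simp
    have h1 := preWaveFun_eq_wordOp γ hκ (w := w ++ [p])
      (x := x ∘ Equiv.swap p.1.1 p.1.2) (by rw [e]; exact hw)
    rw [h1, e, wordOp_append, preWaveFun_eq_wordOp γ hκ hw,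
      preWaveFun_eq_wordOp γ (hκ.comp (Equiv.injective _)) hw]
    -- The two terms are written as a sum over `Bool` so that `wordOp_sum` applies.
    have h2 : wordOp γ [p] (planeWave κ) = fun x => ∑ b : Bool,
        (if b then 1 + Complex.I * γ / (κ p.1.1 - κ p.1.2) else
          -(Complex.I * γ / (κ p.1.1 - κ p.1.2))) *
          (if b then planeWave (κ ∘ Equiv.swap p.1.1 p.1.2) else planeWave κ) x := by
      funext x
      change posSwap γ _ _ (planeWave κ) x = _
      rw [posSwap_planeWave γ κ hp (fun e => hp (hκ e))]
      simp [sub_eq_add_neg]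
    rw [h2, wordOp_sum]
    · simp [sub_eq_add_neg]
    · intro b
      cases b <;> simp [continuous_planeWave]
  · rw [preWaveFun_of_not_injective γ _ hx, preWaveFun_of_not_injective γ _ hx,
      preWaveFun_of_not_injective]
    · simp
    · intro h
      apply hx
      have := h.comp (Equiv.swap p.1.1 p.1.2).injective
      simpa [Function.comp_assoc, Function.comp_def] using this

/-! ### Adding an extremal particle -/

theorem posSwap_extend {N M : ℕ} (γ : ℝ) {e : Fin N → Fin M} (he : Function.Injective e) {r : Fin M}
    (hr : r ∉ Set.range e) (j k : Fin N) (G : (Fin N → ℝ) → ℂ) (φ : ℝ → ℂ) :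
    posSwap γ (e j) (e k) (fun y => G (y ∘ e) * φ (y r))
      = fun y => posSwap γ j k G (y ∘ e) * φ (y r) := by
  funext y
  have hrj : ∀ j, r ≠ e j := fun j h => hr ⟨j, h.symm⟩
  have h1 : (y ∘ Equiv.swap (e j) (e k)) ∘ e = (y ∘ e) ∘ Equiv.swap j k := by
    funext i
    simp only [Function.comp, he.map_swap]
  have h2 : ∀ t : ℝ, (y - t • (Pi.single (e j) 1 - Pi.single (e k) 1)) ∘ e
      = y ∘ e - t • (Pi.single j 1 - Pi.single k 1) := fun t => by
    funext i
    simp [Pi.single_apply, he.eq_iff]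
  have h3 : ∀ t : ℝ,
      (y - t • (Pi.single (e j) 1 - Pi.single (e k) 1) : Fin M → ℝ) r = y r := fun t => by
    simp [hrj]
  simp only [posSwap, intOp, h1, h2, h3, intervalIntegral.integral_mul_const, Function.comp,
    Equiv.swap_apply_of_ne_of_ne (hrj j) (hrj k)]
  ring

/-- The image of a word under a shift of the indices. -/
def mapWord {N M : ℕ} (e : Fin N → Fin M)
    (he : ∀ j k : Fin N, (j : ℕ) + 1 = k → (e j : ℕ) + 1 = e k) (w : SimpleWord N) :
    SimpleWord M :=
  w.map fun p => ⟨(e p.1.1, e p.1.2), he _ _ p.2⟩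

section Extend

variable {N M : ℕ} {e : Fin N → Fin M}
  (hs : ∀ j k : Fin N, (j : ℕ) + 1 = k → (e j : ℕ) + 1 = e k) (he : Function.Injective e)
  {r : Fin M} (hr : r ∉ Set.range e)

include he hr

theorem wordOp_extend (γ : ℝ) (w : SimpleWord N) (G : (Fin N → ℝ) → ℂ) (φ : ℝ → ℂ) :
    wordOp γ (mapWord e hs w) (fun y => G (y ∘ e) * φ (y r))
      = fun y => wordOp γ w G (y ∘ e) * φ (y r) := by
  induction w with
  | nil => rfl
  | cons p w ih =>
    change posSwap γ (e p.1.1) (e p.1.2) (wordOp γ (mapWord e hs w) _) = _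
    rw [ih, posSwap_extend γ he hr]
    rfl

theorem wordPerm_mapWord (w : SimpleWord N) :
    (∀ i, wordPerm (mapWord e hs w) (e i) = e (wordPerm w i)) ∧
      wordPerm (mapWord e hs w) r = r := by
  induction w with
  | nil => exact ⟨fun i => rfl, rfl⟩
  | cons p w ih =>
    have h1 : wordPerm (mapWord e hs (p :: w))
        = Equiv.swap (e p.1.1) (e p.1.2) * wordPerm (mapWord e hs w) := rfl
    have h2 : wordPerm (p :: w) = Equiv.swap p.1.1 p.1.2 * wordPerm w := rfl
    refine ⟨fun i => ?_, ?_⟩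
    · rw [h1, h2, Equiv.Perm.mul_apply, Equiv.Perm.mul_apply, ih.1, he.map_swap]
    · rw [h1, Equiv.Perm.mul_apply, ih.2, Equiv.swap_apply_of_ne_of_ne]
      · exact fun h => hr ⟨_, h.symm⟩
      · exact fun h => hr ⟨_, h.symm⟩

theorem wordPerm_mapWord_inv (w : SimpleWord N) :
    (∀ i, (wordPerm (mapWord e hs w))⁻¹ (e i) = e ((wordPerm w)⁻¹ i)) ∧
      (wordPerm (mapWord e hs w))⁻¹ r = r := by
  obtain ⟨h1, h2⟩ := wordPerm_mapWord hs he hr w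
  refine ⟨fun i => ?_, ?_⟩
  · rw [Equiv.Perm.inv_eq_iff_eq, h1]; simp
  · rw [Equiv.Perm.inv_eq_iff_eq, h2]

/-- The sorting word of the other particles only involves positions other than `r`, and the plane
wave splits off the factor belonging to `r`, which those operators do not touch. -/
theorem preWaveFun_extend (hsum : ∀ f : Fin M → ℂ, ∑ j, f j = ∑ j, f (e j) + f r) (γ : ℝ)
    {κ : Fin M → ℂ} (hκ : Function.Injective κ) {y : Fin M → ℝ} {w : SimpleWord N}
    (hw : StrictAnti ((y ∘ e) ∘ ((wordPerm w)⁻¹ : Equiv.Perm (Fin N))))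
    (hw' : StrictAnti (y ∘ ((wordPerm (mapWord e hs w))⁻¹ : Equiv.Perm (Fin M)))) :
    preWaveFun γ κ y = preWaveFun γ (κ ∘ e) (y ∘ e) * Complex.exp (Complex.I * κ r * y r) := by
  have hpw : planeWave κ = fun y => planeWave (κ ∘ e) (y ∘ e) *
      (fun t : ℝ => Complex.exp (Complex.I * κ r * t)) (y r) := by
    funext y
    simp only [planeWave]
    rw [← Complex.exp_add, hsum]
    simp only [Function.comp]
    congr 1; ring
  rw [preWaveFun_eq_wordOp γ hκ hw', preWaveFun_eq_wordOp γ (hκ.comp he) hw, hpw,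
    wordOp_extend hs he hr γ w (planeWave (κ ∘ e))
      (fun t : ℝ => Complex.exp (Complex.I * κ r * t))]
  obtain ⟨h1, h2⟩ := wordPerm_mapWord_inv hs he hr w
  have h3 : (y ∘ ((wordPerm (mapWord e hs w))⁻¹ : Equiv.Perm (Fin M))) ∘ e
      = (y ∘ e) ∘ ((wordPerm w)⁻¹ : Equiv.Perm (Fin N)) := by
    funext i
    simp only [Function.comp, h1]
  simp only [h3]
  rw [Function.comp_apply, h2]

end Extend

theorem castSucc_notMem {N : ℕ} : Fin.last N ∉ Set.range (Fin.castSucc : Fin N → Fin (N + 1)) := by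
  rintro ⟨i, hi⟩
  exact Fin.castSucc_ne_last i hi

theorem zero_notMem {N : ℕ} : (0 : Fin (N + 1)) ∉ Set.range (Fin.succ : Fin N → Fin (N + 1)) := by
  rintro ⟨i, hi⟩
  exact Fin.succ_ne_zero i hi

/-- A particle to the left of all others, in the last position, decouples. -/
theorem preWaveFun_of_last_lt {N : ℕ} (γ : ℝ) {κ : Fin (N + 1) → ℂ} (hκ : Function.Injective κ)
    {y : Fin (N + 1) → ℝ} (hy : Function.Injective y)
    (h : ∀ j : Fin N, y (Fin.last N) < y j.castSucc) :
    preWaveFun γ κ y = preWaveFun γ (κ ∘ Fin.castSucc) (y ∘ Fin.castSucc) *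
      Complex.exp (Complex.I * κ (Fin.last N) * y (Fin.last N)) := by
  obtain ⟨w, hw⟩ := exists_strictAnti_word (hy.comp (Fin.castSucc_injective N))
  refine preWaveFun_extend (fun j k h => by simpa using h) (Fin.castSucc_injective N)
    castSucc_notMem (fun f => Fin.sum_univ_castSucc f) γ hκ hw ?_
  obtain ⟨h1, h2⟩ := wordPerm_mapWord_inv (fun j k h => by simpa using h)
    (Fin.castSucc_injective N) castSucc_notMem w
  intro a b hab
  refine Fin.lastCases ?_ (fun b hab => ?_) b hab
  · intro hab
    obtain ⟨a, rfl⟩ := Fin.exists_castSucc_eq.mpr hab.ne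
    simp only [Function.comp, h1, h2]
    exact h _
  · obtain ⟨a, rfl⟩ := Fin.exists_castSucc_eq.mpr (hab.trans (Fin.castSucc_lt_last b)).ne
    simp only [Function.comp, h1]
    exact hw (Fin.castSucc_lt_castSucc_iff.mp hab)

/-- A particle to the right of all others, in the first position, decouples. -/
theorem preWaveFun_of_lt_zero {N : ℕ} (γ : ℝ) {κ : Fin (N + 1) → ℂ} (hκ : Function.Injective κ)
    {y : Fin (N + 1) → ℝ} (hy : Function.Injective y)
    (h : ∀ j : Fin N, y j.succ < y 0) :
    preWaveFun γ κ y = preWaveFun γ (κ ∘ Fin.succ) (y ∘ Fin.succ) *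
      Complex.exp (Complex.I * κ 0 * y 0) := by
  obtain ⟨w, hw⟩ := exists_strictAnti_word (hy.comp (Fin.succ_injective N))
  refine preWaveFun_extend (fun j k h => by simpa using h) (Fin.succ_injective N)
    zero_notMem (fun f => by rw [Fin.sum_univ_succ, add_comm]) γ hκ hw ?_
  obtain ⟨h1, h2⟩ := wordPerm_mapWord_inv (fun j k h => by simpa using h)
    (Fin.succ_injective N) zero_notMem w
  intro a b hab
  obtain ⟨b, rfl⟩ := Fin.exists_succ_eq.mpr (Fin.ne_zero_of_lt hab)
  refine Fin.cases ?_ (fun a hab => ?_) a hab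
  · intro hab
    simp only [Function.comp, h1, h2]
    exact h _
  · simp only [Function.comp, h1]
    exact hw (Fin.succ_lt_succ_iff.mp hab)

/-! ### Reflection -/

/-- The reflection `(x_1, …, x_N) ↦ (-x_N, …, -x_1)`. -/
def reflect {N : ℕ} (x : Fin N → ℝ) : Fin N → ℝ := fun i => -x i.rev

/-- Negation and reversal of the indices compensate each other in the difference of two neighbouring
coordinates, so `γ` keeps its sign. -/
theorem posSwap_reflect {N : ℕ} (γ : ℝ) (j k : Fin N) (f : (Fin N → ℝ) → ℂ) (x : Fin N → ℝ) :
    posSwap γ j k f (reflect x) = posSwap γ k.rev j.rev (fun y => f (reflect y)) x := by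
  have h1 : reflect x ∘ Equiv.swap j k = reflect (x ∘ Equiv.swap k.rev j.rev) := by
    funext i
    simp only [reflect, Function.comp]
    rw [Equiv.swap_comm k.rev, ← Fin.rev_injective.map_swap]
  have h2 : ∀ y : ℝ, reflect x - y • (Pi.single j 1 - Pi.single k 1)
      = reflect (x - y • (Pi.single k.rev 1 - Pi.single j.rev 1)) := fun y => by
    funext i
    simp [reflect, Pi.single_apply, Fin.rev_inj]
    ring
  have h3 : reflect x j - reflect x k = x k.rev - x j.rev := by simp only [reflect]; ring
  simp only [posSwap, intOp, h1, h2, h3]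

/-- The image of a word under the reversal of the indices. -/
def revWord {N : ℕ} (w : SimpleWord N) : SimpleWord N :=
  w.map fun p => ⟨(p.1.2.rev, p.1.1.rev), by
    have h := p.2
    have h1 := p.1.2.2
    simp only [Fin.val_rev]; omega⟩

theorem wordOp_reflect {N : ℕ} (γ : ℝ) (w : SimpleWord N) (f : (Fin N → ℝ) → ℂ) :
    (fun x => wordOp γ w f (reflect x)) = wordOp γ (revWord w) fun y => f (reflect y) := by
  induction w with
  | nil => rfl
  | cons p w ih =>
    funext x
    change posSwap γ p.1.1 p.1.2 (wordOp γ w f) (reflect x)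
      = posSwap γ p.1.2.rev p.1.1.rev (wordOp γ (revWord w) fun y => f (reflect y)) x
    rw [posSwap_reflect, ih]

theorem wordPerm_revWord {N : ℕ} (w : SimpleWord N) (i : Fin N) :
    wordPerm (revWord w) i.rev = (wordPerm w i).rev := by
  induction w with
  | nil => rfl
  | cons p w ih =>
    have h1 : wordPerm (revWord (p :: w))
        = Equiv.swap p.1.2.rev p.1.1.rev * wordPerm (revWord w) := rfl
    have h2 : wordPerm (p :: w) = Equiv.swap p.1.1 p.1.2 * wordPerm w := rfl
    rw [h1, h2, Equiv.Perm.mul_apply, Equiv.Perm.mul_apply, ih, Fin.rev_injective.map_swap,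
      Equiv.swap_comm]

/-- The reflection maps the decreasing chamber to itself, permutes the simple transpositions, and
turns `e^{iκ}` into the plane wave with negated and reversed momenta. -/
theorem preWaveFun_reflect {N : ℕ} (γ : ℝ) {κ : Fin N → ℂ} (hκ : Function.Injective κ)
    (x : Fin N → ℝ) : preWaveFun γ κ (reflect x) = preWaveFun γ (fun i => -κ i.rev) x := by
  have hκ' : Function.Injective fun i : Fin N => -κ i.rev :=
    neg_injective.comp (hκ.comp Fin.rev_injective)
  by_cases hx : Function.Injective x
  · have hrx : Function.Injective (reflect x) := neg_injective.comp (hx.comp Fin.rev_injective)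
    obtain ⟨w, hw⟩ := exists_strictAnti_word hrx
    have hinv : ∀ i, (wordPerm (revWord w))⁻¹ i = ((wordPerm w)⁻¹ i.rev).rev := fun i => by
      rw [Equiv.Perm.inv_eq_iff_eq, wordPerm_revWord]; simp
    have e : reflect x ∘ ((wordPerm w)⁻¹ : Equiv.Perm (Fin N))
        = reflect (x ∘ ((wordPerm (revWord w))⁻¹ : Equiv.Perm (Fin N))) := by
      funext i
      simp only [reflect, Function.comp, hinv, Fin.rev_rev]
    have hw' : StrictAnti (x ∘ ((wordPerm (revWord w))⁻¹ : Equiv.Perm (Fin N))) := by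
      intro a b hab
      have := hw (Fin.rev_lt_rev.mpr hab)
      rw [e] at this
      simpa [reflect] using this
    have hp : (fun y => planeWave κ (reflect y)) = planeWave fun i => -κ i.rev := by
      funext y
      simp only [planeWave, reflect]
      congr 2
      refine Fintype.sum_equiv Fin.revPerm _ _ fun i => ?_
      simp
    rw [preWaveFun_eq_wordOp γ hκ hw, preWaveFun_eq_wordOp γ hκ' hw', e]
    have := congrFun (wordOp_reflect γ w (planeWave κ))
      (x ∘ ((wordPerm (revWord w))⁻¹ : Equiv.Perm (Fin N)))
    rw [hp] at this
    exact this
  · rw [preWaveFun_of_not_injective γ _ hx, preWaveFun_of_not_injective]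
    intro h
    apply hx
    have := (neg_injective.comp h).comp Fin.rev_injective
    simpa [reflect, Function.comp_def] using this

/-! ### The Dunkl-type eigenvalue equation -/

/-- The coefficients of the reflection terms in the Dunkl-type operators. -/
def dunklSign {N : ℕ} (x : Fin N → ℝ) (j k : Fin N) : ℂ :=
  (if k < j ∧ x k < x j then 1 else 0) - (if j < k ∧ x j < x k then 1 else 0)

/-- A simple transposition preserves the order of every pair of indices except the pair it
exchanges. So the reflection terms commute with it up to one diagonal contribution, where
injectivity of `x` makes exactly one of two indicators equal to `1`. -/
theorem dunklSign_swap {N : ℕ} {x : Fin N → ℝ} (hx : Function.Injective x)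
    (p : {p : Fin N × Fin N // (p.1 : ℕ) + 1 = p.2}) (j k : Fin N) :
    dunklSign x (Equiv.swap p.1.1 p.1.2 j) k
      - dunklSign (x ∘ Equiv.swap p.1.1 p.1.2) j (Equiv.swap p.1.1 p.1.2 k)
      = if j = k then (if j = p.1.1 then 1 else if j = p.1.2 then -1 else 0) else 0 := by
  obtain ⟨⟨i, i'⟩, hp⟩ := p
  dsimp only at hp ⊢
  have hne : i ≠ i' := fun h => by rw [h] at hp; omega
  have hlt : i < i' := by rw [Fin.lt_def]; omega
  simp only [dunklSign, Function.comp, Equiv.swap_apply_self]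
  by_cases h : j = k ∧ (j = i ∨ j = i')
  · obtain ⟨rfl, rfl | rfl⟩ := h
    · simp only [Equiv.swap_apply_left, hlt, hlt.not_gt, true_and, false_and, if_true, if_false]
      rcases lt_or_gt_of_ne (fun e => hne (hx e)) with h | h
      · simp [h, h.not_gt]
      · simp [h, h.not_gt]
    · simp only [Equiv.swap_apply_right, hlt, hlt.not_gt, true_and, false_and, if_true, if_false,
        hne.symm]
      rcases lt_or_gt_of_ne (fun e => hne (hx e)) with h | h
      · simp [h, h.not_gt]
      · simp [h, h.not_gt]
  · have e : (if j = k then (if j = i then (1 : ℂ) else if j = i' then -1 else 0) else 0) = 0 := by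
      split_ifs <;> tauto
    have h1 : k < Equiv.swap i i' j ↔ Equiv.swap i i' k < j := by
      simp only [Equiv.swap_apply_def, Fin.lt_def, Fin.ext_iff] at h hp ⊢
      split_ifs <;> omega
    have h2 : Equiv.swap i i' j < k ↔ j < Equiv.swap i i' k := by
      simp only [Equiv.swap_apply_def, Fin.lt_def, Fin.ext_iff] at h hp ⊢
      split_ifs <;> omega
    simp only [e, h1, h2, sub_self]

/-- The pre-wavefunctions solve the Dunkl-type eigenvalue equations off the walls. -/
theorem hasDerivAt_preWaveFun {N : ℕ} (γ : ℝ) {κ : Fin N → ℂ} (hκ : Function.Injective κ)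
    {x : Fin N → ℝ} (hx : Function.Injective x) (j : Fin N) :
    HasDerivAt (fun t : ℝ => preWaveFun γ κ (Function.update x j t))
      (Complex.I * κ j * preWaveFun γ κ x
        + γ * ∑ k, dunklSign x j k * preWaveFun γ κ (x ∘ Equiv.swap j k)) (x j) := by
  obtain ⟨σ, hσ⟩ := exists_strictAnti_comp hx
  obtain ⟨w, hw⟩ := exists_word σ⁻¹
  obtain ⟨z, hz, rfl⟩ : ∃ z : Fin N → ℝ, StrictAnti z ∧ z ∘ wordPerm w = x :=
    ⟨x ∘ σ, hσ, by rw [hw]; funext i; simp⟩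
  clear hw hσ
  -- In the decreasing chamber all reflection terms vanish and `ψ` is a plane wave.
  have hbase : ∀ (κ : Fin N → ℂ), Function.Injective κ → ∀ j,
      HasDerivAt (fun t : ℝ => preWaveFun γ κ (Function.update z j t))
      (Complex.I * κ j * preWaveFun γ κ z
        + γ * ∑ k, dunklSign z j k * preWaveFun γ κ (z ∘ Equiv.swap j k)) (z j) := by
    intro κ hκ j
    have h0 : ∀ k, dunklSign z j k = 0 := fun k => by
      rw [dunklSign, if_neg (fun h => (hz h.1).not_gt h.2), if_neg (fun h => (hz h.1).not_gt h.2),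
        sub_zero]
    have hev : ∀ᶠ t in nhds (z j), StrictAnti (Function.update z j t) := by
      have : ∀ a b : Fin N, a < b → ∀ᶠ t in nhds (z j),
          Function.update z j t b < Function.update z j t a := fun a b hab => by
        have hu : Continuous fun t : ℝ => Function.update z j t :=
          continuous_const.update j continuous_id
        have hc : ∀ i, Continuous fun t : ℝ => Function.update z j t i := fun i =>
          (continuous_apply i).comp hu
        refine (hc b).continuousAt.eventually_lt (hc a).continuousAt ?_
        simpa using hz hab
      filter_upwards [Filter.eventually_all.mpr fun a => Filter.eventually_all.mpr fun b =>
        Filter.eventually_imp_distrib_left.mpr (this a b)] with t ht a b hab using ht a b hab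
    have hpw : ∀ t, planeWave κ (Function.update z j t)
        = planeWave κ z * Complex.exp (Complex.I * κ j * (t - z j)) := fun t => by
      rw [planeWave, planeWave, ← Complex.exp_add]
      congr 1
      have : ∀ f : Fin N → ℝ, ∑ i, κ i * (f i : ℂ)
          = ∑ i ∈ Finset.univ.erase j, κ i * (f i : ℂ) + κ j * f j := fun f =>
        (Finset.sum_erase_add _ _ (Finset.mem_univ j)).symm
      rw [this, this z, Function.update_self]
      rw [Finset.sum_congr rfl (g := fun i => κ i * (z i : ℂ))]
      · ring
      · intro i hi
        rw [Function.update_of_ne (Finset.ne_of_mem_erase hi)]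
    have hd : HasDerivAt (fun t : ℝ => planeWave κ (Function.update z j t))
        (Complex.I * κ j * planeWave κ z) (z j) := by
      simp_rw [hpw]
      have h1 : HasDerivAt (fun t : ℝ => Complex.I * κ j * ((t : ℂ) - z j))
          (Complex.I * κ j * 1) (z j) :=
        ((Complex.ofRealCLM.hasDerivAt (x := z j)).sub_const _).const_mul _
      have h2 := h1.cexp.const_mul (planeWave κ z)
      refine h2.congr_deriv ?_
      simp; ring
    simp only [h0, zero_mul, Finset.sum_const_zero, mul_zero, add_zero]
    rw [preWaveFun_of_strictAnti γ hκ hz]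
    refine hd.congr_of_eventuallyEq ?_
    filter_upwards [hev] with t ht using preWaveFun_of_strictAnti γ hκ ht
  -- The equations pass from one chamber to the next, letter by letter. All momenta and all `j` are
  -- kept together, because `preWaveFun_comp_swap` mixes `κ` with `κ ∘ s`.
  have key : ∀ (w : SimpleWord N) (z : Fin N → ℝ), Function.Injective z →
      (∀ (κ : Fin N → ℂ), Function.Injective κ → ∀ j,
        HasDerivAt (fun t : ℝ => preWaveFun γ κ (Function.update z j t))
        (Complex.I * κ j * preWaveFun γ κ z
          + γ * ∑ k, dunklSign z j k * preWaveFun γ κ (z ∘ Equiv.swap j k)) (z j)) →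
      (∀ (κ : Fin N → ℂ), Function.Injective κ → ∀ j,
        HasDerivAt (fun t : ℝ => preWaveFun γ κ (Function.update (z ∘ wordPerm w) j t))
        (Complex.I * κ j * preWaveFun γ κ (z ∘ wordPerm w)
          + γ * ∑ k, dunklSign (z ∘ wordPerm w) j k *
            preWaveFun γ κ ((z ∘ wordPerm w) ∘ Equiv.swap j k)) ((z ∘ wordPerm w) j)) := by
    clear hκ κ j hbase hx hz z w
    intro w
    induction w with
    | nil => exact fun z _ h => h
    | cons p w ih =>
      intro x hx h
      have e : x ∘ wordPerm (p :: w) = (x ∘ Equiv.swap p.1.1 p.1.2) ∘ wordPerm w := rfl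
      rw [e]
      refine ih _ (hx.comp (Equiv.injective _)) ?_
      clear ih e
      intro κ hκ j
      have hp : p.1.1 ≠ p.1.2 := fun h => by
        have := p.2
        rw [h] at this; omega
      have hsw := preWaveFun_comp_swap γ hκ p
      set s := Equiv.swap p.1.1 p.1.2 with hs
      set a := Complex.I * γ / (κ p.1.1 - κ p.1.2) with ha
      have hup : ∀ t, Function.update (x ∘ s) j t = Function.update x (s j) t ∘ s := fun t => by
        have := Function.update_comp_equiv x s (s j) t
        rw [this]; simp [hs]
      simp_rw [hup, hsw]
      have h1 := (h (κ ∘ s) (hκ.comp s.injective) (s j)).const_mul (1 + a)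
      have h2 := (h κ hκ (s j)).const_mul a
      refine (h1.sub h2).congr_deriv ?_
      have hsum : ∑ k, dunklSign (x ∘ s) j k * preWaveFun γ κ ((x ∘ s) ∘ Equiv.swap j k)
          = ∑ k, dunklSign (x ∘ s) j (s k) *
            ((1 + a) * preWaveFun γ (κ ∘ s) (x ∘ Equiv.swap (s j) k)
              - a * preWaveFun γ κ (x ∘ Equiv.swap (s j) k)) := by
        refine (Fintype.sum_equiv s _ _ fun k => ?_).symm
        rw [← hsw]
        congr 2
        funext i
        simp only [Function.comp]
        rw [s.injective.map_swap, hs, Equiv.swap_apply_self]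
      have hdiff : ∑ k, dunklSign x (s j) k *
            ((1 + a) * preWaveFun γ (κ ∘ s) (x ∘ Equiv.swap (s j) k)
              - a * preWaveFun γ κ (x ∘ Equiv.swap (s j) k))
          - ∑ k, dunklSign (x ∘ s) j (s k) *
            ((1 + a) * preWaveFun γ (κ ∘ s) (x ∘ Equiv.swap (s j) k)
              - a * preWaveFun γ κ (x ∘ Equiv.swap (s j) k))
          = (if j = p.1.1 then 1 else if j = p.1.2 then -1 else 0) * preWaveFun γ κ x := by
        rw [← Finset.sum_sub_distrib, Finset.sum_eq_single j]
        · rw [← sub_mul, dunklSign_swap hx p, if_pos rfl, ← hsw]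
          by_cases h1 : j = p.1.1
          · rw [if_pos h1]
            congr 2
            funext i
            simp [hs, h1, Equiv.swap_comm]
          · by_cases h2 : j = p.1.2
            · rw [if_neg h1, if_pos h2]
              congr 2
              funext i
              simp [hs, h2]
            · rw [if_neg h1, if_neg h2, zero_mul, zero_mul]
        · intro k _ hk
          rw [← sub_mul, dunklSign_swap hx p, if_neg hk.symm, zero_mul]
        · simp
      -- The wave `ψ_κ` comes with the eigenvalue `κ (s j)` in place of `κ j`; the diagonal term
      -- found in `hdiff` exactly compensates the discrepancy.
      have hcoef : a * Complex.I * (κ j - κ (s j))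
          + γ * (if j = p.1.1 then 1 else if j = p.1.2 then -1 else 0) = 0 := by
        have hne : κ p.1.1 - κ p.1.2 ≠ 0 := sub_ne_zero.mpr fun e => hp (hκ e)
        by_cases h1 : j = p.1.1
        · rw [if_pos h1, h1, hs, Equiv.swap_apply_left, ha]
          field_simp
          rw [Complex.I_sq]; ring
        · by_cases h2 : j = p.1.2
          · rw [if_neg h1, if_pos h2, h2, hs, Equiv.swap_apply_right, ha]
            field_simp
            rw [← neg_sub (κ p.1.1), Complex.I_sq]; field_simp; ring
          · rw [if_neg h1, if_neg h2, hs, Equiv.swap_apply_of_ne_of_ne h1 h2]; ring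
      rw [hsum]
      have hS1 : ∑ k, dunklSign x (s j) k *
            ((1 + a) * preWaveFun γ (κ ∘ s) (x ∘ Equiv.swap (s j) k)
              - a * preWaveFun γ κ (x ∘ Equiv.swap (s j) k))
          = (1 + a) * ∑ k, dunklSign x (s j) k * preWaveFun γ (κ ∘ s) (x ∘ Equiv.swap (s j) k)
            - a * ∑ k, dunklSign x (s j) k * preWaveFun γ κ (x ∘ Equiv.swap (s j) k) := by
        rw [Finset.mul_sum, Finset.mul_sum, ← Finset.sum_sub_distrib]
        exact Finset.sum_congr rfl fun k _ => by ring
      rw [hS1] at hdiff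
      have hss : (κ ∘ s) (s j) = κ j := by simp [hs]
      rw [hss]
      linear_combination (γ : ℂ) * hdiff + preWaveFun γ κ x * hcoef
  exact key w z hz.injective hbase κ hκ j

/-! ### Appending a particle in the last position -/

/-- The tuple `(x_1, …, x_N, t)`. -/
def addLast {α : Type*} {N : ℕ} (x : Fin N → α) (t : α) : Fin (N + 1) → α :=
  Fin.snoc (α := fun _ => α) x t

section AddLast

variable {α : Type*} {N : ℕ}

@[simp] theorem addLast_castSucc (x : Fin N → α) (t : α) (j : Fin N) :
    addLast x t j.castSucc = x j := Fin.snoc_castSucc (α := fun _ => α) _ _ _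

@[simp] theorem addLast_last (x : Fin N → α) (t : α) : addLast x t (Fin.last N) = t :=
  Fin.snoc_last (α := fun _ => α) _ _

@[simp] theorem addLast_comp_castSucc (x : Fin N → α) (t : α) :
    addLast x t ∘ Fin.castSucc = x := by
  funext j; simp

theorem addLast_eta (y : Fin (N + 1) → α) : addLast (y ∘ Fin.castSucc) (y (Fin.last N)) = y := by
  funext j
  refine Fin.lastCases ?_ (fun j => ?_) j <;> simp

theorem injective_addLast {x : Fin N → α} {t : α} :
    Function.Injective (addLast x t) ↔ Function.Injective x ∧ t ∉ Set.range x := by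
  constructor
  · intro h
    refine ⟨?_, ?_⟩
    · have := h.comp (Fin.castSucc_injective N)
      rwa [addLast_comp_castSucc] at this
    · rintro ⟨j, hj⟩
      have := @h j.castSucc (Fin.last N) (by simpa using hj)
      exact Fin.castSucc_ne_last _ this
  · rintro ⟨h, ht⟩ a b
    refine Fin.lastCases ?_ (fun a => ?_) a <;> refine Fin.lastCases ?_ (fun b => ?_) b
    · simp
    · simpa using fun e => absurd ⟨b, e.symm⟩ ht
    · simpa using fun e => absurd ⟨a, e⟩ ht
    · simpa using fun e => h e

theorem update_addLast_last (x : Fin N → α) (s t : α) :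
    Function.update (addLast x s) (Fin.last N) t = addLast x t := by
  funext j
  refine Fin.lastCases ?_ (fun j => ?_) j
  · simp
  · rw [Function.update_of_ne (Fin.castSucc_ne_last j)]; simp

theorem addLast_comp_swap (x : Fin N → α) (t : α) (k : Fin N) :
    addLast x t ∘ Equiv.swap (Fin.last N) k.castSucc = addLast (Function.update x k t) (x k) := by
  funext j
  refine Fin.lastCases ?_ (fun j => ?_) j
  · simp
  · by_cases h : j = k
    · subst h; simp
    · have : j.castSucc ≠ k.castSucc := fun e => h (Fin.castSucc_injective N e)
      simp [Equiv.swap_apply_of_ne_of_ne (Fin.castSucc_ne_last j) this, h]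

theorem continuous_addLast {X : Type*} [TopologicalSpace X] [TopologicalSpace α]
    {f : X → Fin N → α} {g : X → α} (hf : Continuous f) (hg : Continuous g) :
    Continuous fun a => addLast (f a) (g a) := by
  refine continuous_pi fun j => ?_
  refine Fin.lastCases ?_ (fun j => ?_) j
  · simpa using hg
  · simpa [Function.comp_def] using (continuous_apply j).comp hf

end AddLast

/-! ### Measurability and local boundedness -/

/-- Measurable functions which are bounded on all cubes. -/
structure IsLocallyBounded {N : ℕ} (f : (Fin N → ℝ) → ℂ) : Prop where
  measurable : Measurable f
  bound : ∀ A : ℝ, ∃ C : ℝ, ∀ x : Fin N → ℝ, (∀ j, |x j| ≤ A) → ‖f x‖ ≤ C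

theorem isLocallyBounded_preWaveFun {N : ℕ} (γ : ℝ) (κ : Fin N → ℂ) :
    IsLocallyBounded (preWaveFun γ κ) := by
  classical
  have hperm : ∀ σ : Equiv.Perm (Fin N),
      Continuous fun x : Fin N → ℝ => x ∘ (σ⁻¹ : Equiv.Perm (Fin N)) := fun σ =>
    continuous_pi fun _ => continuous_apply _
  have hc : ∀ σ : Equiv.Perm (Fin N), Continuous fun x : Fin N → ℝ =>
      deformedPerm γ σ (planeWave κ) (x ∘ (σ⁻¹ : Equiv.Perm (Fin N))) := fun σ =>
    (continuous_wordOp γ _ _ (continuous_planeWave κ)).comp (hperm σ)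
  refine ⟨?_, fun A => ?_⟩
  · refine Finset.measurable_fun_sum _ fun σ _ => ?_
    have ht : Measurable fun x : Fin N → ℝ =>
        theta (StrictAnti (x ∘ (σ⁻¹ : Equiv.Perm (Fin N)))) :=
      Measurable.ite (measurableSet_strictAnti _ (hperm σ).measurable) measurable_const
        measurable_const
    exact ht.mul (hc σ).measurable
  · choose C hC using fun σ => (isCompact_univ_pi fun _ : Fin N =>
      isCompact_Icc (a := -A) (b := A)).exists_bound_of_continuousOn (hc σ).continuousOn
    refine ⟨∑ σ, C σ, fun x hx => (norm_sum_le _ _).trans (Finset.sum_le_sum fun σ _ => ?_)⟩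
    refine le_trans ?_ (hC σ x fun j _ => abs_le.mp (hx j))
    rw [norm_mul]
    refine mul_le_of_le_one_left (norm_nonneg _) ?_
    unfold theta
    split_ifs <;> simp

/-! ### Continuity across the walls -/

theorem strictAnti_comp_of_lt_imp {N : ℕ} {y y' : Fin N → ℝ} (h : ∀ a b, y a < y b → y' a < y' b)
    {σ : Equiv.Perm (Fin N)} (hy : StrictAnti (y ∘ σ)) : StrictAnti (y' ∘ σ) :=
  fun _ _ hab => h _ _ (hy hab)

theorem posSwap_of_eq {N : ℕ} (γ : ℝ) {p q : Fin N} (f : (Fin N → ℝ) → ℂ) {z : Fin N → ℝ}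
    (h : z p = z q) : posSwap γ p q f z = f z := by
  have : z ∘ Equiv.swap p q = z := by
    funext i
    simp only [Function.comp, Equiv.swap_apply_def]
    split_ifs with h1 h2 <;> simp_all
  rw [posSwap, this, intOp, h, sub_self, intervalIntegral.integral_same, mul_zero, add_zero]

/-- Near a wall `t = x_k` the function is given by a word `w` on the right and by the word `s_p w`
on the left. On the wall `s_p` fixes the sorted point and the integral in `s_{p,γ}` is over a
degenerate interval, so both sides have the same limit. -/
theorem exists_tendsto_preWaveFun_addLast {N : ℕ} (γ : ℝ) {κ : Fin (N + 1) → ℂ}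
    (hκ : Function.Injective κ) {x : Fin N → ℝ} (hx : Function.Injective x) (t₀ : ℝ) :
    ∃ l, Filter.Tendsto (fun t => preWaveFun γ κ (addLast x t)) (nhdsWithin t₀ (Set.range x)ᶜ)
      (nhds l) := by
  by_cases ht : t₀ ∈ Set.range x
  · obtain ⟨k, rfl⟩ := ht
    have hkx : ∀ i, x i = x k → i = k := fun i h => hx h
    -- `t₁` and `t₂` lie so close to `x_k` that no other coordinate is between them; one chamber
    -- then covers each side of the wall.
    obtain ⟨t₁, h1, h1'⟩ : ∃ t₁, x k < t₁ ∧ ∀ i, x k < x i → t₁ < x i := by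
      have : ∀ᶠ t in nhdsWithin (x k) (Set.Ioi (x k)), ∀ i, x k < x i → t < x i :=
        Filter.eventually_all.mpr fun i => Filter.eventually_imp_distrib_left.mpr fun h =>
          nhdsWithin_le_nhds (Iio_mem_nhds h)
      obtain ⟨t, ht, ht'⟩ := (this.and self_mem_nhdsWithin).exists
      exact ⟨t, ht', ht⟩
    obtain ⟨t₂, h2, h2'⟩ : ∃ t₂, t₂ < x k ∧ ∀ i, x i < x k → x i < t₂ := by
      have : ∀ᶠ t in nhdsWithin (x k) (Set.Iio (x k)), ∀ i, x i < x k → x i < t :=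
        Filter.eventually_all.mpr fun i => Filter.eventually_imp_distrib_left.mpr fun h =>
          nhdsWithin_le_nhds (Ioi_mem_nhds h)
      obtain ⟨t, ht, ht'⟩ := (this.and self_mem_nhdsWithin).exists
      exact ⟨t, ht', ht⟩
    have ht₁ : t₁ ∉ Set.range x := by
      rintro ⟨i, rfl⟩
      exact lt_irrefl _ (h1' i h1)
    obtain ⟨w, hw⟩ := exists_strictAnti_word (injective_addLast.mpr ⟨hx, ht₁⟩)
    set σ := wordPerm w with hσ
    have hright : ∀ t ∈ Set.Ioc (x k) t₁,
        StrictAnti (addLast x t ∘ (σ⁻¹ : Equiv.Perm (Fin (N + 1)))) := by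
      intro t ht
      refine strictAnti_comp_of_lt_imp (fun a b => ?_) hw
      refine Fin.lastCases ?_ (fun a => ?_) a <;> refine Fin.lastCases ?_ (fun b => ?_) b
      · simp
      · simpa using fun h => ht.2.trans_lt h
      · simp only [addLast_castSucc, addLast_last]
        intro h
        refine lt_of_le_of_lt ?_ ht.1
        by_contra hlt
        exact (h1' a (not_le.mp hlt)).not_gt h
      · simp
    have hleft : ∀ t ∈ Set.Ico t₂ (x k),
        StrictAnti ((addLast x t ∘ Equiv.swap (Fin.last N) k.castSucc) ∘
          (σ⁻¹ : Equiv.Perm (Fin (N + 1)))) := by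
      intro t ht
      rw [addLast_comp_swap]
      refine strictAnti_comp_of_lt_imp (fun a b => ?_) hw
      refine Fin.lastCases ?_ (fun a => ?_) a <;> refine Fin.lastCases ?_ (fun b => ?_) b
      · simp
      · simp only [addLast_castSucc, addLast_last]
        intro h
        have : b ≠ k := by rintro rfl; exact h1.not_gt h
        rw [Function.update_of_ne this]
        exact h1.trans h
      · simp only [addLast_castSucc, addLast_last]
        intro h
        by_cases hak : a = k
        · subst hak; simpa using ht.2
        · rw [Function.update_of_ne hak]
          refine lt_of_le_of_ne ?_ fun e => hak (hx e)
          by_contra hlt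
          exact (h1' a (not_le.mp hlt)).not_gt h
      · simp only [addLast_castSucc]
        intro h
        by_cases hak : a = k
        · subst hak
          have : b ≠ a := by rintro rfl; exact lt_irrefl _ h
          rw [Function.update_self, Function.update_of_ne this]
          exact ht.2.trans h
        · rw [Function.update_of_ne hak]
          by_cases hbk : b = k
          · subst hbk
            rw [Function.update_self]
            exact (h2' a h).trans_le ht.1
          · rwa [Function.update_of_ne hbk]
    -- `p` and `q` are the ranks of the last coordinate and of `x_k` just to the right of the wall.
    -- They are consecutive since no coordinate lies between the two.
    set p := σ (Fin.last N) with hp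
    set q := σ k.castSucc with hq
    have hpq : (p : ℕ) + 1 = q := by
      have hzp : (addLast x t₁ ∘ (σ⁻¹ : Equiv.Perm (Fin (N + 1)))) p = t₁ := by simp [hp]
      have hzq : (addLast x t₁ ∘ (σ⁻¹ : Equiv.Perm (Fin (N + 1)))) q = x k := by simp [hq]
      have hlt : p < q := by
        rw [← hw.lt_iff_gt, hzp, hzq]; exact h1
      by_contra hne
      have hlt' : (p : ℕ) + 1 < q := lt_of_le_of_ne hlt hne
      let m : Fin (N + 1) := ⟨p + 1, hlt'.trans q.2⟩
      have hm1 := hw (show p < m from Nat.lt_succ_self _)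
      have hm2 := hw (show m < q from hlt')
      rw [hzp] at hm1
      rw [hzq] at hm2
      simp only [Function.comp] at hm1 hm2
      generalize (σ⁻¹ : Equiv.Perm (Fin (N + 1))) m = i at hm1 hm2
      revert hm1 hm2
      refine Fin.lastCases ?_ (fun i => ?_) i
      · simp
      · simp only [addLast_castSucc]
        intro h3 h4
        exact (h1' i h4).not_gt h3
    set w' : SimpleWord (N + 1) := ⟨(p, q), hpq⟩ :: w with hw'
    have hperm : ((wordPerm w')⁻¹ : Equiv.Perm (Fin (N + 1)))
        = Equiv.swap (Fin.last N) k.castSucc * σ⁻¹ := by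
      have : wordPerm w' = Equiv.swap p q * σ := rfl
      rw [this, mul_inv_rev, Equiv.swap_inv, hp, hq, Equiv.swap_apply_apply]
      simp [mul_assoc]
    set g := wordOp γ w (planeWave κ) with hg
    have hgc : Continuous g := continuous_wordOp γ w _ (continuous_planeWave κ)
    have hcont : Continuous fun t => addLast x t :=
      continuous_addLast continuous_const continuous_id
    have hperm_cont : ∀ ρ : Equiv.Perm (Fin (N + 1)), Continuous fun t => addLast x t ∘ ρ :=
      fun ρ => continuous_pi fun i => (continuous_apply (ρ i)).comp hcont
    refine ⟨g (addLast x (x k) ∘ (σ⁻¹ : Equiv.Perm (Fin (N + 1)))), ?_⟩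
    have hle : nhdsWithin (x k) (Set.range x)ᶜ
        ≤ nhdsWithin (x k) (Set.Iio (x k)) ⊔ nhdsWithin (x k) (Set.Ioi (x k)) := by
      rw [← nhdsWithin_union]
      refine nhdsWithin_mono _ fun t ht => ?_
      exact lt_or_gt_of_ne fun e => ht ⟨k, e.symm⟩
    refine Filter.Tendsto.mono_left (Filter.tendsto_sup.mpr ⟨?_, ?_⟩) hle
    · have hlim : Filter.Tendsto (fun t => posSwap γ p q g
          ((addLast x t ∘ Equiv.swap (Fin.last N) k.castSucc) ∘
            (σ⁻¹ : Equiv.Perm (Fin (N + 1))))) (nhdsWithin (x k) (Set.Iio (x k)))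
          (nhds (g (addLast x (x k) ∘ (σ⁻¹ : Equiv.Perm (Fin (N + 1)))))) := by
        have hc := (continuous_posSwap γ p q g hgc).comp
          (hperm_cont (Equiv.swap (Fin.last N) k.castSucc * σ⁻¹))
        refine ((hc.tendsto (x k)).mono_left nhdsWithin_le_nhds).congr' ?_ |>.trans ?_
        · exact Filter.Eventually.of_forall fun t => rfl
        · rw [Function.comp_apply, Equiv.Perm.coe_mul, ← Function.comp_assoc, addLast_comp_swap,
            Function.update_eq_self, posSwap_of_eq]
          simp [hp, hq]
      refine hlim.congr' ?_
      filter_upwards [Ico_mem_nhdsLT h2] with t ht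
      have := preWaveFun_eq_wordOp γ hκ (x := addLast x t) (w := w')
        (by rw [hperm]; exact hleft t ht)
      rw [this, hperm]
      rfl
    · have hc := hgc.comp (hperm_cont σ⁻¹)
      refine ((hc.tendsto (x k)).mono_left nhdsWithin_le_nhds).congr' ?_
      filter_upwards [Ioc_mem_nhdsGT h1] with t ht
      exact (preWaveFun_eq_wordOp γ hκ (hright t ht)).symm
  · refine ⟨preWaveFun γ κ (addLast x t₀), ?_⟩
    have h := hasDerivAt_preWaveFun γ hκ (injective_addLast.mpr ⟨hx, ht⟩) (Fin.last N)
    simp only [update_addLast_last, addLast_last] at h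
    exact h.continuousAt.tendsto.mono_left nhdsWithin_le_nhds

/-! ### The integral equation in the last coordinate -/

theorem IsLocallyBounded.intervalIntegrable {N : ℕ} {f : (Fin N → ℝ) → ℂ} (hf : IsLocallyBounded f)
    {φ : ℝ → Fin N → ℝ} (hφ : Continuous φ) {c : ℝ → ℂ} (hc : Continuous c) (a b : ℝ) :
    IntervalIntegrable (fun y => c y * f (φ y)) volume a b := by
  obtain ⟨A, hA⟩ := (isCompact_uIcc (a := a) (b := b)).exists_bound_of_continuousOn
    hφ.continuousOn
  obtain ⟨C, hC⟩ := hf.bound A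
  obtain ⟨D, hD⟩ := (isCompact_uIcc (a := a) (b := b)).exists_bound_of_continuousOn
    hc.continuousOn
  refine (intervalIntegrable_const (c := D * C)).mono_fun
    (hc.measurable.mul (hf.measurable.comp hφ.measurable)).aestronglyMeasurable ?_
  refine (ae_restrict_iff' measurableSet_uIoc).mpr (Filter.Eventually.of_forall fun y hy => ?_)
  have hy' := Set.uIoc_subset_uIcc hy
  have h1 := hD y hy'
  have h2 := hC (φ y) fun j => (norm_le_pi_norm (φ y) j).trans (hA y hy')
  simp only [norm_mul]
  calc ‖c y‖ * ‖f (φ y)‖ ≤ D * C :=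
        mul_le_mul h1 h2 (norm_nonneg _) ((norm_nonneg _).trans h1)
    _ ≤ ‖D‖ * ‖C‖ := by rw [← norm_mul]; exact le_abs_self _

theorem dunklSign_last {N : ℕ} (x : Fin N → ℝ) (t : ℝ) (k : Fin N) :
    dunklSign (addLast x t) (Fin.last N) k.castSucc = if x k < t then 1 else 0 := by
  simp [dunklSign, Fin.castSucc_lt_last, (Fin.castSucc_lt_last k).not_gt]

theorem integral_ite_lt {f : ℝ → ℂ} {a b u : ℝ} (hau : a < u) (hab : a < b)
    (hf : ∀ c d, IntervalIntegrable f volume c d) :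
    IntervalIntegrable (fun y => if u < y then f y else 0) volume a b ∧
    ∫ y in a..b, (if u < y then f y else 0) = if u < b then ∫ y in u..b, f y else 0 := by
  have hind : (fun y => if u < y then f y else 0) = (Set.Ioi u).indicator f := by
    funext y; simp [Set.indicator]
  rw [hind]
  refine ⟨⟨(hf a b).1.indicator measurableSet_Ioi, (hf a b).2.indicator measurableSet_Ioi⟩, ?_⟩
  rw [intervalIntegral.integral_of_le hab.le, setIntegral_indicator measurableSet_Ioi]
  have : Set.Ioc a b ∩ Set.Ioi u = Set.Ioc u b := by
    ext y
    simp only [Set.mem_inter_iff, Set.mem_Ioc, Set.mem_Ioi]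
    exact ⟨fun h => ⟨h.2, h.1.2⟩, fun h => ⟨⟨hau.trans h.1, h.2⟩, h.1⟩⟩
  rw [this]
  split_ifs with h
  · rw [intervalIntegral.integral_of_le h.le]
  · rw [Set.Ioc_eq_empty h]; simp

/-- In the last coordinate the Dunkl-type equation is a first-order linear equation in `t`, forced
by the reflection terms with `x_k < t`. Multiplying by `e^{-iμt}` and integrating from a point left
of all `x_k` gives the formula. -/
theorem preWaveFun_addLast_eq {N : ℕ} (γ : ℝ) {κ : Fin (N + 1) → ℂ}
    (hκ : Function.Injective κ) {x : Fin N → ℝ} {t : ℝ}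
    (hxt : Function.Injective (addLast x t)) :
    preWaveFun γ κ (addLast x t) =
      Complex.exp (Complex.I * κ (Fin.last N) * t) * preWaveFun γ (κ ∘ Fin.castSucc) x
      + γ * ∑ k, if x k < t then ∫ y in x k..t, Complex.exp (Complex.I * κ (Fin.last N) * (t - y)) *
          preWaveFun γ κ (addLast (Function.update x k y) (x k)) else 0 := by
  obtain ⟨hx, ht⟩ := injective_addLast.mp hxt
  set μ := κ (Fin.last N) with hμ
  set F : ℝ → ℂ := fun t => preWaveFun γ κ (addLast x t) with hF
  have hfin : (Set.range x).Finite := Set.finite_range x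
  have hdense : Dense (Set.range x)ᶜ := hfin.countable.dense_compl ℝ
  -- `F` takes the value `0` on the walls. The fundamental theorem of calculus off a countable set
  -- needs continuity everywhere, so `F` is replaced there by its limits.
  set g := extendFrom (Set.range x)ᶜ F with hg
  have hgc : Continuous g :=
    continuous_extendFrom hdense fun t => exists_tendsto_preWaveFun_addLast γ hκ hx t
  have hder : ∀ s ∉ Set.range x, HasDerivAt F (Complex.I * μ * F s
      + γ * ∑ k, (if x k < s then 1 else 0) *
        preWaveFun γ κ (addLast (Function.update x k s) (x k))) s := fun s hs => by
    have h := hasDerivAt_preWaveFun γ hκ (injective_addLast.mpr ⟨hx, hs⟩) (Fin.last N)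
    simp only [update_addLast_last, addLast_last, Fin.sum_univ_castSucc, dunklSign_last,
      addLast_comp_swap] at h
    simpa [dunklSign] using h
  have hgF : ∀ s ∉ Set.range x, g s = F s := fun s hs =>
    extendFrom_extends (fun s hs => (hder s hs).continuousAt.continuousWithinAt) s hs
  obtain ⟨t₀, ht₀, ht₀'⟩ : ∃ t₀, t₀ < t ∧ ∀ k, t₀ < x k := by
    have : ∀ᶠ s in Filter.atBot, s < t ∧ ∀ k, s < x k :=
      (Filter.eventually_lt_atBot t).and
        (Filter.eventually_all.mpr fun k => Filter.eventually_lt_atBot (x k))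
    exact this.exists
  have ht₀x : t₀ ∉ Set.range x := by
    rintro ⟨k, rfl⟩
    exact lt_irrefl _ (ht₀' k)
  set f : Fin N → ℝ → ℂ := fun k y => Complex.exp (-(Complex.I * μ) * y) *
    preWaveFun γ κ (addLast (Function.update x k y) (x k)) with hf
  have hfi : ∀ k a b, IntervalIntegrable (f k) volume a b := fun k a b =>
    (isLocallyBounded_preWaveFun γ κ).intervalIntegrable
      (continuous_addLast (continuous_const.update k continuous_id) continuous_const)
      (by fun_prop) a b
  have hint : IntervalIntegrable (fun s => (γ : ℂ) * ∑ k, if x k < s then f k s else 0)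
      volume t₀ t := by
    have h := (IntervalIntegrable.sum Finset.univ fun k _ =>
      (integral_ite_lt (ht₀' k) ht₀ (hfi k)).1).const_mul (γ : ℂ)
    refine h.congr fun s _ => ?_
    simp [Finset.sum_apply]
  have hftc := integral_eq_of_hasDerivAt_off_countable_of_le
    (fun s : ℝ => Complex.exp (-(Complex.I * μ) * s) * g s)
    (fun s => γ * ∑ k, if x k < s then f k s else 0) ht₀.le hfin.countable
    (by fun_prop) (fun s hs => by
      have h1 : HasDerivAt (fun s : ℝ => Complex.exp (-(Complex.I * μ) * s))
          (Complex.exp (-(Complex.I * μ) * s) * (-(Complex.I * μ) * 1)) s :=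
        ((Complex.ofRealCLM.hasDerivAt (x := s)).const_mul _).cexp
      have h2 : HasDerivAt g (Complex.I * μ * F s
          + γ * ∑ k, (if x k < s then 1 else 0) *
            preWaveFun γ κ (addLast (Function.update x k s) (x k))) s :=
        (hder s hs.2).congr_of_eventuallyEq
          (by filter_upwards [hfin.isClosed.isOpen_compl.mem_nhds hs.2] with r hr using hgF r hr)
      refine (h1.mul h2).congr_deriv ?_
      rw [hgF s hs.2]
      have : ∑ k, (if x k < s then f k s else 0) = Complex.exp (-(Complex.I * μ) * s) *
          ∑ k, (if x k < s then 1 else 0) *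
            preWaveFun γ κ (addLast (Function.update x k s) (x k)) := by
        rw [Finset.mul_sum]
        refine Finset.sum_congr rfl fun k _ => ?_
        split_ifs <;> simp [hf]
      rw [this]
      ring)
    hint
  rw [intervalIntegral.integral_const_mul, intervalIntegral.integral_finsetSum
    (fun k _ => (integral_ite_lt (ht₀' k) ht₀ (hfi k)).1),
    Finset.sum_congr rfl fun k _ => (integral_ite_lt (ht₀' k) ht₀ (hfi k)).2,
    hgF t ht, hgF t₀ ht₀x] at hftc
  -- The initial value: at `t₀` the last particle is to the left of all others and decouples.
  have hF0 : F t₀ = preWaveFun γ (κ ∘ Fin.castSucc) x * Complex.exp (Complex.I * μ * t₀) := by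
    have := preWaveFun_of_last_lt γ hκ (injective_addLast.mpr ⟨hx, ht₀x⟩) (by simpa using ht₀')
    simpa using this
  have hmul : ∀ k, (if x k < t then ∫ y in x k..t, Complex.exp (Complex.I * μ * (t - y)) *
          preWaveFun γ κ (addLast (Function.update x k y) (x k)) else 0)
      = Complex.exp (Complex.I * μ * t) * (if x k < t then ∫ y in x k..t, f k y else 0) := by
    intro k
    split_ifs
    · rw [← intervalIntegral.integral_const_mul]
      refine intervalIntegral.integral_congr fun y _ => ?_
      simp only [hf]
      rw [← mul_assoc, ← Complex.exp_add]
      congr 2; ring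
    · simp
  simp_rw [hmul]
  rw [← Finset.mul_sum]
  have e1 : Complex.exp (Complex.I * μ * t) * Complex.exp (-(Complex.I * μ) * t) = 1 := by
    rw [← Complex.exp_add, ← Complex.exp_zero]; congr 1; ring
  have e2 : Complex.exp (Complex.I * μ * t₀) * Complex.exp (-(Complex.I * μ) * t₀) = 1 := by
    rw [← Complex.exp_add, ← Complex.exp_zero]; congr 1; ring
  rw [hF0] at hftc
  change F t = _
  linear_combination -Complex.exp (Complex.I * μ * t) * hftc - F t * e1
    + Complex.exp (Complex.I * μ * t) * preWaveFun γ (κ ∘ Fin.castSucc) x * e2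

/-! ### The recursion for `b⁻` -/

/-- The box for `y_1` is `(v_0, t]`, and the remaining variables range over a box of the same shape
with upper end `v_0`; Fubini thus makes the nested integrals recursive. -/
theorem setIntegral_boxAbove_succ {n : ℕ} (t : ℝ) (v : Fin (n + 1) → ℝ)
    (Φ : (Fin (n + 1) → ℝ) → ℂ) (hΦ : IntegrableOn Φ (boxAbove t v)) :
    IntegrableOn (fun y => ∫ y' in boxAbove (v 0) (Fin.tail v), Φ (Fin.cons y y'))
      (Set.Ioc (v 0) t) ∧
    ∫ Y in boxAbove t v, Φ Y
      = ∫ y in Set.Ioc (v 0) t, ∫ y' in boxAbove (v 0) (Fin.tail v), Φ (Fin.cons y y') := by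
  set E := (MeasurableEquiv.piFinSuccAbove (fun _ : Fin (n + 1) => ℝ) 0).symm with hE
  have hmp : MeasurePreserving E :=
    (volume_preserving_piFinSuccAbove (fun _ : Fin (n + 1) => ℝ) 0).symm
  have hval : ∀ p : ℝ × (Fin n → ℝ), E p = Fin.cons p.1 p.2 := fun p => by
    change Fin.insertNth (α := fun _ => ℝ) 0 p.1 p.2 = _
    exact Fin.insertNth_zero' _ _
  have hpre : E ⁻¹' boxAbove t v = Set.Ioc (v 0) t ×ˢ boxAbove (v 0) (Fin.tail v) := by
    ext p
    rw [Set.mem_preimage, hval]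
    simp only [boxAbove, Set.mem_pi, Set.mem_univ, true_implies, Set.mem_prod, Fin.forall_fin_succ]
    refine and_congr (by simp) (forall_congr' fun m => ?_)
    simp only [Fin.cons_succ, Fin.castSucc_succ, Fin.tail]
    rw [Fin.cons_self_tail]
  have hint : IntegrableOn (fun p : ℝ × (Fin n → ℝ) => Φ (Fin.cons p.1 p.2))
      (Set.Ioc (v 0) t ×ˢ boxAbove (v 0) (Fin.tail v)) (volume.prod volume) := by
    have := (hmp.integrableOn_comp_preimage E.measurableEmbedding).mpr hΦ
    rw [hpre] at this
    refine this.congr_fun_ae (Filter.Eventually.of_forall fun p => ?_)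
    simp only [Function.comp, hval]
  refine ⟨?_, ?_⟩
  · rw [IntegrableOn, ← Measure.prod_restrict] at hint
    exact hint.integral_prod_left
  · rw [← hmp.setIntegral_preimage_emb E.measurableEmbedding, hpre]
    simp_rw [hval]
    exact setIntegral_prod _ hint

theorem measurable_replace {N n : ℕ} (i : Fin n ↪ Fin N) (x : Fin N → ℝ) :
    Measurable fun Y : Fin n → ℝ => replace i Y x := by
  refine measurable_pi_lambda _ fun j => ?_
  by_cases h : ∃ m, i m = j
  · obtain ⟨m, rfl⟩ := h
    simp only [replace, i.injective.extend_apply]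
    exact measurable_pi_apply m
  · simp only [replace, Function.extend_apply' _ _ _ h]
    exact measurable_const

theorem abs_replace_le {N n : ℕ} (i : Fin n ↪ Fin N) {A : ℝ} {x : Fin N → ℝ} {Y : Fin n → ℝ}
    (hx : ∀ j, |x j| ≤ A) (hY : ∀ m, |Y m| ≤ A) (j : Fin N) : |replace i Y x j| ≤ A := by
  by_cases h : ∃ m, i m = j
  · obtain ⟨m, rfl⟩ := h
    simp only [replace, i.injective.extend_apply]
    exact hY m
  · simp only [replace, Function.extend_apply' _ _ _ h]
    exact hx j

/-- The integrand of `shiftIntegral`. -/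
def shiftIntegrand {N n : ℕ} (l : ℂ) (i : Fin n ↪ Fin N) (f : (Fin N → ℝ) → ℂ) (x : Fin N → ℝ)
    (Y : Fin n → ℝ) : ℂ :=
  (∏ m, Complex.exp (Complex.I * l * ((x (i m) : ℂ) - Y m))) * f (replace i Y x)

theorem IsLocallyBounded.integrableOn_shiftIntegrand {N n : ℕ} {f : (Fin N → ℝ) → ℂ}
    (hf : IsLocallyBounded f) (l : ℂ) (i : Fin n ↪ Fin N) (x : Fin N → ℝ) (A : ℝ)
    (hx : ∀ j, |x j| ≤ A) :
    IntegrableOn (shiftIntegrand l i f x) (Set.pi Set.univ fun _ => Set.Icc (-A) A) := by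
  have hc : Continuous fun Y : Fin n → ℝ =>
      ∏ m, Complex.exp (Complex.I * l * ((x (i m) : ℂ) - Y m)) := by fun_prop
  have hcompact : IsCompact (Set.pi Set.univ fun _ : Fin n => Set.Icc (-A) A) :=
    isCompact_univ_pi fun _ => isCompact_Icc
  obtain ⟨C, hC⟩ := hf.bound A
  obtain ⟨D, hD⟩ := hcompact.exists_bound_of_continuousOn hc.continuousOn
  refine Measure.integrableOn_of_bounded (M := D * C) hcompact.measure_lt_top.ne
    (hc.measurable.mul (hf.measurable.comp (measurable_replace i x))).aestronglyMeasurable ?_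
  refine (ae_restrict_iff' hcompact.measurableSet).mpr (Filter.Eventually.of_forall fun Y hY => ?_)
  rw [shiftIntegrand, norm_mul]
  have h1 := hD Y hY
  exact mul_le_mul h1 (hC _ (abs_replace_le i hx fun m => abs_le.mpr (hY m (Set.mem_univ m))))
    (norm_nonneg _) ((norm_nonneg _).trans h1)

theorem shiftIntegrand_cons {N n : ℕ} (l : ℂ) {i : Fin (n + 1) ↪ Fin N} {i' : Fin n ↪ Fin N}
    {k : Fin N} (h0 : i 0 = k) (hs : ∀ m, i m.succ = i' m) (hk : k ∉ Set.range i')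
    (f : (Fin N → ℝ) → ℂ) (x : Fin N → ℝ) (y : ℝ) (y' : Fin n → ℝ) :
    shiftIntegrand l i f x (Fin.cons y y') = Complex.exp (Complex.I * l * (x k - y)) *
      shiftIntegrand l i' f (Function.update x k y) y' := by
  have hne : ∀ m, i' m ≠ k := fun m h => hk ⟨m, h⟩
  have hr : replace i (Fin.cons y y') x = replace i' y' (Function.update x k y) := by
    funext j
    by_cases h : ∃ m, i' m = j
    · obtain ⟨m, rfl⟩ := h
      rw [replace, replace, i'.injective.extend_apply, ← hs, i.injective.extend_apply, Fin.cons_succ]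
    · rw [replace, replace, Function.extend_apply' y' _ j h]
      by_cases hj : j = k
      · rw [hj, ← h0, i.injective.extend_apply, Fin.cons_zero, Function.update_self]
      · rw [Function.update_of_ne hj, Function.extend_apply']
        rintro ⟨m, hm⟩
        revert hm
        refine Fin.cases (fun hm => hj (by rw [← hm, h0])) (fun m hm => h ⟨m, ?_⟩) m
        rw [← hs, hm]
  rw [shiftIntegrand, shiftIntegrand, hr, Fin.prod_univ_succ, h0]
  simp only [Fin.cons_zero, Fin.cons_succ, hs, Function.update_of_ne (hne _), mul_assoc]

theorem hatMinusFun_addLast {N n : ℕ} (l : ℂ) (i : Fin n ↪ Fin N) (f : (Fin N → ℝ) → ℂ)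
    (x : Fin N → ℝ) (t : ℝ) : hatMinusFun l i f (addLast x t) = Complex.exp (Complex.I * l * t) *
      theta (StrictAnti (Fin.cons t (x ∘ i) : Fin (n + 1) → ℝ)) *
        ∫ Y in boxAbove t (x ∘ i), shiftIntegrand l i f x Y := by
  simp only [hatMinusFun, addLast_last, addLast_comp_castSucc]
  rfl

/-- After `y = y_1` is split off, the next upper limit is `x_k`, which now plays the role of the
last coordinate, while `y` occupies place `k`. The phases match because `e^{il(t-y)} e^{il x_k} =
e^{ilt} e^{il(x_k-y)}`. -/
theorem hatMinusFun_succ {N n : ℕ} (l : ℂ) {f : (Fin N → ℝ) → ℂ} (hf : IsLocallyBounded f)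
    {i : Fin (n + 1) ↪ Fin N} {i' : Fin n ↪ Fin N}
    {k : Fin N} (h0 : i 0 = k) (hs : ∀ m, i m.succ = i' m) (hk : k ∉ Set.range i')
    (x : Fin N → ℝ) {t : ℝ} (ht : x k < t) :
    IntervalIntegrable (fun y : ℝ => Complex.exp (Complex.I * l * (t - y)) *
      hatMinusFun l i' f (addLast (Function.update x k y) (x k))) volume (x k) t ∧
    hatMinusFun l i f (addLast x t) = ∫ y in x k..t, Complex.exp (Complex.I * l * (t - y)) *
      hatMinusFun l i' f (addLast (Function.update x k y) (x k)) := by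
  have hne : ∀ m, i' m ≠ k := fun m h => hk ⟨m, h⟩
  have hcomp : ∀ y, Function.update x k y ∘ i' = x ∘ i' := fun y => by
    funext m
    simp [Function.update_of_ne (hne m)]
  have htail : Fin.tail (x ∘ i) = x ∘ i' := by
    funext m
    simp [Fin.tail, hs]
  have hv0 : (x ∘ i) 0 = x k := by simp [h0]
  have hcons : x ∘ i = (Fin.cons (x k) (x ∘ i') : Fin (n + 1) → ℝ) := by
    rw [← Fin.cons_self_tail (x ∘ i), htail, hv0]
  have hiff : StrictAnti (Fin.cons t (x ∘ i) : Fin (n + 1 + 1) → ℝ)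
      ↔ StrictAnti (Fin.cons (x k) (x ∘ i') : Fin (n + 1) → ℝ) := by
    have := strictAnti_vecCons (a := t) (f := x ∘ i)
    rw [hv0] at this
    rw [← hcons]
    exact this.trans (and_iff_right ht)
  obtain ⟨A, hA⟩ : ∃ A, (∀ j, |x j| ≤ A) ∧ |t| ≤ A := by
    refine ⟨max ‖x‖ |t|, fun j => (norm_le_pi_norm x j).trans (le_max_left _ _), le_max_right _ _⟩
  have hint : IntegrableOn (shiftIntegrand l i f x) (boxAbove t (x ∘ i)) := by
    refine (hf.integrableOn_shiftIntegrand l i x A hA.1).mono_set ?_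
    refine Set.pi_mono fun m _ y hy => ⟨?_, ?_⟩
    · exact (abs_le.mp (hA.1 (i m))).1.trans hy.1.le
    · exact hy.2.trans (cons_le _ _ _ (fun m => (abs_le.mp (hA.1 (i m))).2) (abs_le.mp hA.2).2 _)
  obtain ⟨h1, h2⟩ := setIntegral_boxAbove_succ t (x ∘ i) _ hint
  simp only [hv0, htail, shiftIntegrand_cons l h0 hs hk, integral_const_mul] at h1 h2
  have hG : ∀ y : ℝ, Complex.exp (Complex.I * l * (t - y)) *
      hatMinusFun l i' f (addLast (Function.update x k y) (x k))
      = Complex.exp (Complex.I * l * t) *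
        theta (StrictAnti (Fin.cons (x k) (x ∘ i') : Fin (n + 1) → ℝ)) *
        (Complex.exp (Complex.I * l * (x k - y)) * ∫ y' in boxAbove (x k) (x ∘ i'),
          shiftIntegrand l i' f (Function.update x k y) y') := fun y => by
    rw [hatMinusFun_addLast, hcomp]
    have : Complex.exp (Complex.I * l * (t - y)) * Complex.exp (Complex.I * l * (x k))
        = Complex.exp (Complex.I * l * t) * Complex.exp (Complex.I * l * (x k - y)) := by
      rw [← Complex.exp_add, ← Complex.exp_add]; congr 1; ring
    linear_combination (theta (StrictAnti (Fin.cons (x k) (x ∘ i') : Fin (n + 1) → ℝ)) *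
      ∫ y' in boxAbove (x k) (x ∘ i'), shiftIntegrand l i' f (Function.update x k y) y') * this
  simp_rw [hG]
  refine ⟨?_, ?_⟩
  · rw [intervalIntegrable_iff_integrableOn_Ioc_of_le ht.le]
    exact h1.const_mul _
  · rw [hatMinusFun_addLast, h2, intervalIntegral.integral_const_mul,
      intervalIntegral.integral_of_le ht.le]
    simp only [hiff]

theorem hatMinusFun_eq_zero {N n : ℕ} (l : ℂ) (f : (Fin N → ℝ) → ℂ)
    {i : Fin n ↪ Fin N} {k : Fin N} (hk : k ∈ Set.range i) {x : Fin N → ℝ} {t : ℝ}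
    (ht : t ≤ x k) : hatMinusFun l i f (addLast x t) = 0 := by
  obtain ⟨m, rfl⟩ := hk
  rw [hatMinusFun_addLast, theta, if_neg, mul_zero, zero_mul]
  intro h
  have := h (Fin.succ_pos m)
  simp only [Fin.cons_zero, Fin.cons_succ, Function.comp] at this
  exact ht.not_gt this

/-- The part of `b⁻` with `n` integrations. -/
def bMinusPart {N : ℕ} (l : ℂ) (n : ℕ) (f : (Fin N → ℝ) → ℂ) (y : Fin (N + 1) → ℝ) : ℂ :=
  ∑ i : Fin n ↪ Fin N, hatMinusFun l i f y

/-- The formula for `b⁻_l`. -/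
def bMinusFun {N : ℕ} (γ : ℝ) (l : ℂ) (f : (Fin N → ℝ) → ℂ) (y : Fin (N + 1) → ℝ) : ℂ :=
  ∑ n ∈ Finset.range (N + 1), (γ : ℂ) ^ n * bMinusPart l n f y

theorem bMinusPart_zero {N : ℕ} (l : ℂ) (f : (Fin N → ℝ) → ℂ) (x : Fin N → ℝ) (t : ℝ) :
    bMinusPart l 0 f (addLast x t) = Complex.exp (Complex.I * l * t) * f x := by
  have : Subsingleton (Fin (0 + 1)) := inferInstanceAs (Subsingleton (Fin 1))
  rw [bMinusPart, Fintype.sum_unique, hatMinusFun_addLast, theta, if_pos (Subsingleton.strictAnti _),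
    mul_one]
  congr 1
  have h1 : boxAbove t (x ∘ (default : Fin 0 ↪ Fin N)) = Set.univ := by
    ext y; simp [boxAbove]
  have h2 : ∀ Y, shiftIntegrand l (default : Fin 0 ↪ Fin N) f x Y = f x := fun Y => by
    have : replace (default : Fin 0 ↪ Fin N) Y x = x := by
      funext j
      rw [replace, Function.extend_apply']
      rintro ⟨m, _⟩
      exact m.elim0
    simp [shiftIntegrand, this]
  simp_rw [h1, h2]
  rw [setIntegral_univ, integral_const, volume_pi, Measure.pi_of_empty]
  simp

theorem hatMinusFun_integrable {N n : ℕ} (l : ℂ) {f : (Fin N → ℝ) → ℂ} (hf : IsLocallyBounded f)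
    (i' : Fin n ↪ Fin N) (k : Fin N) (x : Fin N → ℝ) {t : ℝ} (ht : x k < t) :
    IntervalIntegrable (fun y : ℝ => Complex.exp (Complex.I * l * (t - y)) *
      hatMinusFun l i' f (addLast (Function.update x k y) (x k))) volume (x k) t ∧
    (k ∈ Set.range i' → ∫ y in x k..t, Complex.exp (Complex.I * l * (t - y)) *
      hatMinusFun l i' f (addLast (Function.update x k y) (x k)) = 0) := by
  by_cases hk : k ∈ Set.range i'
  · have h0 : Set.EqOn (fun y : ℝ => Complex.exp (Complex.I * l * (t - y)) *
      hatMinusFun l i' f (addLast (Function.update x k y) (x k))) 0 (Set.uIcc (x k) t) := by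
      intro y hy
      rw [Set.uIcc_of_le ht.le] at hy
      dsimp only
      rw [hatMinusFun_eq_zero l f hk (by simpa using hy.1), mul_zero]
      rfl
    refine ⟨?_, fun _ => ?_⟩
    · exact (IntervalIntegrable.congr (f := fun _ => (0 : ℂ))
        (fun y hy => (h0 (Set.uIoc_subset_uIcc hy)).symm) intervalIntegrable_const)
    · rw [intervalIntegral.integral_congr h0]
      simp
  · exact ⟨(hatMinusFun_succ l hf (i := (Equiv.embeddingFinSucc n (Fin N)).symm ⟨i', k, hk⟩)
      (by simp) (by simp) hk x ht).1, fun h => absurd h hk⟩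

theorem bMinusPart_integrable {N : ℕ} (l : ℂ) (n : ℕ) {f : (Fin N → ℝ) → ℂ}
    (hf : IsLocallyBounded f) (k : Fin N) (x : Fin N → ℝ) {t : ℝ} (ht : x k < t) :
    IntervalIntegrable (fun y : ℝ => Complex.exp (Complex.I * l * (t - y)) *
      bMinusPart l n f (addLast (Function.update x k y) (x k))) volume (x k) t := by
  simp only [bMinusPart, Finset.mul_sum]
  have h := (IntervalIntegrable.sum Finset.univ fun (i : Fin n ↪ Fin N) _ =>
      (hatMinusFun_integrable l hf i k x ht).1)
  refine h.congr fun s _ => ?_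
  simp [Finset.sum_apply]

/-- An injective tuple of length `n + 1` is a first entry `k` and an injective `n`-tuple avoiding
`k`. The restriction on the `n`-tuple may be dropped: if it contains `k`, the step function vanishes
because the new coordinate `y ≥ x_k` is not below the new last coordinate `x_k`. -/
theorem bMinusPart_succ {N : ℕ} (l : ℂ) (n : ℕ) {f : (Fin N → ℝ) → ℂ} (hf : IsLocallyBounded f)
    (x : Fin N → ℝ) (t : ℝ) :
    bMinusPart l (n + 1) f (addLast x t) = ∑ k, if x k < t then
      ∫ y in x k..t, Complex.exp (Complex.I * l * (t - y)) *
        bMinusPart l n f (addLast (Function.update x k y) (x k)) else 0 := by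
  classical
  have h1 : ∀ k, (if x k < t then ∫ y in x k..t, Complex.exp (Complex.I * l * (t - y)) *
        bMinusPart l n f (addLast (Function.update x k y) (x k)) else 0)
      = ∑ i' : Fin n ↪ Fin N, if x k < t then ∫ y in x k..t, Complex.exp (Complex.I * l * (t - y)) *
        hatMinusFun l i' f (addLast (Function.update x k y) (x k)) else 0 := by
    intro k
    split_ifs with hk
    · simp only [bMinusPart, Finset.mul_sum]
      exact intervalIntegral.integral_finsetSum fun i _ => (hatMinusFun_integrable l hf i k x hk).1
    · simp
  simp_rw [h1]
  rw [Finset.sum_comm, bMinusPart,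
    Fintype.sum_equiv (Equiv.embeddingFinSucc n (Fin N)) _ (fun p : Σ e : Fin n ↪ Fin N,
      {k // k ∉ Set.range e} => if x p.2.1 < t then ∫ y in x p.2.1..t,
        Complex.exp (Complex.I * l * (t - y)) *
        hatMinusFun l p.1 f (addLast (Function.update x p.2.1 y) (x p.2.1)) else 0) ?_,
    Fintype.sum_sigma]
  · refine Finset.sum_congr rfl fun i' _ => ?_
    rw [← Finset.sum_subset (Finset.subset_univ (Finset.univ.filter fun k => k ∉ Set.range i'))]
    · exact (Finset.sum_subtype (Finset.univ.filter fun k => k ∉ Set.range i')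
        (p := fun k => k ∉ Set.range i') (fun k => by simp)
        (fun k => if x k < t then ∫ y in x k..t, Complex.exp (Complex.I * l * (t - y)) *
          hatMinusFun l i' f (addLast (Function.update x k y) (x k)) else 0)).symm
    · intro k _ hk
      simp only [Finset.mem_filter, Finset.mem_univ, true_and, not_not] at hk
      split_ifs with hkt
      · exact (hatMinusFun_integrable l hf i' k x hkt).2 hk
      · rfl
  · intro i
    split_ifs with hk
    · exact (hatMinusFun_succ l hf rfl (fun _ => rfl)
        (Equiv.embeddingFinSucc n (Fin N) i).2.2 x hk).2
    · rw [hatMinusFun_addLast, theta, if_neg, mul_zero, zero_mul]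
      intro h
      have := h (Fin.succ_pos 0)
      simp only [Fin.cons_zero, Fin.cons_succ, Function.comp] at this
      exact hk this

theorem bMinusPart_eq_zero {N : ℕ} (l : ℂ) (f : (Fin N → ℝ) → ℂ) (y : Fin (N + 1) → ℝ) :
    bMinusPart l (N + 1) f y = 0 := by
  have : IsEmpty (Fin (N + 1) ↪ Fin N) := ⟨fun e => by
    have := Fintype.card_le_of_embedding e
    simp at this⟩
  rw [bMinusPart, Finset.univ_eq_empty, Finset.sum_empty]

/-- Summed over `n`, the recursion in the number of integrations becomes the Volterra equation that
`preWaveFun_addLast_eq` gives for the pre-wavefunctions. -/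
theorem bMinusFun_addLast_eq {N : ℕ} (γ : ℝ) (l : ℂ) {f : (Fin N → ℝ) → ℂ}
    (hf : IsLocallyBounded f) (x : Fin N → ℝ) (t : ℝ) :
    bMinusFun γ l f (addLast x t) = Complex.exp (Complex.I * l * t) * f x
      + γ * ∑ k, if x k < t then ∫ y in x k..t, Complex.exp (Complex.I * l * (t - y)) *
          bMinusFun γ l f (addLast (Function.update x k y) (x k)) else 0 := by
  -- The term `n = N + 1` may be added, as there are no injective tuples of that length; after
  -- removal of `n = 0` the index shift is then exact.
  have h1 : bMinusFun γ l f (addLast x t)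
      = ∑ n ∈ Finset.range (N + 1 + 1), (γ : ℂ) ^ n * bMinusPart l n f (addLast x t) := by
    rw [Finset.sum_range_succ, bMinusPart_eq_zero, mul_zero, add_zero]; rfl
  rw [h1, Finset.sum_range_succ', pow_zero, one_mul, bMinusPart_zero, add_comm]
  congr 1
  have h2 : ∀ k, (if x k < t then ∫ y in x k..t, Complex.exp (Complex.I * l * (t - y)) *
          bMinusFun γ l f (addLast (Function.update x k y) (x k)) else 0)
      = ∑ n ∈ Finset.range (N + 1), (γ : ℂ) ^ n * if x k < t then ∫ y in x k..t,
          Complex.exp (Complex.I * l * (t - y)) *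
          bMinusPart l n f (addLast (Function.update x k y) (x k)) else 0 := by
    intro k
    split_ifs with hk
    · simp only [bMinusFun, Finset.mul_sum, mul_left_comm _ ((γ : ℂ) ^ _)]
      rw [intervalIntegral.integral_finsetSum fun n _ =>
        (bMinusPart_integrable l n hf k x hk).const_mul _]
      simp only [intervalIntegral.integral_const_mul]
    · simp
  simp_rw [h2, bMinusPart_succ l _ hf]
  rw [Finset.sum_comm, Finset.mul_sum]
  refine Finset.sum_congr rfl fun n _ => ?_
  rw [← Finset.mul_sum, pow_succ]
  ring

/-- The recursive construction of the pre-wavefunctions: `b⁻_μ ψ_λ = ψ_{(λ, μ)}`. -/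
theorem bMinusFun_preWaveFun {N : ℕ} (γ : ℝ) {κ : Fin (N + 1) → ℂ}
    (hκ : Function.Injective κ) {x : Fin N → ℝ} {t : ℝ}
    (hxt : Function.Injective (addLast x t)) :
    bMinusFun γ (κ (Fin.last N)) (preWaveFun γ (κ ∘ Fin.castSucc)) (addLast x t)
      = preWaveFun γ κ (addLast x t) := by
  classical
  -- The recursive call has last coordinate `x_k < t` and the coordinate `y > x_k` at place `k`, so
  -- strictly fewer coordinates lie below the last one.
  induction hm : (Finset.univ.filter fun k => x k < t).card using Nat.strong_induction_on
    generalizing x t with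
  | _ m ih =>
    rw [bMinusFun_addLast_eq γ _ (isLocallyBounded_preWaveFun γ _), preWaveFun_addLast_eq γ hκ hxt]
    congr 2
    refine Finset.sum_congr rfl fun k _ => ?_
    split_ifs with hk
    · obtain ⟨hx, ht⟩ := injective_addLast.mp hxt
      refine intervalIntegral.integral_congr_ae ?_
      -- The finitely many `y` equal to a coordinate of `x` are discarded, to stay off the walls.
      filter_upwards [(Set.countable_range x).ae_notMem volume] with y hy hyk
      rw [Set.uIoc_of_le hk.le] at hyk
      congr 1
      refine ih _ ?_ ?_ rfl
      · rw [← hm]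
        refine Finset.card_lt_card ?_
        rw [Finset.ssubset_iff_of_subset]
        · exact ⟨k, by simpa using hk, by simpa using hyk.1.le⟩
        · intro j hj
          simp only [Finset.mem_filter, Finset.mem_univ, true_and] at hj ⊢
          by_cases hjk : j = k
          · rw [hjk]; exact hk
          · rw [Function.update_of_ne hjk] at hj
            exact hj.trans hk
      · have hy' : Function.Injective (addLast x y) := injective_addLast.mpr ⟨hx, hy⟩
        rw [← addLast_comp_swap]
        exact hy'.comp (Equiv.injective _)
    · rfl

/-! ### Generic points and generic momenta -/

theorem ae_injective (L : ℝ) (N : ℕ) : ∀ᵐ x ∂(cubeMeasure L N), Function.Injective x := by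
  rw [cubeMeasure_eq]
  refine ae_restrict_of_ae ?_
  have h : ∀ i j : Fin N, i ≠ j → ∀ᵐ x : Fin N → ℝ, x i ≠ x j := fun i j hij => by
    have hne : LinearMap.ker (LinearMap.proj (R := ℝ) (φ := fun _ : Fin N => ℝ) i
        - LinearMap.proj j) ≠ ⊤ := fun h => by
      have := h ▸ Submodule.mem_top (x := (Pi.single i 1 : Fin N → ℝ))
      simp [Pi.single_eq_of_ne' hij] at this
    have := Measure.addHaar_submodule (volume : Measure (Fin N → ℝ)) _ hne
    refine compl_mem_ae_iff.mpr (measure_mono_null (fun x hx => ?_) this)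
    have hx' : x i = x j := hx
    simpa [sub_eq_zero] using hx'
  have h' : ∀ᵐ x : Fin N → ℝ, ∀ i j : Fin N, i ≠ j → x i ≠ x j := by
    simp only [ae_all_iff]
    exact h
  filter_upwards [h'] with x hx i j hij
  by_contra hne
  exact hx i j hne hij

theorem ae_ne (L : ℝ) (N : ℕ) (c : ℝ) : ∀ᵐ x ∂(cubeMeasure L N), ∀ j, x j ≠ c := by
  rw [ae_all_iff]
  intro j
  have h : ∀ᵐ t ∂((volume : Measure ℝ).restrict (Set.Icc (-(L / 2)) (L / 2))), t ≠ c :=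
    Measure.ae_ne _ c
  exact (Measure.tendsto_eval_ae_ae (μ := fun _ : Fin N =>
    (volume : Measure ℝ).restrict (Set.Icc (-(L / 2)) (L / 2))) (i := j)).eventually h

theorem ae_lt (L : ℝ) (N : ℕ) : ∀ᵐ x ∂(cubeMeasure L N), ∀ j, x j < L / 2 := by
  filter_upwards [ae_cube L N, ae_ne L N (L / 2)] with x h1 h2 j
  exact lt_of_le_of_ne (h1 j).2 (h2 j)

theorem ae_injective_addLast (L : ℝ) (N : ℕ) :
    ∀ᵐ x ∂(cubeMeasure L N), Function.Injective (addLast x (L / 2)) := by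
  filter_upwards [ae_injective L N, ae_ne L N (L / 2)] with x h1 h2
  exact injective_addLast.mpr ⟨h1, fun ⟨j, hj⟩ => h2 j hj⟩

/-- The complement is a finite union of proper real subspaces, hence a null set. Through this
density identities proved for distinct momenta extend to all momenta by continuity. -/
theorem dense_injective (N : ℕ) : Dense {κ : Fin N → ℂ | Function.Injective κ} := by
  have h : ∀ i j : Fin N, i ≠ j → ∀ᵐ x : Fin N → ℂ, x i ≠ x j := fun i j hij => by
    have hne : LinearMap.ker (LinearMap.proj (R := ℝ) (φ := fun _ : Fin N => ℂ) i
        - LinearMap.proj j) ≠ ⊤ := fun h => by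
      have := h ▸ Submodule.mem_top (x := (Pi.single i 1 : Fin N → ℂ))
      simp [Pi.single_eq_of_ne' hij] at this
    have := Measure.addHaar_submodule (volume : Measure (Fin N → ℂ)) _ hne
    refine compl_mem_ae_iff.mpr (measure_mono_null (fun x hx => ?_) this)
    have hx' : x i = x j := hx
    simpa [sub_eq_zero] using hx'
  have h' : ∀ᵐ x : Fin N → ℂ, ∀ i j : Fin N, i ≠ j → x i ≠ x j := by
    simp only [ae_all_iff]
    exact h
  refine (Measure.dense_of_ae h').mono fun x hx i j hij => ?_
  by_contra hne
  exact hx i j hne hij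

/-! ### Pointwise formulae for the operators -/

theorem coeFn_opOf {L : ℝ} {N M : ℕ} {K : ((Fin N → ℝ) → ℂ) → (Fin M → ℝ) → ℂ}
    (h : IsL2Bounded L K) (F : Sector L N) {f : (Fin N → ℝ) → ℂ} (hf : F =ᵐ[cubeMeasure L N] f) :
    opOf L K h F =ᵐ[cubeMeasure L M] K f :=
  (h.memLp F (Lp.memLp F)).coeFn_toLp.trans (h.congr _ _ hf)

theorem coeFn_sum_opOf {L : ℝ} {N M : ℕ} (γ : ℝ)
    (K : ∀ n, (Fin n ↪ Fin N) → ((Fin N → ℝ) → ℂ) → (Fin M → ℝ) → ℂ)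
    (h : ∀ n i, IsL2Bounded L (K n i)) (F : Sector L N) {f : (Fin N → ℝ) → ℂ}
    (hf : F =ᵐ[cubeMeasure L N] f) :
    (∑ n ∈ Finset.range (N + 1), (γ : ℂ) ^ n • ∑ i, opOf L (K n i) (h n i)) F
      =ᵐ[cubeMeasure L M]
      fun x => ∑ n ∈ Finset.range (N + 1), (γ : ℂ) ^ n * ∑ i, K n i f x := by
  simp only [sum_apply, smul_apply]
  have h1 : ∀ᵐ x ∂(cubeMeasure L M), ∀ n i, opOf L (K n i) (h n i) F x = K n i f x := by
    simp only [ae_all_iff]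
    exact fun n i => coeFn_opOf (h n i) F hf
  have h2 : ∀ᵐ x ∂(cubeMeasure L M), ∀ n,
      ((γ : ℂ) ^ n • ∑ i, opOf L (K n i) (h n i) F : Sector L M) x
        = (γ : ℂ) ^ n * (∑ i, opOf L (K n i) (h n i) F : Sector L M) x := by
    rw [ae_all_iff]
    exact fun n => Lp.coeFn_smul _ _
  have h3 : ∀ᵐ x ∂(cubeMeasure L M), ∀ n,
      (∑ i, opOf L (K n i) (h n i) F : Sector L M) x = ∑ i, opOf L (K n i) (h n i) F x := by
    rw [ae_all_iff]
    exact fun n => Lp.coeFn_fun_finsetSum _ _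
  filter_upwards [Lp.coeFn_fun_finsetSum (Finset.range (N + 1)) fun n =>
    (γ : ℂ) ^ n • ∑ i, opOf L (K n i) (h n i) F, h1, h2, h3] with x h h1 h2 h3
  simp only [h, h2, h3, h1]

theorem coeFn_opBMinus {L γ : ℝ} {N : ℕ} (l : ℂ) (F : Sector L N) {f : (Fin N → ℝ) → ℂ}
    (hf : F =ᵐ[cubeMeasure L N] f) :
    opBMinus L γ N l F =ᵐ[cubeMeasure L (N + 1)] bMinusFun γ l f :=
  coeFn_sum_opOf γ (fun _ i => hatMinusFun l i) (fun _ i => isL2Bounded_hatMinus L l i) F hf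

/-- With `L/2` as last coordinate the extra inequality in the step function holds automatically, so
`d` is the boundary value of `b⁻`. -/
theorem barMinusFun_eq {L : ℝ} {N n : ℕ} (l : ℂ) (i : Fin n ↪ Fin N) (f : (Fin N → ℝ) → ℂ)
    {x : Fin N → ℝ} (hx : ∀ j, x j < L / 2) :
    barMinusFun L l i f x = hatMinusFun l i f (addLast x (L / 2)) := by
  simp only [barMinusFun, hatMinusFun, addLast_last, addLast_comp_castSucc]
  have : StrictAnti (Fin.cons (L / 2) (x ∘ i) : Fin (n + 1) → ℝ) ↔ StrictAnti (x ∘ i) := by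
    refine ⟨fun h => ?_, fun h => ?_⟩
    · simpa [Function.comp_def] using h.comp_strictMono Fin.strictMono_succ
    · cases n with
      | zero =>
        have : Subsingleton (Fin (0 + 1)) := inferInstanceAs (Subsingleton (Fin 1))
        exact Subsingleton.strictAnti _
      | succ n => exact strictAnti_vecCons.mpr ⟨hx _, h⟩
  simp only [this]
  congr 3
  push_cast
  ring

theorem coeFn_opD {L γ : ℝ} {N : ℕ} (l : ℂ) (F : Sector L N) {f : (Fin N → ℝ) → ℂ}
    (hf : F =ᵐ[cubeMeasure L N] f) :
    opD L γ N l F =ᵐ[cubeMeasure L N] fun x => bMinusFun γ l f (addLast x (L / 2)) := by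
  refine (coeFn_sum_opOf γ (fun _ i => barMinusFun L l i) (fun _ i => isL2Bounded_barMinus L l i)
    F hf).trans ?_
  filter_upwards [ae_lt L N] with x hx
  simp only [bMinusFun, bMinusPart, barMinusFun_eq _ _ _ hx]

theorem coeFn_preWave (L γ : ℝ) {N : ℕ} (κ : Fin N → ℂ) :
    preWave L γ κ =ᵐ[cubeMeasure L N] preWaveFun γ κ :=
  (memLp_preWaveFun L γ κ).coeFn_toLp

theorem coeFn_swapOp {L : ℝ} {N : ℕ} (j k : Fin N) (F : Sector L N) {f : (Fin N → ℝ) → ℂ}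
    (hf : F =ᵐ[cubeMeasure L N] f) :
    swapOp L j k F =ᵐ[cubeMeasure L N] fun x => f (x ∘ Equiv.swap j k) :=
  (Lp.coeFn_compMeasurePreserving F (measurePreserving_perm L N (Equiv.swap j k))).trans
    ((measurePreserving_perm L N (Equiv.swap j k)).quasiMeasurePreserving.ae_eq hf)

theorem opBMinus_preWave_of_injective (L γ : ℝ) {N : ℕ} {κ : Fin (N + 1) → ℂ}
    (hκ : Function.Injective κ) :
    opBMinus L γ N (κ (Fin.last N)) (preWave L γ (κ ∘ Fin.castSucc)) = preWave L γ κ := by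
  refine Lp.ext (((coeFn_opBMinus _ _ (coeFn_preWave L γ _)).trans ?_).trans
    (coeFn_preWave L γ κ).symm)
  filter_upwards [ae_injective L (N + 1)] with y hy
  rw [← addLast_eta y] at hy ⊢
  exact bMinusFun_preWaveFun γ hκ hy

/-- The face on which the last coordinate is `L/2` is null in `J^{N+1}`, so this uses the recursion
for `b⁻` as an identity at every injective point, not merely almost everywhere. -/
theorem coeFn_opD_preWave (L γ : ℝ) {N : ℕ} {κ : Fin (N + 1) → ℂ} (hκ : Function.Injective κ) :
    opD L γ N (κ (Fin.last N)) (preWave L γ (κ ∘ Fin.castSucc))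
      =ᵐ[cubeMeasure L N] fun x => preWaveFun γ κ (addLast x (L / 2)) := by
  refine (coeFn_opD _ _ (coeFn_preWave L γ _)).trans ?_
  filter_upwards [ae_injective_addLast L N] with x hx
  exact bMinusFun_preWaveFun γ hκ hx

/-! ### Continuity in the momenta -/

theorem continuous_uncurry_wordOp {X : Type*} [TopologicalSpace X] {N : ℕ} (γ : ℝ)
    (w : SimpleWord N) (F : X → (Fin N → ℝ) → ℂ) (hF : Continuous (Function.uncurry F)) :
    Continuous (Function.uncurry fun p => wordOp γ w (F p)) := by
  induction w with
  | nil => exact hF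
  | cons s w ih =>
    have h1 : Continuous fun q : X × (Fin N → ℝ) => q.2 ∘ Equiv.swap s.1.1 s.1.2 :=
      continuous_pi fun _ => (continuous_apply _).comp continuous_snd
    have h2 : Continuous fun q : X × (Fin N → ℝ) =>
        intOp s.1.1 s.1.2 (wordOp γ w (F q.1)) q.2 := by
      unfold intOp
      refine intervalIntegral.continuous_parametric_intervalIntegral_of_continuous ?_
        (by fun_prop)
      exact ih.comp (f := fun r : (X × (Fin N → ℝ)) × ℝ =>
        (r.1.1, r.1.2 - r.2 • (Pi.single s.1.1 1 - Pi.single s.1.2 1))) (by fun_prop)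
    exact (ih.comp (continuous_fst.prodMk h1)).add (continuous_const.mul h2)

/-- The chambers and the words chosen for them do not depend on `κ`, and each `w_γ e^{iκ}` is
jointly continuous in `κ` and `x`. Convergence is therefore uniform on the compact cube, hence holds
in `L²`. -/
theorem continuous_preWave (L γ : ℝ) (N : ℕ) :
    Continuous fun κ : Fin N → ℂ => preWave L γ κ := by
  rw [Metric.continuous_iff']
  intro κ₀ ε hε
  set m := (cubeMeasure L N).real Set.univ ^ (ENNReal.toReal 2)⁻¹ with hm
  have hm0 : 0 ≤ m := Real.rpow_nonneg measureReal_nonneg _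
  obtain ⟨δ, hδ, hδε⟩ : ∃ δ > 0, m * (Fintype.card (Equiv.Perm (Fin N)) * δ) < ε := by
    have : Filter.Tendsto (fun δ : ℝ => m * (Fintype.card (Equiv.Perm (Fin N)) * δ))
        (nhdsWithin 0 (Set.Ioi 0)) (nhds 0) := by
      have hc : Continuous fun δ : ℝ => m * (Fintype.card (Equiv.Perm (Fin N)) * δ) := by fun_prop
      simpa using (hc.tendsto 0).mono_left nhdsWithin_le_nhds
    obtain ⟨δ, h1, h2⟩ := ((this.eventually (gt_mem_nhds hε)).and self_mem_nhdsWithin).exists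
    exact ⟨δ, h2, h1⟩
  have hG : ∀ σ : Equiv.Perm (Fin N), Continuous (Function.uncurry fun κ : Fin N → ℂ =>
      fun x => deformedPerm γ σ (planeWave κ) (x ∘ (σ⁻¹ : Equiv.Perm (Fin N)))) := fun σ => by
    have h1 : Continuous (Function.uncurry fun κ : Fin N → ℂ => planeWave κ) := by
      unfold planeWave Function.uncurry; fun_prop
    refine (continuous_uncurry_wordOp γ (exists_word σ).choose _ h1).comp
      (f := fun q : (Fin N → ℂ) × (Fin N → ℝ) => (q.1, q.2 ∘ (σ⁻¹ : Equiv.Perm (Fin N)))) ?_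
    exact continuous_fst.prodMk (continuous_pi fun _ => (continuous_apply _).comp continuous_snd)
  have hunif : ∀ σ : Equiv.Perm (Fin N), ∀ᶠ κ in nhds κ₀,
      ∀ x ∈ Set.pi Set.univ fun _ : Fin N => Set.Icc (-(L / 2)) (L / 2),
        dist (deformedPerm γ σ (planeWave κ) (x ∘ (σ⁻¹ : Equiv.Perm (Fin N))))
          (deformedPerm γ σ (planeWave κ₀) (x ∘ (σ⁻¹ : Equiv.Perm (Fin N)))) < δ := fun σ => by
    obtain ⟨v, hv, h⟩ := (isCompact_univ_pi fun _ : Fin N =>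
      isCompact_Icc (a := -(L / 2)) (b := L / 2)).mem_uniformity_of_prod
        (hG σ).continuousOn (Set.mem_univ κ₀) (Metric.dist_mem_uniformity hδ)
    rw [nhdsWithin_univ] at hv
    exact Filter.eventually_of_mem hv h
  filter_upwards [Filter.eventually_all.mpr hunif] with κ hκ
  rw [dist_eq_norm]
  refine lt_of_le_of_lt (Lp.norm_le_of_ae_bound
    (C := Fintype.card (Equiv.Perm (Fin N)) * δ) (by positivity) ?_) hδε
  filter_upwards [Lp.coeFn_sub (preWave L γ κ) (preWave L γ κ₀), coeFn_preWave L γ κ,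
    coeFn_preWave L γ κ₀, ae_cube L N] with x h h1 h2 hx
  rw [h, Pi.sub_apply, h1, h2]
  simp only [preWaveFun, propagation]
  rw [← Finset.sum_sub_distrib]
  refine (norm_sum_le _ _).trans ?_
  rw [← nsmul_eq_mul, ← Finset.card_univ]
  refine Finset.sum_le_card_nsmul _ _ _ fun σ _ => ?_
  rw [← mul_sub, norm_mul, ← dist_eq_norm]
  refine le_trans (mul_le_of_le_one_left dist_nonneg ?_) (hκ σ x fun j _ => hx j).le
  unfold theta
  split_ifs <;> simp

/-! ### Holomorphic dependence on the momentum -/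

/-- The nearest point of the cube `J^N`. -/
def clip (L : ℝ) {N : ℕ} (x : Fin N → ℝ) : Fin N → ℝ :=
  fun j => max (-(L / 2)) (min (x j) (L / 2))

theorem clip_mem {L : ℝ} (hL : 0 < L) {N : ℕ} (x : Fin N → ℝ) (j : Fin N) :
    clip L x j ∈ Set.Icc (-(L / 2)) (L / 2) :=
  ⟨le_max_left _ _, max_le (by linarith) (min_le_right _ _)⟩

theorem clip_of_mem {L : ℝ} {N : ℕ} {x : Fin N → ℝ}
    (hx : ∀ j, x j ∈ Set.Icc (-(L / 2)) (L / 2)) : clip L x = x := by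
  funext j
  rw [clip, min_eq_left (hx j).2, max_eq_right (hx j).1]

/-- Multiplication by `e^{lu}` is the exponential of `l g` in the Banach algebra of bounded
continuous functions, followed by a continuous linear map into the operators; so it is entire in
operator norm. -/
theorem exists_differentiable_mulOp {L : ℝ} (hL : 0 < L) {N : ℕ} {u : (Fin N → ℝ) → ℂ}
    (hu : Continuous u) : ∃ T : ℂ → Sector L N →L[ℂ] Sector L N, Differentiable ℂ T ∧
      ∀ l F, T l F =ᵐ[cubeMeasure L N] fun x => Complex.exp (l * u x) * F x := by
  have hclip : Continuous fun x : Fin N → ℝ => clip L x := by unfold clip; fun_prop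
  obtain ⟨C, hC⟩ := (isCompact_univ_pi fun _ : Fin N =>
    isCompact_Icc (a := -(L / 2)) (b := L / 2)).exists_bound_of_continuousOn hu.continuousOn
  -- Composing with `clip` makes `u` bounded on all of `ℝ^N` without changing it on the cube.
  let g : BoundedContinuousFunction (Fin N → ℝ) ℂ :=
    BoundedContinuousFunction.ofNormedAddCommGroup (fun x => u (clip L x)) (hu.comp hclip) C
      fun x => hC _ fun j _ => clip_mem hL x j
  let Φ : BoundedContinuousFunction (Fin N → ℝ) ℂ →L[ℂ] Sector L N →L[ℂ] Sector L N :=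
    ((ContinuousLinearMap.mul ℂ ℂ).holderL (cubeMeasure L N) ∞ 2 2).comp
      (BoundedContinuousFunction.toLp ∞ (cubeMeasure L N) ℂ)
  refine ⟨fun l => Φ (NormedSpace.exp (l • g)), ?_, fun l F => ?_⟩
  · intro l
    exact Φ.differentiableAt.comp l (hasDerivAt_exp_smul_const g l).differentiableAt
  · have h1 := (ContinuousLinearMap.mul ℂ ℂ).coeFn_holder (r := 2)
      (BoundedContinuousFunction.toLp ∞ (cubeMeasure L N) ℂ (NormedSpace.exp (l • g))) F
    refine h1.trans ?_
    filter_upwards [BoundedContinuousFunction.coeFn_toLp ∞ (cubeMeasure L N) ℂ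
      (NormedSpace.exp (l • g)), ae_cube L N] with x h2 hx
    rw [h2, ContinuousLinearMap.mul_apply']
    congr 1
    let ev : BoundedContinuousFunction (Fin N → ℝ) ℂ →+* ℂ :=
      { toFun := fun h => h x, map_one' := rfl, map_mul' := fun _ _ => rfl, map_zero' := rfl,
        map_add' := fun _ _ => rfl }
    have h3 : ev (NormedSpace.exp (l • g)) = NormedSpace.exp (ev (l • g)) :=
      NormedSpace.map_exp ev ((BoundedContinuousFunction.lipschitz_eval_const x).continuous) _
    have h4 : ev (l • g) = l * u x := by
      change l * u (clip L x) = _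
      rw [clip_of_mem hx]
    rw [h4, ← Complex.exp_eq_exp_ℂ] at h3
    exact h3

/-- All dependence on `l` sits in two multiplication operators around the operator at `l = 0`. -/
theorem differentiable_opOf {L : ℝ} (hL : 0 < L) {N M : ℕ}
    {K : ℂ → ((Fin N → ℝ) → ℂ) → (Fin M → ℝ) → ℂ} (h : ∀ l, IsL2Bounded L (K l))
    {u : (Fin N → ℝ) → ℂ} (hu : Continuous u) {v : (Fin M → ℝ) → ℂ} (hv : Continuous v)
    (hK : ∀ l f, ∀ x : Fin M → ℝ, (∀ j, x j ∈ Set.Icc (-(L / 2)) (L / 2)) →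
      K l f x = Complex.exp (l * v x) * K 0 (fun z => Complex.exp (l * u z) * f z) x) :
    Differentiable ℂ fun l => opOf L (K l) (h l) := by
  obtain ⟨S, hS, hS'⟩ := exists_differentiable_mulOp hL hu
  obtain ⟨T, hT, hT'⟩ := exists_differentiable_mulOp hL hv
  have : (fun l => opOf L (K l) (h l)) = fun l => T l ∘L opOf L (K 0) (h 0) ∘L S l := by
    funext l
    ext1 F
    refine Lp.ext ((coeFn_opOf (h l) F Filter.EventuallyEq.rfl).trans ?_)
    simp only [ContinuousLinearMap.comp_apply]
    filter_upwards [hT' l (opOf L (K 0) (h 0) (S l F)), coeFn_opOf (h 0) (S l F) (hS' l F),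
      ae_cube L M] with x h1 h2 hx
    rw [h1, h2, hK l F x hx]
  rw [this]
  exact hT.clm_comp ((differentiable_const _).clm_comp hS)

/-- The kernel factors as `e^{ilx} e^{-ily}`, and the `y_m` are the coordinates `i_m` of the point
at which `f` is evaluated; so the second factor can be absorbed into `f`. -/
theorem shiftIntegral_eq {N n : ℕ} (l : ℂ) (i : Fin n ↪ Fin N) (B : Set (Fin n → ℝ))
    (f : (Fin N → ℝ) → ℂ) (x : Fin N → ℝ) :
    shiftIntegral l i B f x = Complex.exp (l * (Complex.I * ∑ m, (x (i m) : ℂ))) *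
      shiftIntegral 0 i B
        (fun z => Complex.exp (l * -(Complex.I * ∑ m, (z (i m) : ℂ))) * f z) x := by
  rw [shiftIntegral, shiftIntegral, ← integral_const_mul]
  congr 1
  funext y
  have : ∀ m, replace i y x (i m) = y m := fun m => i.injective.extend_apply _ _ _
  simp only [this, mul_zero, zero_mul, Complex.exp_zero, Finset.prod_const_one, one_mul]
  rw [← mul_assoc, ← Complex.exp_sum, ← Complex.exp_add]
  congr 2
  rw [← Finset.mul_sum, Finset.sum_sub_distrib]
  ring

theorem differentiable_hatMinus {L : ℝ} (hL : 0 < L) {N n : ℕ} (i : Fin n ↪ Fin N) :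
    Differentiable ℂ fun l => hatMinus L l i := by
  refine differentiable_opOf hL (K := fun l => hatMinusFun l i)
    (fun l => isL2Bounded_hatMinus L l i)
    (u := fun z => -(Complex.I * ∑ m, (z (i m) : ℂ))) (by fun_prop)
    (v := fun x => Complex.I * x (Fin.last N) + Complex.I * ∑ m, (x (i m).castSucc : ℂ))
    (by fun_prop) fun l f x _ => ?_
  simp only [hatMinusFun]
  rw [shiftIntegral_eq, mul_add, Complex.exp_add]
  simp only [mul_zero, zero_mul, Complex.exp_zero, Function.comp]
  rw [show Complex.I * l * x (Fin.last N) = l * (Complex.I * x (Fin.last N)) by ring]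
  ring

theorem differentiable_barMinus {L : ℝ} (hL : 0 < L) {N n : ℕ} (i : Fin n ↪ Fin N) :
    Differentiable ℂ fun l => barMinus L l i := by
  refine differentiable_opOf hL (K := fun l => barMinusFun L l i)
    (fun l => isL2Bounded_barMinus L l i)
    (u := fun z => -(Complex.I * ∑ m, (z (i m) : ℂ))) (by fun_prop)
    (v := fun x => Complex.I * L / 2 + Complex.I * ∑ m, (x (i m) : ℂ))
    (by fun_prop) fun l f x _ => ?_
  simp only [barMinusFun]
  rw [shiftIntegral_eq, mul_add, Complex.exp_add]
  simp only [mul_zero, zero_mul, zero_div, Complex.exp_zero]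
  rw [show Complex.I * l * L / 2 = l * (Complex.I * L / 2) by ring]
  ring

theorem differentiable_opBMinus {L : ℝ} (hL : 0 < L) (γ : ℝ) (N : ℕ) :
    Differentiable ℂ (opBMinus L γ N) := by
  unfold opBMinus
  exact Differentiable.fun_sum fun n _ => Differentiable.fun_const_smul
    (Differentiable.fun_sum fun i _ => differentiable_hatMinus hL i) _

theorem differentiable_opD {L : ℝ} (hL : 0 < L) (γ : ℝ) (N : ℕ) :
    Differentiable ℂ (opD L γ N) := by
  unfold opD
  exact Differentiable.fun_sum fun n _ => Differentiable.fun_const_smul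
    (Differentiable.fun_sum fun i _ => differentiable_barMinus hL i) _

/-! ### The action of `b⁻` on the pre-wavefunctions -/

theorem preWave_mem_zSpace (L γ : ℝ) {N : ℕ} (κ : Fin N → ℂ) : preWave L γ κ ∈ zSpace L γ N :=
  Submodule.le_topologicalClosure _ (Submodule.subset_span ⟨κ, rfl⟩)

theorem isClosed_zSpace (L γ : ℝ) (N : ℕ) : IsClosed (zSpace L γ N : Set (Sector L N)) :=
  Submodule.isClosed_topologicalClosure _

theorem zSpace_le {L γ : ℝ} {N : ℕ} {p : Submodule ℂ (Sector L N)}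
    (hp : IsClosed (p : Set (Sector L N))) (h : ∀ κ, preWave L γ κ ∈ p) : zSpace L γ N ≤ p :=
  Submodule.topologicalClosure_minimal _ (Submodule.span_le.mpr (by rintro _ ⟨κ, rfl⟩; exact h κ)) hp

theorem map_mem_zSpace {L γ : ℝ} {N M : ℕ} {T : Sector L N →L[ℂ] Sector L M}
    (h : ∀ κ : Fin N → ℂ, T (preWave L γ κ) ∈ zSpace L γ M) {f : Sector L N}
    (hf : f ∈ zSpace L γ N) : T f ∈ zSpace L γ M :=
  zSpace_le (p := (zSpace L γ M).comap T.toLinearMap)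
    ((isClosed_zSpace L γ M).preimage T.continuous) h hf

theorem mem_of_injective {X : Type*} [TopologicalSpace X] {N : ℕ} {s : Set X} (hs : IsClosed s)
    {F : (Fin N → ℂ) → X} (hF : Continuous F) (h : ∀ κ, Function.Injective κ → F κ ∈ s)
    (κ : Fin N → ℂ) : F κ ∈ s :=
  (hs.preimage hF).closure_subset_iff.mpr h ((dense_injective N).closure_eq ▸ Set.mem_univ κ)

theorem continuous_comp_index {N M : ℕ} (e : Fin N → Fin M) :
    Continuous fun κ : Fin M → ℂ => κ ∘ e :=
  continuous_pi fun _ => continuous_apply _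

theorem opBMinus_preWave {L : ℝ} (hL : 0 < L) (γ : ℝ) {N : ℕ} (κ : Fin N → ℂ) (μ : ℂ) :
    opBMinus L γ N μ (preWave L γ κ) = preWave L γ (addLast κ μ) := by
  have h : (fun κ : Fin (N + 1) → ℂ =>
      opBMinus L γ N (κ (Fin.last N)) (preWave L γ (κ ∘ Fin.castSucc))) = preWave L γ := by
    refine Continuous.ext_on (dense_injective (N + 1)) ?_ (continuous_preWave L γ _)
      fun κ hκ => opBMinus_preWave_of_injective L γ hκ
    exact ((differentiable_opBMinus hL γ N).continuous.comp (continuous_apply _)).clm_apply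
      ((continuous_preWave L γ N).comp (continuous_comp_index _))
  simpa using congrFun h (addLast κ μ)

/-! ### Permuting the first particles -/

/-- The coefficients in `preWaveFun_comp_swap` depend only on the two momenta exchanged. The same
`c` therefore serves with and without an extra particle in the last place. -/
theorem exists_preWaveFun_comp_perm {N : ℕ} (γ : ℝ) {κ : Fin N → ℂ} {ν : ℂ}
    (hκ : Function.Injective (addLast κ ν)) (π : Equiv.Perm (Fin N)) :
    ∃ c : Equiv.Perm (Fin N) → ℂ,
      (∀ y, preWaveFun γ κ (y ∘ π) = ∑ v, c v * preWaveFun γ (κ ∘ v) y) ∧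
      ∀ y t, preWaveFun γ (addLast κ ν) (addLast (y ∘ π) t)
        = ∑ v : Equiv.Perm (Fin N), c v * preWaveFun γ (addLast (κ ∘ v) ν) (addLast y t) := by
  classical
  obtain ⟨w, rfl⟩ := exists_word π
  induction w with
  | nil =>
    refine ⟨fun v => if v = 1 then 1 else 0, fun y => ?_, fun y t => ?_⟩ <;>
      simp [wordPerm]
  | cons s w ih =>
    obtain ⟨c, h1, h2⟩ := ih
    obtain ⟨hi, hν⟩ := injective_addLast.mp hκ
    set τ := Equiv.swap s.1.1 s.1.2 with hτ
    let a : Equiv.Perm (Fin N) → ℂ := fun v =>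
      Complex.I * γ / ((κ ∘ v) s.1.1 - (κ ∘ v) s.1.2)
    have hττ : τ * τ = 1 := Equiv.swap_mul_self _ _
    have hperm : wordPerm (s :: w) = τ * wordPerm w := rfl
    have key : ∀ g : Equiv.Perm (Fin N) → ℂ,
        ∑ v, (c (v * τ) * (1 + a (v * τ)) - c v * a v) * g v
          = ∑ v, c v * ((1 + a v) * g (v * τ) - a v * g v) := by
      intro g
      have : ∑ v, c (v * τ) * (1 + a (v * τ)) * g v = ∑ v, c v * (1 + a v) * g (v * τ) := by
        refine Fintype.sum_equiv (Equiv.mulRight τ) _ _ fun v => ?_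
        simp [mul_assoc, hττ]
      simp only [sub_mul, mul_sub, Finset.sum_sub_distrib, this]
      simp only [mul_assoc]
    refine ⟨fun v => c (v * τ) * (1 + a (v * τ)) - c v * a v, fun y => ?_, fun y t => ?_⟩
    · rw [hperm, Equiv.Perm.coe_mul, ← Function.comp_assoc, h1]
      rw [key fun v => preWaveFun γ (κ ∘ v) y]
      refine Finset.sum_congr rfl fun v _ => ?_
      rw [preWaveFun_comp_swap γ (hi.comp v.injective) s]
      rfl
    · rw [hperm, Equiv.Perm.coe_mul, ← Function.comp_assoc, h2]
      rw [key fun v => preWaveFun γ (addLast (κ ∘ v) ν) (addLast y t)]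
      refine Finset.sum_congr rfl fun v _ => ?_
      have hcs : ∀ {α : Type} (z : Fin N → α) (r : α), addLast (z ∘ τ) r
          = addLast z r ∘ Equiv.swap s.1.1.castSucc s.1.2.castSucc := by
        intro α z r
        funext j
        refine Fin.lastCases ?_ (fun j => ?_) j
        · rw [Function.comp_apply, Equiv.swap_apply_of_ne_of_ne] <;>
            simp [(Fin.castSucc_ne_last _).symm]
        · have := (Fin.castSucc_injective N).map_swap s.1.1 s.1.2 j
          rw [Function.comp_apply, ← this]
          simp [hτ]
      have hi' : Function.Injective (addLast (κ ∘ v) ν) :=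
        injective_addLast.mpr ⟨hi.comp v.injective, fun ⟨j, hj⟩ => hν ⟨v j, hj⟩⟩
      have h := preWaveFun_comp_swap γ hi' ⟨(s.1.1.castSucc, s.1.2.castSucc), by simpa using s.2⟩
        (addLast y t)
      rw [hcs, h, ← hcs]
      simp only [addLast_castSucc]
      rfl

/-! ### Inserting a particle at the right end `L/2` -/

theorem preWaveFun_cons {N : ℕ} (γ : ℝ) {κ : Fin (N + 1) → ℂ} (hκ : Function.Injective κ)
    {x : Fin N → ℝ} (hx : Function.Injective x) {T : ℝ} (hT : ∀ j, x j < T) :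
    preWaveFun γ κ (Fin.cons T x : Fin (N + 1) → ℝ)
      = Complex.exp (Complex.I * κ 0 * T) * preWaveFun γ (κ ∘ Fin.succ) x := by
  have hinj : Function.Injective (Fin.cons T x : Fin (N + 1) → ℝ) :=
    Fin.cons_injective_iff.mpr ⟨fun ⟨j, hj⟩ => (hT j).ne hj, hx⟩
  rw [preWaveFun_of_lt_zero γ hκ hinj (by simpa using hT), mul_comm]
  congr 1

theorem addLast_cons {α : Type*} {N : ℕ} (T : α) (x : Fin N → α) (t : α) :
    addLast (Fin.cons T x : Fin (N + 1) → α) t = (Fin.cons T (addLast x t) : Fin (N + 2) → α) :=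
  (Fin.cons_snoc_eq_snoc_cons (β := α) T x t).symm

theorem cons_comp_finRotate {α : Type*} {N : ℕ} (T : α) (x : Fin N → α) :
    (Fin.cons T x : Fin (N + 1) → α) ∘ finRotate (N + 1) = addLast x T :=
  (Fin.snoc_eq_cons_rotate x T).symm

theorem coeFn_sum_smul_preWave (L γ : ℝ) {N : ℕ} {ι : Type*} [Fintype ι] (c : ι → ℂ)
    (ρ : ι → Fin N → ℂ) : ⇑(∑ v, c v • preWave L γ (ρ v)) =ᵐ[cubeMeasure L N]
      fun x => ∑ v, c v * preWaveFun γ (ρ v) x := by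
  have h : ∀ᵐ x ∂(cubeMeasure L N), ∀ v,
      (c v • preWave L γ (ρ v)) x = c v * preWaveFun γ (ρ v) x := by
    rw [ae_all_iff]
    intro v
    filter_upwards [Lp.coeFn_smul (c v) (preWave L γ (ρ v)), coeFn_preWave L γ (ρ v)] with x h h'
    rw [h, Pi.smul_apply, h', smul_eq_mul]
  filter_upwards [h, Lp.coeFn_fun_finsetSum Finset.univ fun v => c v • preWave L γ (ρ v)]
    with x h1 h2
  simp only [h2, h1]

/-- On the pre-wavefunctions `d_μ` followed by appending a particle of momentum `ν` inserts the
position `L/2` before the last one. -/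
theorem exists_opD_preWave (L γ : ℝ) {N : ℕ} {κ : Fin (N + 1) → ℂ} {ν : ℂ}
    (hκ : Function.Injective (addLast κ ν)) :
    ∃ (c : Equiv.Perm (Fin (N + 1)) → ℂ) (ρ : Equiv.Perm (Fin (N + 1)) → Fin N → ℂ),
      opD L γ N (κ (Fin.last N)) (preWave L γ (κ ∘ Fin.castSucc))
        = ∑ v, c v • preWave L γ (ρ v) ∧
      (∑ v, c v • preWave L γ (addLast (ρ v) ν) : Sector L (N + 1))
        =ᵐ[cubeMeasure L (N + 1)] fun z => preWaveFun γ (addLast κ ν)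
          (addLast (addLast (z ∘ Fin.castSucc) (L / 2)) (z (Fin.last N))) := by
  obtain ⟨hi, hν⟩ := injective_addLast.mp hκ
  -- The rotation brings the coordinate `L/2` from the last place to the first. There it exceeds
  -- almost surely all others and splits off as an exponential, which is absorbed into the
  -- coefficients.
  obtain ⟨c, h1, h2⟩ := exists_preWaveFun_comp_perm γ hκ (finRotate (N + 1))
  refine ⟨fun v => c v * Complex.exp (Complex.I * (κ ∘ v) 0 * (L / 2 : ℝ)),
    fun v => (κ ∘ v) ∘ Fin.succ, ?_, ?_⟩
  · refine Lp.ext ((coeFn_opD_preWave L γ hi).trans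
      (Filter.EventuallyEq.trans ?_ (coeFn_sum_smul_preWave L γ _ _).symm))
    filter_upwards [ae_injective L N, ae_lt L N] with x hx hx'
    rw [← cons_comp_finRotate, h1]
    refine Finset.sum_congr rfl fun v _ => ?_
    rw [preWaveFun_cons γ (hi.comp v.injective) hx hx', ← mul_assoc]
  · refine (coeFn_sum_smul_preWave L γ _ _).trans ?_
    filter_upwards [ae_injective L (N + 1), ae_lt L (N + 1)] with x hx hx'
    rw [← cons_comp_finRotate (L / 2) (x ∘ Fin.castSucc), h2]
    refine Finset.sum_congr rfl fun v _ => ?_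
    have hi' : Function.Injective (addLast (κ ∘ v) ν) :=
      injective_addLast.mpr ⟨hi.comp v.injective, fun ⟨j, hj⟩ => hν ⟨v j, hj⟩⟩
    have hz : addLast (κ ∘ v) ν ∘ Fin.succ = addLast ((κ ∘ v) ∘ Fin.succ) ν := by
      rw [← Fin.cons_self_tail (κ ∘ v), addLast_cons]
      rfl
    have hz0 : addLast (κ ∘ v) ν 0 = (κ ∘ v) 0 := addLast_castSucc _ _ 0
    rw [addLast_cons, addLast_eta, preWaveFun_cons γ hi' hx hx', hz, hz0, ← mul_assoc]

/-! ### Relations under the deformed transposition in momentum space -/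

section SwapRelated

variable {E E' : Type*} [NormedAddCommGroup E] [NormedSpace ℂ E] [NormedAddCommGroup E']
  [NormedSpace ℂ E']

/-- The identity `G = s̃_γ F` on the vector `f`, multiplied by `μ - ν`. -/
def SwapRelated (γ : ℝ) (F G : ℂ → ℂ → E →L[ℂ] E') (f : E) : Prop :=
  ∀ μ ν, (μ - ν) • G μ ν f = (μ - ν) • F ν μ f - (Complex.I * γ) • (F μ ν f - F ν μ f)

/-- The deformed transposition is an involution. On the diagonal both sides vanish because of the
factor `μ - ν`. -/
theorem SwapRelated.symm {γ : ℝ} {F G : ℂ → ℂ → E →L[ℂ] E'} {f : E} (h : SwapRelated γ F G f) :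
    SwapRelated γ G F f := by
  intro μ ν
  by_cases hd : μ - ν = 0
  · have : μ = ν := sub_eq_zero.mp hd
    subst this
    simp
  · refine smul_right_injective E' hd ?_
    have h1 := h μ ν
    have h2 := h ν μ
    have h3 : (ν - μ) • G ν μ f = -((μ - ν) • G ν μ f) := by rw [← neg_smul, neg_sub]
    rw [h3, neg_eq_iff_eq_neg] at h2
    simp only [smul_sub, smul_comm (μ - ν) (Complex.I * γ : ℂ) (G _ _ f)]
    rw [h1, h2]
    have hI : Complex.I * Complex.I = -1 := Complex.I_mul_I
    module

/-- Off the diagonal one divides by `μ - ν`. On the diagonal the identity is the limit along `(μ +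
ε, μ - ε)`; differentiability of `F` is what guarantees that the limit in `dividedDifference`
exists, so that `limUnder` is not a default value. -/
theorem SwapRelated.eq_momentumSwap {γ : ℝ} {F G : ℂ → ℂ → E →L[ℂ] E'} {f : E}
    (h : SwapRelated γ F G f) (hF : Differentiable ℂ fun p : ℂ × ℂ => F p.1 p.2)
    (hG : Continuous fun p : ℂ × ℂ => G p.1 p.2) (μ ν : ℂ) :
    G μ ν f = momentumSwap γ F μ ν f := by
  have hne : ∀ μ ν, μ ≠ ν → G μ ν f = F ν μ f
      - (Complex.I * γ) • ((μ - ν)⁻¹ • (F μ ν - F ν μ)) f := by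
    intro μ ν hμν
    have hd := sub_ne_zero.mpr hμν
    refine smul_right_injective E' hd ?_
    dsimp only
    rw [h μ ν, smul_sub (μ - ν), smul_apply, sub_apply,
      smul_comm (μ - ν) (Complex.I * γ : ℂ), smul_inv_smul₀ hd]
  by_cases hμν : μ = ν
  · subst hμν
    -- `H` vanishes at `0`, so dividing by the momentum difference `2ε` gives half its derivative in
    -- the limit.
    let H : ℂ → E →L[ℂ] E' := fun ε => F (μ + ε) (μ - ε) - F (μ - ε) (μ + ε)
    have hH : DifferentiableAt ℂ H 0 := by
      refine Differentiable.differentiableAt ?_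
      exact (hF.comp (f := fun ε : ℂ => (μ + ε, μ - ε)) (by fun_prop)).sub
        (hF.comp (f := fun ε : ℂ => (μ - ε, μ + ε)) (by fun_prop))
    have hlim : Filter.Tendsto (fun ε : ℂ =>
        (2 * ε)⁻¹ • (F (μ + ε) (μ - ε) - F (μ - ε) (μ + ε))) (nhdsWithin 0 {0}ᶜ)
        (nhds ((2 : ℂ)⁻¹ • deriv H 0)) := by
      have := (hasDerivAt_iff_tendsto_slope.mp hH.hasDerivAt).const_smul (2 : ℂ)⁻¹
      refine this.congr fun ε => ?_
      simp only [slope, vsub_eq_sub, sub_zero, H, add_zero, sub_self, smul_smul, mul_inv]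
    have hms : momentumSwap γ F μ μ = F μ μ - (Complex.I * γ) • ((2 : ℂ)⁻¹ • deriv H 0) := by
      rw [momentumSwap, dividedDifference, if_pos rfl, hlim.limUnder_eq]
    rw [hms]
    have h1 : Filter.Tendsto (fun ε : ℂ => G (μ + ε) (μ - ε) f) (nhdsWithin 0 {0}ᶜ)
        (nhds (G μ μ f)) := by
      have hc : Continuous fun ε : ℂ => G (μ + ε) (μ - ε) f :=
        (hG.comp (f := fun ε : ℂ => (μ + ε, μ - ε)) (by fun_prop)).clm_apply continuous_const
      simpa using (hc.tendsto 0).mono_left nhdsWithin_le_nhds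
    have h2 : Filter.Tendsto (fun ε : ℂ => F (μ - ε) (μ + ε)) (nhdsWithin 0 {0}ᶜ)
        (nhds (F μ μ)) := by
      have hc : Continuous fun ε : ℂ => F (μ - ε) (μ + ε) :=
        hF.continuous.comp (f := fun ε : ℂ => (μ - ε, μ + ε)) (by fun_prop)
      simpa using (hc.tendsto 0).mono_left nhdsWithin_le_nhds
    have h3 := ((ContinuousLinearMap.apply ℂ E' f).continuous.tendsto _).comp
      (h2.sub (hlim.const_smul (Complex.I * γ)))
    refine tendsto_nhds_unique h1 (h3.congr' ?_)
    filter_upwards [self_mem_nhdsWithin] with ε hε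
    have hε' : μ + ε ≠ μ - ε := fun e => hε (by
      have : 2 * ε = 0 := by linear_combination e
      simpa using this)
    rw [hne _ _ hε', show μ + ε - (μ - ε) = 2 * ε by ring]
    rfl
  · rw [hne μ ν hμν, momentumSwap, dividedDifference, if_neg hμν]
    rfl

end SwapRelated

/-- For fixed `μ, ν` the relation says that `f` lies in the kernel of a bounded operator, a closed
subspace. -/
theorem swapRelated_of_mem_zSpace {L γ : ℝ} {N : ℕ} {E' : Type*} [NormedAddCommGroup E']
    [NormedSpace ℂ E'] {F G : ℂ → ℂ → Sector L N →L[ℂ] E'}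
    (h : ∀ κ, SwapRelated γ F G (preWave L γ κ)) {f : Sector L N} (hf : f ∈ zSpace L γ N) :
    SwapRelated γ F G f := by
  intro μ ν
  let T : Sector L N →L[ℂ] E' := (μ - ν) • G μ ν -
    ((μ - ν) • F ν μ - (Complex.I * γ) • (F μ ν - F ν μ))
  have hz : zSpace L γ N ≤ LinearMap.ker T.toLinearMap :=
    zSpace_le (ContinuousLinearMap.isClosed_ker T) fun κ => sub_eq_zero.mpr (h κ μ ν)
  exact sub_eq_zero.mp (hz hf)

/-! ### The relations for `b⁻` and `d` -/

/-- The operators `(μ, ν) ↦ b⁻_ν b⁻_μ`. -/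
def bbMinus (L γ : ℝ) (N : ℕ) (μ ν : ℂ) : Sector L N →L[ℂ] Sector L (N + 2) :=
  opBMinus L γ (N + 1) ν ∘L opBMinus L γ N μ

/-- The operators `(μ, ν) ↦ d_ν b⁻_μ`. -/
def dbMinus (L γ : ℝ) (N : ℕ) (μ ν : ℂ) : Sector L N →L[ℂ] Sector L (N + 1) :=
  opD L γ (N + 1) ν ∘L opBMinus L γ N μ

/-- The operators `(μ, ν) ↦ b⁻_ν d_μ`. -/
def bdMinus (L γ : ℝ) (N : ℕ) (μ ν : ℂ) : Sector L N →L[ℂ] Sector L (N + 1) :=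
  opBMinus L γ N ν ∘L opD L γ N μ

theorem differentiable_bbMinus {L : ℝ} (hL : 0 < L) (γ : ℝ) (N : ℕ) :
    Differentiable ℂ fun p : ℂ × ℂ => bbMinus L γ N p.1 p.2 :=
  ((differentiable_opBMinus hL γ (N + 1)).comp differentiable_snd).clm_comp
    ((differentiable_opBMinus hL γ N).comp differentiable_fst)

theorem differentiable_dbMinus {L : ℝ} (hL : 0 < L) (γ : ℝ) (N : ℕ) :
    Differentiable ℂ fun p : ℂ × ℂ => dbMinus L γ N p.1 p.2 :=
  ((differentiable_opD hL γ (N + 1)).comp differentiable_snd).clm_comp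
    ((differentiable_opBMinus hL γ N).comp differentiable_fst)

theorem differentiable_bdMinus {L : ℝ} (hL : 0 < L) (γ : ℝ) (N : ℕ) :
    Differentiable ℂ fun p : ℂ × ℂ => bdMinus L γ N p.1 p.2 :=
  ((differentiable_opBMinus hL γ N).comp differentiable_snd).clm_comp
    ((differentiable_opD hL γ N).comp differentiable_fst)

theorem addLast_addLast_comp_swap {α : Type*} {N : ℕ} (x : Fin N → α) (s t : α) :
    addLast (addLast x s) t ∘ Equiv.swap (Fin.last N).castSucc (Fin.last (N + 1))
      = addLast (addLast x t) s := by
  rw [Equiv.swap_comm, addLast_comp_swap, update_addLast_last, addLast_last]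

/-- Clearing the denominator `μ - ν` gives the relation a form that survives the passage to equal
momenta. -/
theorem preWaveFun_swap_last {N : ℕ} (γ : ℝ) {κ : Fin N → ℂ} {μ ν : ℂ}
    (hκ : Function.Injective (addLast (addLast κ μ) ν)) (y : Fin (N + 2) → ℝ) :
    (μ - ν) * preWaveFun γ (addLast (addLast κ μ) ν)
        (y ∘ Equiv.swap (Fin.last N).castSucc (Fin.last (N + 1)))
      = (μ - ν) * preWaveFun γ (addLast (addLast κ ν) μ) y
        - Complex.I * γ * (preWaveFun γ (addLast (addLast κ μ) ν) y
          - preWaveFun γ (addLast (addLast κ ν) μ) y) := by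
  have hμν : μ - ν ≠ 0 := sub_ne_zero.mpr fun e =>
    (injective_addLast.mp hκ).2 ⟨Fin.last N, by rw [addLast_last, e]⟩
  rw [preWaveFun_comp_swap γ hκ ⟨((Fin.last N).castSucc, Fin.last (N + 1)), by simp⟩ y]
  simp only [addLast_addLast_comp_swap, addLast_castSucc, addLast_last]
  field_simp
  ring

/-! ### The relations on pre-wavefunctions with arbitrary momenta -/

theorem continuous_preWave_comp {X : Type*} [TopologicalSpace X] (L γ : ℝ) {N : ℕ}
    {F : X → Fin N → ℂ} (hF : Continuous F) : Continuous fun a => preWave L γ (F a) :=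
  (continuous_preWave L γ N).comp hF

theorem swapOp_preWave (L γ : ℝ) {N : ℕ} (κ : Fin N → ℂ) (μ ν : ℂ) :
    (μ - ν) • swapOp L (Fin.last N).castSucc (Fin.last (N + 1))
        (preWave L γ (addLast (addLast κ μ) ν))
      = (μ - ν) • preWave L γ (addLast (addLast κ ν) μ)
        - (Complex.I * γ) • (preWave L γ (addLast (addLast κ μ) ν)
          - preWave L γ (addLast (addLast κ ν) μ)) := by
  let lam : (Fin (N + 2) → ℂ) → Fin N → ℂ := fun κ => (κ ∘ Fin.castSucc) ∘ Fin.castSucc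
  let m : (Fin (N + 2) → ℂ) → ℂ := fun κ => κ (Fin.last N).castSucc
  let n : (Fin (N + 2) → ℂ) → ℂ := fun κ => κ (Fin.last (N + 1))
  have hlam : Continuous lam := by fun_prop
  have hm : Continuous m := by fun_prop
  have hn : Continuous n := by fun_prop
  have h1 := continuous_preWave_comp L γ (continuous_addLast (continuous_addLast hlam hm) hn)
  have h2 := continuous_preWave_comp L γ (continuous_addLast (continuous_addLast hlam hn) hm)
  have key := Continuous.ext_on (dense_injective (N + 2))
    (f := fun κ => (m κ - n κ) • swapOp L (Fin.last N).castSucc (Fin.last (N + 1))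
        (preWave L γ (addLast (addLast (lam κ) (m κ)) (n κ))))
    (g := fun κ => (m κ - n κ) • preWave L γ (addLast (addLast (lam κ) (n κ)) (m κ))
        - (Complex.I * γ) • (preWave L γ (addLast (addLast (lam κ) (m κ)) (n κ))
          - preWave L γ (addLast (addLast (lam κ) (n κ)) (m κ))))
    ((hm.sub hn).smul ((swapOp L _ _).continuous.comp h1))
    (((hm.sub hn).smul h2).sub ((h1.sub h2).const_smul (Complex.I * (γ : ℂ)))) ?_
  · simpa [lam, m, n] using congrFun key (addLast (addLast κ μ) ν)
  · intro κ hκ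
    have hκ' : Function.Injective (addLast (addLast (lam κ) (m κ)) (n κ)) := by
      have : addLast (addLast (lam κ) (m κ)) (n κ) = κ := by
        rw [show addLast (lam κ) (m κ) = κ ∘ Fin.castSucc from addLast_eta (κ ∘ Fin.castSucc)]
        exact addLast_eta κ
      rw [this]; exact hκ
    dsimp only
    generalize lam κ = l, m κ = μ, n κ = ν at hκ' ⊢
    refine Lp.ext ?_
    filter_upwards [Lp.coeFn_smul (μ - ν) (swapOp L (Fin.last N).castSucc (Fin.last (N + 1))
        (preWave L γ (addLast (addLast l μ) ν))),
      coeFn_swapOp (Fin.last N).castSucc (Fin.last (N + 1)) _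
        (coeFn_preWave L γ (addLast (addLast l μ) ν)),
      Lp.coeFn_sub ((μ - ν) • preWave L γ (addLast (addLast l ν) μ))
        ((Complex.I * γ) • (preWave L γ (addLast (addLast l μ) ν)
          - preWave L γ (addLast (addLast l ν) μ))),
      Lp.coeFn_smul (μ - ν) (preWave L γ (addLast (addLast l ν) μ)),
      Lp.coeFn_smul (Complex.I * γ) (preWave L γ (addLast (addLast l μ) ν)
          - preWave L γ (addLast (addLast l ν) μ)),
      Lp.coeFn_sub (preWave L γ (addLast (addLast l μ) ν)) (preWave L γ (addLast (addLast l ν) μ)),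
      coeFn_preWave L γ (addLast (addLast l μ) ν), coeFn_preWave L γ (addLast (addLast l ν) μ)]
      with y h1 h2 h3 h4 h5 h6 h7 h8
    rw [h1, Pi.smul_apply, h2, h3, Pi.sub_apply, h4, Pi.smul_apply, h5, Pi.smul_apply, h6,
      Pi.sub_apply, h7, h8]
    exact preWaveFun_swap_last γ hκ' y

theorem opD_preWave_mem {L : ℝ} (hL : 0 < L) (γ : ℝ) {N : ℕ} (κ : Fin N → ℂ) (μ : ℂ) :
    opD L γ N μ (preWave L γ κ) ∈ zSpace L γ N := by
  -- `exists_opD_preWave` carries one more momentum than is needed here; it is set to `0` at the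
  -- end, after density has removed the distinctness condition.
  have h := mem_of_injective (N := N + 2) (isClosed_zSpace L γ N)
    (F := fun κ => opD L γ N (κ (Fin.last N).castSucc)
      (preWave L γ ((κ ∘ Fin.castSucc) ∘ Fin.castSucc)))
    (((differentiable_opD hL γ N).continuous.comp (continuous_apply _)).clm_apply
      (continuous_preWave_comp L γ (by fun_prop))) ?_ (addLast (addLast κ μ) 0)
  · simpa using h
  · intro κ hκ
    rw [← addLast_eta κ] at hκ
    obtain ⟨c, ρ, h, -⟩ := exists_opD_preWave L γ hκ
    change opD L γ N ((κ ∘ Fin.castSucc) (Fin.last N)) _ ∈ _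
    rw [h]
    exact Submodule.sum_mem _ fun v _ => Submodule.smul_mem _ _ (preWave_mem_zSpace L γ _)

/-- The relation between `b⁻_ν d_μ` and `d_ν b⁻_μ` on the pre-wavefunctions. -/
theorem swapRelated_dbMinus_preWave {L : ℝ} (hL : 0 < L) (γ : ℝ) {N : ℕ} (κ : Fin N → ℂ) :
    SwapRelated γ (dbMinus L γ N) (bdMinus L γ N) (preWave L γ κ) := by
  intro μ ν
  let lam : (Fin (N + 2) → ℂ) → Fin N → ℂ := fun κ => (κ ∘ Fin.castSucc) ∘ Fin.castSucc
  let m : (Fin (N + 2) → ℂ) → ℂ := fun κ => κ (Fin.last N).castSucc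
  let n : (Fin (N + 2) → ℂ) → ℂ := fun κ => κ (Fin.last (N + 1))
  have hlam : Continuous lam := by fun_prop
  have hm : Continuous m := by fun_prop
  have hn : Continuous n := by fun_prop
  have hpw := continuous_preWave_comp L γ hlam
  have hbd : Continuous fun κ => bdMinus L γ N (m κ) (n κ) (preWave L γ (lam κ)) :=
    ((differentiable_bdMinus hL γ N).continuous.comp (hm.prodMk hn)).clm_apply hpw
  have hdb : Continuous fun κ => dbMinus L γ N (m κ) (n κ) (preWave L γ (lam κ)) :=
    ((differentiable_dbMinus hL γ N).continuous.comp (hm.prodMk hn)).clm_apply hpw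
  have hdb' : Continuous fun κ => dbMinus L γ N (n κ) (m κ) (preWave L γ (lam κ)) :=
    ((differentiable_dbMinus hL γ N).continuous.comp (hn.prodMk hm)).clm_apply hpw
  have key := Continuous.ext_on (dense_injective (N + 2))
    (f := fun κ => (m κ - n κ) • bdMinus L γ N (m κ) (n κ) (preWave L γ (lam κ)))
    (g := fun κ => (m κ - n κ) • dbMinus L γ N (n κ) (m κ) (preWave L γ (lam κ))
      - (Complex.I * γ) • (dbMinus L γ N (m κ) (n κ) (preWave L γ (lam κ))
        - dbMinus L γ N (n κ) (m κ) (preWave L γ (lam κ))))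
    ((hm.sub hn).smul hbd)
    (((hm.sub hn).smul hdb').sub ((hdb.sub hdb').const_smul (Complex.I * (γ : ℂ)))) ?_
  · simpa [lam, m, n] using congrFun key (addLast (addLast κ μ) ν)
  · intro κ hκ
    have hκ' : Function.Injective (addLast (addLast (lam κ) (m κ)) (n κ)) := by
      have : addLast (addLast (lam κ) (m κ)) (n κ) = κ := by
        rw [show addLast (lam κ) (m κ) = κ ∘ Fin.castSucc from addLast_eta (κ ∘ Fin.castSucc)]
        exact addLast_eta κ
      rw [this]; exact hκ
    dsimp only
    generalize lam κ = l, m κ = μ, n κ = ν at hκ' ⊢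
    have hκs : Function.Injective (addLast (addLast l ν) μ) := by
      rw [← addLast_addLast_comp_swap]
      exact hκ'.comp (Equiv.injective _)
    -- All three vectors are values of two functions `ψ`: `d b⁻` at `(z, L/2)`, and `b⁻ d` at the
    -- same point with its last two coordinates exchanged.
    have e1 : dbMinus L γ N μ ν (preWave L γ l) =ᵐ[cubeMeasure L (N + 1)]
        fun z => preWaveFun γ (addLast (addLast l μ) ν) (addLast z (L / 2)) := by
      have := coeFn_opD_preWave L γ hκ'
      rw [addLast_last, addLast_comp_castSucc, ← opBMinus_preWave hL] at this
      exact this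
    have e2 : dbMinus L γ N ν μ (preWave L γ l) =ᵐ[cubeMeasure L (N + 1)]
        fun z => preWaveFun γ (addLast (addLast l ν) μ) (addLast z (L / 2)) := by
      have := coeFn_opD_preWave L γ hκs
      rw [addLast_last, addLast_comp_castSucc, ← opBMinus_preWave hL] at this
      exact this
    have e3 : bdMinus L γ N μ ν (preWave L γ l) =ᵐ[cubeMeasure L (N + 1)]
        fun z => preWaveFun γ (addLast (addLast l μ) ν)
          (addLast (addLast (z ∘ Fin.castSucc) (L / 2)) (z (Fin.last N))) := by
      obtain ⟨c, ρ, h, h'⟩ := exists_opD_preWave L γ hκ'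
      rw [addLast_last, addLast_comp_castSucc] at h
      have : bdMinus L γ N μ ν (preWave L γ l) = ∑ v, c v • preWave L γ (addLast (ρ v) ν) := by
        rw [bdMinus, ContinuousLinearMap.comp_apply, h, map_sum]
        simp only [map_smul, opBMinus_preWave hL]
      rw [this]
      exact h'
    refine Lp.ext ?_
    filter_upwards [e1, e2, e3, Lp.coeFn_smul (μ - ν) (bdMinus L γ N μ ν (preWave L γ l)),
      Lp.coeFn_sub ((μ - ν) • dbMinus L γ N ν μ (preWave L γ l))
        ((Complex.I * γ) • (dbMinus L γ N μ ν (preWave L γ l)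
          - dbMinus L γ N ν μ (preWave L γ l))),
      Lp.coeFn_smul (μ - ν) (dbMinus L γ N ν μ (preWave L γ l)),
      Lp.coeFn_smul (Complex.I * γ) (dbMinus L γ N μ ν (preWave L γ l)
          - dbMinus L γ N ν μ (preWave L γ l)),
      Lp.coeFn_sub (dbMinus L γ N μ ν (preWave L γ l)) (dbMinus L γ N ν μ (preWave L γ l))]
      with z h1 h2 h3 h4 h5 h6 h7 h8
    rw [h4, Pi.smul_apply, h3, h5, Pi.sub_apply, h6, Pi.smul_apply, h7, Pi.smul_apply, h8,
      Pi.sub_apply, h1, h2, ← addLast_addLast_comp_swap (z ∘ Fin.castSucc), addLast_eta]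
    exact preWaveFun_swap_last γ hκ' _

/-! ### The relations on `𝔷_N` -/

theorem opBMinus_mem {L : ℝ} (hL : 0 < L) (γ : ℝ) {N : ℕ} (μ : ℂ) {f : Sector L N}
    (hf : f ∈ zSpace L γ N) : opBMinus L γ N μ f ∈ zSpace L γ (N + 1) :=
  map_mem_zSpace (fun κ => by
    rw [opBMinus_preWave hL]; exact preWave_mem_zSpace L γ _) hf

theorem opD_mem {L : ℝ} (hL : 0 < L) (γ : ℝ) {N : ℕ} (μ : ℂ) {f : Sector L N}
    (hf : f ∈ zSpace L γ N) : opD L γ N μ f ∈ zSpace L γ N :=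
  map_mem_zSpace (fun κ => opD_preWave_mem hL γ κ μ) hf

theorem swapOp_last_mem (L γ : ℝ) {N : ℕ} {f : Sector L (N + 2)}
    (hf : f ∈ zSpace L γ (N + 2)) :
    swapOp L (Fin.last N).castSucc (Fin.last (N + 1)) f ∈ zSpace L γ (N + 2) := by
  refine map_mem_zSpace (fun κ => ?_) hf
  refine mem_of_injective (isClosed_zSpace L γ (N + 2)) (F := fun κ => swapOp L (Fin.last N).castSucc
    (Fin.last (N + 1)) (preWave L γ κ)) ((swapOp L _ _).continuous.comp
      (continuous_preWave L γ _)) (fun κ hκ => ?_) κ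
  have h := swapOp_preWave L γ ((κ ∘ Fin.castSucc) ∘ Fin.castSucc) (κ (Fin.last N).castSucc)
    (κ (Fin.last (N + 1)))
  have e : addLast (addLast ((κ ∘ Fin.castSucc) ∘ Fin.castSucc) (κ (Fin.last N).castSucc))
      (κ (Fin.last (N + 1))) = κ := by
    rw [show addLast ((κ ∘ Fin.castSucc) ∘ Fin.castSucc) (κ (Fin.last N).castSucc)
      = κ ∘ Fin.castSucc from addLast_eta (κ ∘ Fin.castSucc)]
    exact addLast_eta κ
  rw [e] at h
  -- For distinct momenta the factor `μ - ν` in `swapOp_preWave` is invertible, so the permuted wave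
  -- itself lies in the span.
  have hd : κ (Fin.last N).castSucc - κ (Fin.last (N + 1)) ≠ 0 :=
    sub_ne_zero.mpr fun e => Fin.castSucc_ne_last _ (hκ e)
  rw [SetLike.mem_coe, ← Submodule.smul_mem_iff _ hd, h]
  exact Submodule.sub_mem _ (Submodule.smul_mem _ _ (preWave_mem_zSpace L γ _))
    (Submodule.smul_mem _ _ (Submodule.sub_mem _ (preWave_mem_zSpace L γ _)
      (preWave_mem_zSpace L γ _)))

theorem swapRelated_bbMinus {L : ℝ} (hL : 0 < L) (γ : ℝ) {N : ℕ} {f : Sector L N}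
    (hf : f ∈ zSpace L γ N) : SwapRelated γ (bbMinus L γ N) (fun μ ν =>
      swapOp L (Fin.last N).castSucc (Fin.last (N + 1)) ∘L bbMinus L γ N μ ν) f := by
  refine swapRelated_of_mem_zSpace (fun κ μ ν => ?_) hf
  simp only [bbMinus, ContinuousLinearMap.comp_apply, opBMinus_preWave hL]
  exact swapOp_preWave L γ κ μ ν

theorem swapRelated_dbMinus {L : ℝ} (hL : 0 < L) (γ : ℝ) {N : ℕ} {f : Sector L N}
    (hf : f ∈ zSpace L γ N) : SwapRelated γ (dbMinus L γ N) (bdMinus L γ N) f :=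
  swapRelated_of_mem_zSpace (fun κ => swapRelated_dbMinus_preWave hL γ κ) hf

/-! ### The reflection `x ↦ (-x_N, …, -x_1)` -/

theorem reflect_reflect {N : ℕ} (x : Fin N → ℝ) : reflect (reflect x) = x := by
  funext i; simp [reflect]

theorem measurePreserving_reflect_of {N : ℕ} {m : Measure ℝ} [SigmaFinite m]
    (hm : MeasurePreserving (fun t : ℝ => -t) m m) :
    MeasurePreserving (reflect (N := N)) (Measure.pi fun _ => m) (Measure.pi fun _ => m) := by
  have h1 := measurePreserving_piCongrLeft (α := fun _ : Fin N => ℝ) (fun _ => m) Fin.revPerm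
  have h2 := measurePreserving_pi (fun _ : Fin N => m) (fun _ => m) (fun _ => hm)
  have e : ⇑(MeasurableEquiv.piCongrLeft (fun _ : Fin N => ℝ) Fin.revPerm)
      = fun x : Fin N → ℝ => fun i => x i.rev := by
    funext x i
    rw [MeasurableEquiv.coe_piCongrLeft]
    have := Equiv.piCongrLeft_apply_apply (fun _ : Fin N => ℝ) Fin.revPerm x i.rev
    simpa using this
  rw [e] at h1
  exact h2.comp h1

theorem measurePreserving_reflect (L : ℝ) (N : ℕ) :
    MeasurePreserving (reflect (N := N)) (cubeMeasure L N) (cubeMeasure L N) := by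
  refine measurePreserving_reflect_of ?_
  have h := (Measure.measurePreserving_neg (volume : Measure ℝ)).restrict_preimage
    (measurableSet_Icc (a := -(L / 2)) (b := L / 2))
  have e : (Neg.neg : ℝ → ℝ) ⁻¹' Set.Icc (-(L / 2)) (L / 2) = Set.Icc (-(L / 2)) (L / 2) := by
    ext t
    simp only [Set.mem_preimage, Set.mem_Icc]
    constructor <;> rintro ⟨h1, h2⟩ <;> constructor <;> linarith
  rwa [e] at h

theorem measurePreserving_reflect_volume (N : ℕ) :
    MeasurePreserving (reflect (N := N)) volume volume :=
  measurePreserving_reflect_of (Measure.measurePreserving_neg volume)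

theorem measurableEmbedding_reflect (N : ℕ) : MeasurableEmbedding (reflect (N := N)) :=
  (MeasurableEquiv.mk ⟨reflect, reflect, reflect_reflect, reflect_reflect⟩
    (measurePreserving_reflect_volume N).measurable
    (measurePreserving_reflect_volume N).measurable).measurableEmbedding

/-- The operator `f ↦ f ∘ reflect` on `𝔥_N`. -/
def reflOp (L : ℝ) (N : ℕ) : Sector L N →L[ℂ] Sector L N :=
  (Lp.compMeasurePreservingₗᵢ ℂ reflect (measurePreserving_reflect L N)).toContinuousLinearMap

theorem coeFn_reflOp {L : ℝ} {N : ℕ} (F : Sector L N) {f : (Fin N → ℝ) → ℂ}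
    (hf : F =ᵐ[cubeMeasure L N] f) :
    reflOp L N F =ᵐ[cubeMeasure L N] fun x => f (reflect x) :=
  (Lp.coeFn_compMeasurePreserving F (measurePreserving_reflect L N)).trans
    ((measurePreserving_reflect L N).quasiMeasurePreserving.ae_eq hf)

theorem reflOp_reflOp {L : ℝ} {N : ℕ} (F : Sector L N) : reflOp L N (reflOp L N F) = F := by
  refine Lp.ext ((coeFn_reflOp _ (coeFn_reflOp F Filter.EventuallyEq.rfl)).trans
    (Filter.Eventually.of_forall fun x => ?_))
  simp only [reflect_reflect]

theorem reflOp_preWave (L γ : ℝ) {N : ℕ} (κ : Fin N → ℂ) :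
    reflOp L N (preWave L γ κ) = preWave L γ fun i => -κ i.rev := by
  refine congrFun (Continuous.ext_on (dense_injective N)
    (f := fun κ => reflOp L N (preWave L γ κ)) (g := fun κ => preWave L γ fun i => -κ i.rev)
    ((reflOp L N).continuous.comp (continuous_preWave L γ N))
    (continuous_preWave_comp L γ (by fun_prop)) fun κ hκ => ?_) κ
  refine Lp.ext ((coeFn_reflOp _ (coeFn_preWave L γ κ)).trans
    (Filter.EventuallyEq.trans ?_ (coeFn_preWave L γ _).symm))
  exact Filter.Eventually.of_forall fun x => preWaveFun_reflect γ hκ x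

theorem reflOp_mem {L γ : ℝ} {N : ℕ} {f : Sector L N} (hf : f ∈ zSpace L γ N) :
    reflOp L N f ∈ zSpace L γ N :=
  map_mem_zSpace (fun κ => by rw [reflOp_preWave]; exact preWave_mem_zSpace L γ _) hf

/-! ### Reflection of the operators -/

theorem opOf_eq_reflOp {L : ℝ} {N M : ℕ} {K K' : ((Fin N → ℝ) → ℂ) → (Fin M → ℝ) → ℂ}
    (h : IsL2Bounded L K) (h' : IsL2Bounded L K')
    (hK : ∀ f x, K f x = K' (fun z => f (reflect z)) (reflect x)) :
    opOf L K h = reflOp L M ∘L opOf L K' h' ∘L reflOp L N := by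
  ext1 F
  refine Lp.ext ((coeFn_opOf h F Filter.EventuallyEq.rfl).trans ?_)
  simp only [ContinuousLinearMap.comp_apply]
  refine Filter.EventuallyEq.trans ?_ (coeFn_reflOp _ (coeFn_opOf h' _
    (coeFn_reflOp F Filter.EventuallyEq.rfl))).symm
  exact Filter.Eventually.of_forall fun x => hK _ x

/-- The reversed tuple `m ↦ N + 1 - i_{n + 1 - m}`. -/
def reflectEmb {N n : ℕ} (i : Fin n ↪ Fin N) : Fin n ↪ Fin N :=
  ⟨fun m => (i m.rev).rev, fun a b h => by simpa using h⟩

theorem reflectEmb_apply {N n : ℕ} (i : Fin n ↪ Fin N) (m : Fin n) :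
    reflectEmb i m = (i m.rev).rev := rfl

theorem reflectEmb_involutive {N n : ℕ} :
    Function.Involutive (reflectEmb : (Fin n ↪ Fin N) → (Fin n ↪ Fin N)) := fun i => by
  ext m; simp [reflectEmb_apply]

theorem reflect_comp_reflectEmb {N n : ℕ} (i : Fin n ↪ Fin N) (x : Fin N → ℝ) :
    reflect x ∘ reflectEmb i = reflect (x ∘ i) := by
  funext m; simp [reflect, reflectEmb_apply]

theorem strictAnti_reflect {N : ℕ} {x : Fin N → ℝ} : StrictAnti (reflect x) ↔ StrictAnti x := by
  have h : ∀ x : Fin N → ℝ, StrictAnti x → StrictAnti (reflect x) := fun x hx a b hab =>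
    neg_lt_neg (hx (Fin.rev_lt_rev.mpr hab))
  exact ⟨fun hx => reflect_reflect x ▸ h _ hx, h x⟩

theorem cons_reflect {n : ℕ} (t : ℝ) (v : Fin n → ℝ) :
    (Fin.cons (-t) (reflect v) : Fin (n + 1) → ℝ) = reflect (Fin.snoc v t : Fin (n + 1) → ℝ) := by
  funext j
  refine Fin.cases ?_ (fun j => ?_) j
  · simp [reflect]
  · simp [reflect, Fin.rev_succ]

theorem reflect_replace {N n : ℕ} (i : Fin n ↪ Fin N) (y : Fin n → ℝ) (x : Fin N → ℝ) :
    reflect (replace (reflectEmb i) (reflect y) (reflect x)) = replace i y x := by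
  funext j
  by_cases h : ∃ m, i m = j
  · obtain ⟨m, rfl⟩ := h
    have : (i m).rev = reflectEmb i m.rev := by simp [reflectEmb_apply]
    rw [reflect, this]
    simp only [replace, (reflectEmb i).injective.extend_apply, i.injective.extend_apply]
    simp [reflect]
  · have h' : ¬∃ m, reflectEmb i m = j.rev := fun ⟨m, hm⟩ => h ⟨m.rev, by
      simpa [reflectEmb_apply] using hm⟩
    rw [reflect]
    simp only [replace, Function.extend_apply' _ _ _ h, Function.extend_apply' _ _ _ h']
    simp [reflect]

/-- The change of variables `y ↦ reflect y` preserves volume. It reverses each interval and negates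
the difference `x - y` in the exponent, which replacing `l` by `-l` undoes. -/
theorem shiftIntegral_reflect {N n : ℕ} (l : ℂ) (i : Fin n ↪ Fin N) (v : Fin n → ℝ) (t : ℝ)
    (f : (Fin N → ℝ) → ℂ) (x : Fin N → ℝ) :
    shiftIntegral (-l) (reflectEmb i) (boxAbove (-t) (reflect v)) (fun z => f (reflect z))
      (reflect x) = shiftIntegral l i (boxBelow v t) f x := by
  rw [shiftIntegral, ← (measurePreserving_reflect_volume n).setIntegral_preimage_emb
    (measurableEmbedding_reflect n)]
  have hpre : reflect ⁻¹' boxAbove (-t) (reflect v)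
      = Set.pi Set.univ fun m => Set.Ico ((Fin.snoc v t : Fin (n + 1) → ℝ) m.succ) (v m) := by
    ext y
    simp only [boxAbove, cons_reflect, Set.mem_preimage, Set.mem_pi, Set.mem_univ, true_implies]
    rw [Fin.revPerm.forall_congr_left]
    refine forall_congr' fun m => ?_
    simp only [reflect, Fin.revPerm_symm, Fin.revPerm_apply, Fin.rev_rev, Fin.rev_castSucc,
      Set.mem_Ioc, Set.mem_Ico, neg_lt_neg_iff, neg_le_neg_iff]
    exact and_comm
  -- Reflection moves the closed end of each half-open interval to the other side, a change on a
  -- null set only.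
  have hae : (Set.pi Set.univ fun m =>
      Set.Ico ((Fin.snoc v t : Fin (n + 1) → ℝ) m.succ) (v m)) =ᵐ[volume] boxBelow v t := by
    rw [volume_pi]
    exact Measure.univ_pi_Ico_ae_eq_Icc.trans Measure.univ_pi_Ioc_ae_eq_Icc.symm
  rw [hpre, setIntegral_congr_set hae, shiftIntegral]
  congr 1
  funext y
  rw [reflect_replace]
  congr 1
  refine Fintype.prod_equiv Fin.revPerm _ _ fun m => ?_
  simp only [reflect, reflectEmb_apply, Fin.rev_rev, Fin.revPerm_apply]
  congr 1
  push_cast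
  ring

theorem hatPlusFun_eq_reflect {N n : ℕ} (l : ℂ) (i : Fin n ↪ Fin N) (f : (Fin N → ℝ) → ℂ)
    (x : Fin (N + 1) → ℝ) : hatPlusFun l i f x
      = hatMinusFun (-l) (reflectEmb i) (fun z => f (reflect z)) (reflect x) := by
  have h1 : reflect x ∘ Fin.castSucc = reflect (x ∘ Fin.succ) := by
    funext j; simp [reflect, Fin.rev_castSucc]
  have h2 : reflect x (Fin.last N) = -x 0 := by simp [reflect]
  rw [hatPlusFun, hatMinusFun, h1, h2, reflect_comp_reflectEmb, cons_reflect,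
    strictAnti_reflect, shiftIntegral_reflect]
  congr 3
  push_cast
  ring

theorem barPlusFun_eq_reflect (L : ℝ) {N n : ℕ} (l : ℂ) (i : Fin n ↪ Fin N)
    (f : (Fin N → ℝ) → ℂ) (x : Fin N → ℝ) : barPlusFun L l i f x
      = barMinusFun L (-l) (reflectEmb i) (fun z => f (reflect z)) (reflect x) := by
  rw [barPlusFun, barMinusFun, reflect_comp_reflectEmb, strictAnti_reflect,
    ← neg_neg (L / 2), shiftIntegral_reflect, neg_neg]
  congr 3
  ring

/-- The reflection turns the first coordinate into the last and the tuples into reversed tuples, so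
that `b⁺` inherits from `b⁻` its holomorphy, its invariance properties and its relations. -/
theorem opBPlus_eq (L γ : ℝ) (N : ℕ) (l : ℂ) :
    opBPlus L γ N l = reflOp L (N + 1) ∘L opBMinus L γ N (-l) ∘L reflOp L N := by
  ext1 f
  simp only [opBPlus, opBMinus, ContinuousLinearMap.comp_apply, sum_apply, smul_apply, map_sum,
    map_smul]
  refine Finset.sum_congr rfl fun n _ => congrArg _ ?_
  refine Fintype.sum_equiv reflectEmb_involutive.toPerm _ _ fun i => ?_
  exact DFunLike.congr_fun (opOf_eq_reflOp (isL2Bounded_hatPlus L l i)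
    (isL2Bounded_hatMinus L (-l) (reflectEmb i)) (hatPlusFun_eq_reflect l i)) f

theorem opA_eq (L γ : ℝ) (N : ℕ) (l : ℂ) :
    opA L γ N l = reflOp L N ∘L opD L γ N (-l) ∘L reflOp L N := by
  ext1 f
  simp only [opA, opD, ContinuousLinearMap.comp_apply, sum_apply, smul_apply, map_sum,
    map_smul]
  refine Finset.sum_congr rfl fun n _ => congrArg _ ?_
  refine Fintype.sum_equiv reflectEmb_involutive.toPerm _ _ fun i => ?_
  exact DFunLike.congr_fun (opOf_eq_reflOp (isL2Bounded_barPlus L l i)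
    (isL2Bounded_barMinus L (-l) (reflectEmb i)) (barPlusFun_eq_reflect L l i)) f

theorem swapOp_zero_one_eq (L : ℝ) (N : ℕ) : swapOp L (0 : Fin (N + 2)) 1
    = reflOp L (N + 2) ∘L swapOp L (Fin.last N).castSucc (Fin.last (N + 1)) ∘L
      reflOp L (N + 2) := by
  ext1 F
  refine Lp.ext ((coeFn_swapOp 0 1 F Filter.EventuallyEq.rfl).trans
    (Filter.EventuallyEq.trans (Filter.Eventually.of_forall fun x => ?_)
      (coeFn_reflOp _ (coeFn_swapOp _ _ _ (coeFn_reflOp F Filter.EventuallyEq.rfl))).symm))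
  dsimp only
  congr 1
  funext j
  have h := (Fin.rev_injective (n := N + 2)).map_swap (Fin.last N).castSucc (Fin.last (N + 1)) j.rev
  rw [Fin.rev_rev, Fin.rev_castSucc, Fin.rev_last, Fin.rev_last, Fin.succ_zero_eq_one,
    Equiv.swap_comm 1] at h
  simp [reflect, h]

/-! ### Transport of the relations -/

/-- The conjugate of a family of operators by the reflection, `(μ, ν) ↦ R F(-ν, -μ) R`. -/
def reflConj (L : ℝ) {N M : ℕ} (F : ℂ → ℂ → Sector L N →L[ℂ] Sector L M) (μ ν : ℂ) :
    Sector L N →L[ℂ] Sector L M :=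
  reflOp L M ∘L F (-ν) (-μ) ∘L reflOp L N

/-- The substitution `(μ, ν) ↦ (-ν, -μ)` preserves `μ - ν` and commutes with the exchange of the two
momenta, hence with `s̃_γ`. -/
theorem SwapRelated.reflConj {L γ : ℝ} {N M : ℕ} {F G : ℂ → ℂ → Sector L N →L[ℂ] Sector L M}
    {f : Sector L N} (h : SwapRelated γ F G (reflOp L N f)) :
    SwapRelated γ (reflConj L F) (reflConj L G) f := by
  intro μ ν
  have := congrArg (reflOp L M) (h (-ν) (-μ))
  simp only [map_sub, map_smul, neg_sub_neg] at this
  exact this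

theorem differentiable_reflConj {L : ℝ} {N M : ℕ} {F : ℂ → ℂ → Sector L N →L[ℂ] Sector L M}
    (hF : Differentiable ℂ fun p : ℂ × ℂ => F p.1 p.2) :
    Differentiable ℂ fun p : ℂ × ℂ => reflConj L F p.1 p.2 :=
  (differentiable_const _).clm_comp
    ((hF.comp (f := fun p : ℂ × ℂ => (-p.2, -p.1)) (by fun_prop)).clm_comp
      (differentiable_const _))

theorem differentiable_opBPlus {L : ℝ} (hL : 0 < L) (γ : ℝ) (N : ℕ) :
    Differentiable ℂ (opBPlus L γ N) := by
  rw [show opBPlus L γ N = _ from funext (opBPlus_eq L γ N)]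
  exact (differentiable_const _).clm_comp
    (((differentiable_opBMinus hL γ N).comp differentiable_neg).clm_comp (differentiable_const _))

theorem differentiable_opA {L : ℝ} (hL : 0 < L) (γ : ℝ) (N : ℕ) :
    Differentiable ℂ (opA L γ N) := by
  rw [show opA L γ N = _ from funext (opA_eq L γ N)]
  exact (differentiable_const _).clm_comp
    (((differentiable_opD hL γ N).comp differentiable_neg).clm_comp (differentiable_const _))

theorem opBPlus_mem {L : ℝ} (hL : 0 < L) (γ : ℝ) {N : ℕ} (μ : ℂ) {f : Sector L N}
    (hf : f ∈ zSpace L γ N) : opBPlus L γ N μ f ∈ zSpace L γ (N + 1) := by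
  rw [opBPlus_eq]
  exact reflOp_mem (opBMinus_mem hL γ _ (reflOp_mem hf))

theorem opA_mem {L : ℝ} (hL : 0 < L) (γ : ℝ) {N : ℕ} (μ : ℂ) {f : Sector L N}
    (hf : f ∈ zSpace L γ N) : opA L γ N μ f ∈ zSpace L γ N := by
  rw [opA_eq]
  exact reflOp_mem (opD_mem hL γ _ (reflOp_mem hf))

theorem swapOp_zero_one_mem (L γ : ℝ) {N : ℕ} {f : Sector L (N + 2)}
    (hf : f ∈ zSpace L γ (N + 2)) : swapOp L (0 : Fin (N + 2)) 1 f ∈ zSpace L γ (N + 2) := by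
  rw [swapOp_zero_one_eq]
  exact reflOp_mem (swapOp_last_mem L γ (reflOp_mem hf))

/-- The inner reflections cancel in pairs, and the combined negation and exchange of the momenta
produces the order `b⁺_μ b⁺_ν`. -/
theorem reflConj_bbMinus (L γ : ℝ) (N : ℕ) : reflConj L (bbMinus L γ N)
    = fun μ ν => opBPlus L γ (N + 1) μ ∘L opBPlus L γ N ν := by
  funext μ ν
  ext1 f
  simp [reflConj, bbMinus, opBPlus_eq, reflOp_reflOp]

theorem reflConj_swapOp_bbMinus (L γ : ℝ) (N : ℕ) : reflConj L (fun μ ν =>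
      swapOp L (Fin.last N).castSucc (Fin.last (N + 1)) ∘L bbMinus L γ N μ ν)
    = fun μ ν => swapOp L (0 : Fin (N + 2)) 1 ∘L opBPlus L γ (N + 1) μ ∘L opBPlus L γ N ν := by
  funext μ ν
  ext1 f
  simp [reflConj, bbMinus, opBPlus_eq, swapOp_zero_one_eq, reflOp_reflOp]

theorem reflConj_dbMinus (L γ : ℝ) (N : ℕ) : reflConj L (dbMinus L γ N)
    = fun μ ν => opA L γ (N + 1) μ ∘L opBPlus L γ N ν := by
  funext μ ν
  ext1 f
  simp [reflConj, dbMinus, opBPlus_eq, opA_eq, reflOp_reflOp]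

theorem reflConj_bdMinus (L γ : ℝ) (N : ℕ) : reflConj L (bdMinus L γ N)
    = fun μ ν => opBPlus L γ N μ ∘L opA L γ N ν := by
  funext μ ν
  ext1 f
  simp [reflConj, bdMinus, opBPlus_eq, opA_eq, reflOp_reflOp]

end QNLS

end

/-! ### Assembly of the relations -/

theorem mainTheorem5 (L : ℝ) (hL : 0 < L) (γ : ℝ) (N : ℕ) :
    -- the operators depend analytically on the momentum, so that `s̃_γ` acts on them
    (Differentiable ℂ (QNLS.opA L γ N) ∧ Differentiable ℂ (QNLS.opBPlus L γ N) ∧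
      Differentiable ℂ (QNLS.opBMinus L γ N) ∧ Differentiable ℂ (QNLS.opD L γ N)) ∧
    -- the operators map `𝔷_N` to `𝔷_N` or `𝔷_{N+1}`
    (∀ μ : ℂ, ∀ f ∈ QNLS.zSpace L γ N,
      QNLS.opA L γ N μ f ∈ QNLS.zSpace L γ N ∧
      QNLS.opBPlus L γ N μ f ∈ QNLS.zSpace L γ (N + 1) ∧
      QNLS.opBMinus L γ N μ f ∈ QNLS.zSpace L γ (N + 1) ∧
      QNLS.opD L γ N μ f ∈ QNLS.zSpace L γ N) ∧
    -- the relations, with `(μ, ν) = (λ_{N+1}, λ_{N+2})` for `b⁻`, `d`, and `(μ, ν) = (λ_1, λ_2)`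
    -- for `b⁺`, `a`
    ∀ μ ν : ℂ, ∀ f ∈ QNLS.zSpace L γ N,
      -- `s_{N+1} b⁻_ν b⁻_μ = (s̃_γ b⁻_ν b⁻_μ)` and `s_1 b⁺_μ b⁺_ν = (s̃_γ b⁺_μ b⁺_ν)`
      (QNLS.swapOp L (Fin.last N).castSucc (Fin.last (N + 1))
          (QNLS.opBMinus L γ (N + 1) ν (QNLS.opBMinus L γ N μ f)) =
        QNLS.momentumSwap γ
          (fun μ ν => QNLS.opBMinus L γ (N + 1) ν ∘L QNLS.opBMinus L γ N μ) μ ν f ∧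
       QNLS.swapOp L (Fin.last N).castSucc (Fin.last (N + 1))
          (QNLS.opBMinus L γ (N + 1) ν (QNLS.opBMinus L γ N μ f)) ∈ QNLS.zSpace L γ (N + 2)) ∧
      (QNLS.swapOp L (0 : Fin (N + 2)) 1
          (QNLS.opBPlus L γ (N + 1) μ (QNLS.opBPlus L γ N ν f)) =
        QNLS.momentumSwap γ
          (fun μ ν => QNLS.opBPlus L γ (N + 1) μ ∘L QNLS.opBPlus L γ N ν) μ ν f ∧
       QNLS.swapOp L (0 : Fin (N + 2)) 1
          (QNLS.opBPlus L γ (N + 1) μ (QNLS.opBPlus L γ N ν f)) ∈ QNLS.zSpace L γ (N + 2)) ∧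
      -- `b⁻_ν d_μ = (s̃_γ d_ν b⁻_μ)` and `b⁺_μ a_ν = (s̃_γ a_μ b⁺_ν)`
      QNLS.opBMinus L γ N ν (QNLS.opD L γ N μ f) =
        QNLS.momentumSwap γ
          (fun μ ν => QNLS.opD L γ (N + 1) ν ∘L QNLS.opBMinus L γ N μ) μ ν f ∧
      QNLS.opBPlus L γ N μ (QNLS.opA L γ N ν f) =
        QNLS.momentumSwap γ
          (fun μ ν => QNLS.opA L γ (N + 1) μ ∘L QNLS.opBPlus L γ N ν) μ ν f ∧
      -- `d_ν b⁻_μ = (s̃_γ b⁻_ν d_μ)` and `a_μ b⁺_ν = (s̃_γ b⁺_μ a_ν)`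
      QNLS.opD L γ (N + 1) ν (QNLS.opBMinus L γ N μ f) =
        QNLS.momentumSwap γ
          (fun μ ν => QNLS.opBMinus L γ N ν ∘L QNLS.opD L γ N μ) μ ν f ∧
      QNLS.opA L γ (N + 1) μ (QNLS.opBPlus L γ N ν f) =
        QNLS.momentumSwap γ
          (fun μ ν => QNLS.opBPlus L γ N μ ∘L QNLS.opA L γ N ν) μ ν f := by
  refine ⟨⟨QNLS.differentiable_opA hL γ N, QNLS.differentiable_opBPlus hL γ N,
    QNLS.differentiable_opBMinus hL γ N, QNLS.differentiable_opD hL γ N⟩, fun μ f hf =>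
    ⟨QNLS.opA_mem hL γ μ hf, QNLS.opBPlus_mem hL γ μ hf, QNLS.opBMinus_mem hL γ μ hf,
      QNLS.opD_mem hL γ μ hf⟩, fun μ ν f hf => ?_⟩
  have hbb := QNLS.differentiable_bbMinus hL γ N
  have hdb := QNLS.differentiable_dbMinus hL γ N
  have hbd := QNLS.differentiable_bdMinus hL γ N
  have hR := QNLS.reflOp_mem hf
  have hs : Differentiable ℂ fun p : ℂ × ℂ =>
      QNLS.swapOp L (Fin.last N).castSucc (Fin.last (N + 1)) ∘L QNLS.bbMinus L γ N p.1 p.2 :=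
    (differentiable_const _).clm_comp hbb
  -- The relations for `b⁺` and `a` at `f` are those for `b⁻` and `d` at the reflected vector, which
  -- again lies in `𝔷_N`.
  have h1 := (QNLS.swapRelated_bbMinus hL γ hR).reflConj.eq_momentumSwap
    (QNLS.differentiable_reflConj hbb) (QNLS.differentiable_reflConj hs).continuous μ ν
  have h2 := (QNLS.swapRelated_dbMinus hL γ hR).reflConj.eq_momentumSwap
    (QNLS.differentiable_reflConj hdb) (QNLS.differentiable_reflConj hbd).continuous μ ν
  have h3 := (QNLS.swapRelated_dbMinus hL γ hR).symm.reflConj.eq_momentumSwap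
    (QNLS.differentiable_reflConj hbd) (QNLS.differentiable_reflConj hdb).continuous μ ν
  rw [QNLS.reflConj_bbMinus, QNLS.reflConj_swapOp_bbMinus] at h1
  rw [QNLS.reflConj_dbMinus, QNLS.reflConj_bdMinus] at h2 h3
  refine ⟨⟨(QNLS.swapRelated_bbMinus hL γ hf).eq_momentumSwap hbb hs.continuous μ ν,
    QNLS.swapOp_last_mem L γ (QNLS.opBMinus_mem hL γ ν (QNLS.opBMinus_mem hL γ μ hf))⟩,
    ⟨h1, QNLS.swapOp_zero_one_mem L γ (QNLS.opBPlus_mem hL γ μ (QNLS.opBPlus_mem hL γ ν hf))⟩,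
    (QNLS.swapRelated_dbMinus hL γ hf).eq_momentumSwap hdb hbd.continuous μ ν, h2,
    (QNLS.swapRelated_dbMinus hL γ hf).symm.eq_momentumSwap hbd hdb.continuous μ ν, h3⟩
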